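/- **Setting.** Let $\mathbb T=\mathbb R/\mathbb Z$ and $T>0$. For $\sigma\ge 0$, $H^\sigma=H^\sigma(\mathbb T)$ is the space of real $g\in L^2(\mathbb T)$ with $\|g\|_{H^\sigma}^2=\sum_{k\in\mathbb Z}(1+k^2)^{\sigma}|\hat g(k)|^2<\infty$; for $\sigma>1/2$ its elements are identified with their continuous representatives. Let $S(t)=e^{t\partial_x^2}$ be the heat semigroup on $L^2(\mathbb T)$. For real $k\ge 0$ let $$G^k=\Big\{f\in L^1(\mathbb T\times\mathbb R):\ \|f\|_{G^k}=\iint(1+|v|^k)|f(x,v)|\,dx\,dv<\infty\Big\},\qquad G^k_0=G^k\cap\Big\{f\ge 0,\ \iint f\,dx\,dv=1\Big\},$$ and write $\rho(f)(x)=\int f(x,v)\,dv$, $J(f)(x)=\int v f(x,v)\,dv$. Let $E$ be a real normed space continuously embedded in $W^{2,\infty}(\mathbb T)$ and let $m:[0,T]\to E$ be a càdlàg path. For $w=m+u$ with $u\in C([0,T];H^\beta)$, $\beta>3/2$, let $\Phi^t_s=(X^t_s,V^t_s)$, $s,t\in[0,T]$, be the flow on $\mathbb T\times\mathbb R$ of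 the characteristics, understood in integral form, $$\frac{d}{ds}X^t_s=V^t_s,\qquad \frac{d}{ds}V^t_s=w_s(X^t_s)-V^t_s,\qquad (X^t_t,V^t_t)(x,v)=(x,v).$$ **Proposition 3.1.** Let $f_0\in L^1(\mathbb T\times\mathbb R)$ be real-valued and weakly differentiable with $$\iint(1+|v|^4)|f_0|^2\,dx\,dv+\iint(1+|v|)\,|\nabla_{x,v}f_0|\,dx\,dv<\infty,$$ and let $u_0\in H^\eta$ with $\eta\in(3/2,2)$. Consider the system $$\partial_t f+v\,\partial_x f+\partial_v[(m+u-v)f]=0,\qquad \partial_t u-\partial_x^2u=J(f)-\rho(f)\,u$$ on $[0,T]$ with initial data $(f_0,u_0)$. A pair $(f,u)$ with $f:[0,T]\to L^1(\mathbb T\times\mathbb R)$ and $u$ a path of continuous functions on $\mathbb T$ is called a mild solution if, for all $t\in[0,T]$, $$f_t=e^{t}f_0\circ\Phi^t_0\ \text{ a.e., where }\Phi\text{ is the flow associated with }w=m+u,$$ $$u_t=S(t)u_0+\int_0^tS(t-s)\big[J(f_s)-\rho(f_s)u_s\big]\,ds,$$ where $vf_s\in L^1(\mathbb T\times\mathbb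 R)$ and $J(f_s)-\rho(f_s)u_s\in L^2(\mathbb T)$ for all $s\in[0,T]$, and the last integral is a convergent Bochner integral in $L^2(\mathbb T)$. Then there exists a mild solution $(f,u)$ such that $u\in C([0,T];H^\beta)$ for every $\beta\in(3/2,\eta)$, and for each single $\beta\in(3/2,\eta)$ it is the only mild solution with $u\in C([0,T];H^\beta)$. Moreover, for every real $k\ge0$: if $f_0\in G^k$ then $f\in C([0,T];G^k)$, and if $f_0\in G^k_0$ then $f\in C([0,T];G^k_0)$. -/

import Mathlib

open MeasureTheory Set Filter Topology
open scoped ENNReal ContDiff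

namespace KineticFluid

/-- The one-dimensional torus `ℝ/ℤ`. Its `volume` is the Haar probability measure, and the phase
space `Torus × ℝ` carries the product of it with Lebesgue measure. -/
abbrev Torus : Type := UnitAddCircle

/-- `L¹(𝕋 × ℝ)`, as a space of classes modulo almost everywhere equality. -/
abbrev L1xv : Type := Lp ℝ 1 (volume : Measure (Torus × ℝ))

/-- `L²(𝕋; ℂ)`, as a space of classes modulo almost everywhere equality. -/
abbrev L2x : Type := Lp ℂ 2 (AddCircle.haarAddCircle : Measure Torus)

/-! ### The spaces `W^{2,∞}(𝕋)`, càdlàg paths -/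

/-- `h` is a weak derivative of `g` on the torus; the test functions are the smooth functions on
the torus, i.e. the functions whose `1`-periodic lift to `ℝ` is smooth. -/
def IsWeakDeriv (g h : Torus → ℝ) : Prop :=
  ∀ φ : Torus → ℝ, ContDiff ℝ ∞ (fun x : ℝ => φ (x : Torus)) →
    ∫ x, g x * deriv (fun r : ℝ => φ (x + (r : Torus))) 0 = - ∫ x, h x * φ x

/-- The function `g` belongs to `W^{2,∞}(𝕋)`, with
`‖g‖_∞ + ‖g'‖_∞ + ‖g''‖_∞ ≤ M`, where the derivatives are weak derivatives. -/
def W2InftyNormLE (g : Torus → ℝ) (M : ℝ) : Prop :=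
  ∃ g' g'' : Torus → ℝ,
    MemLp g ∞ volume ∧ MemLp g' ∞ volume ∧ MemLp g'' ∞ volume ∧
    IsWeakDeriv g g' ∧ IsWeakDeriv g' g'' ∧
    eLpNorm g ∞ volume + eLpNorm g' ∞ volume + eLpNorm g'' ∞ volume ≤ ENNReal.ofReal M

/-- The path `m` is càdlàg on `[0,T]`: right-continuous on `[0,T)` with left limits on `(0,T]`. -/
def IsCadlagOn {E : Type*} [TopologicalSpace E] (T : ℝ) (m : ℝ → E) : Prop :=
  (∀ t ∈ Ico 0 T, ContinuousWithinAt m (Ici t) t) ∧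
  (∀ t ∈ Ioc 0 T, ∃ l, Tendsto m (𝓝[<] t) (𝓝 l))

/-! ### Weak gradients on the phase space -/

/-- `(gx, gv)` is the weak gradient of `f` on `𝕋 × ℝ`, tested against smooth compactly supported
functions. -/
def IsWeakGradient (f gx gv : Torus × ℝ → ℝ) : Prop :=
  ∀ φ : Torus × ℝ → ℝ,
    ContDiff ℝ ∞ (fun p : ℝ × ℝ => φ ((p.1 : Torus), p.2)) → HasCompactSupport φ →
    (∫ z, f z * deriv (fun r : ℝ => φ (z.1 + (r : Torus), z.2)) 0 = - ∫ z, gx z * φ z) ∧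
    (∫ z, f z * deriv (fun r : ℝ => φ (z.1, z.2 + r)) 0 = - ∫ z, gv z * φ z)

/-- `∬ (1 + |v|) |∇_{x,v} f| dx dv < ∞`, where the gradient is the weak one. -/
def HasWeightedIntegrableGradient (f : Torus × ℝ → ℝ) : Prop :=
  ∃ gx gv : Torus × ℝ → ℝ, IsWeakGradient f gx gv ∧
    Integrable (fun z => (1 + |z.2|) * gx z) ∧ Integrable (fun z => (1 + |z.2|) * gv z)

/-! ### Sobolev spaces `H^σ(𝕋)`

For `σ > 1/2` every element of `H^σ(𝕋)` has a unique continuous representative, with which it is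
identified; this is the only range of `σ` that is used. -/

/-- The square of the `H^σ(𝕋)` norm, `∑ₖ (1 + k²)^σ |ĝ(k)|²`, possibly infinite. -/
noncomputable def sobolevNormSq (σ : ℝ) (g : C(Torus, ℝ)) : ℝ≥0∞ :=
  ∑' k : ℤ, ENNReal.ofReal ((1 + (k : ℝ) ^ 2) ^ σ) *
    ‖fourierCoeff (fun x : Torus => ((g x : ℝ) : ℂ)) k‖ₑ ^ 2

/-- `g ∈ H^σ(𝕋)`. -/
def MemH (σ : ℝ) (g : C(Torus, ℝ)) : Prop := sobolevNormSq σ g < ⊤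

/-- `u ∈ C([0,T]; H^σ(𝕋))`. -/
def ContinuousInH (T σ : ℝ) (u : ℝ → C(Torus, ℝ)) : Prop :=
  ∀ t ∈ Icc 0 T, MemH σ (u t) ∧
    Tendsto (fun s => sobolevNormSq σ (u s - u t)) (𝓝[Icc 0 T] t) (𝓝 0)

/-! ### The spaces `G^k` and `G^k_0` -/

/-- The norm `‖f‖_{G^k} = ∬ (1 + |v|^k) |f(x,v)| dx dv`, possibly infinite. -/
noncomputable def gNorm (k : ℝ) (f : L1xv) : ℝ≥0∞ :=
  ∫⁻ z, ENNReal.ofReal (1 + |z.2| ^ k) * ‖f z‖ₑ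

/-- `f ∈ G^k`. -/
def MemG (k : ℝ) (f : L1xv) : Prop := gNorm k f < ⊤

/-- `f ∈ G^k_0`, i.e. `f ∈ G^k` and `f` is a probability density. -/
def MemG0 (k : ℝ) (f : L1xv) : Prop := MemG k f ∧ 0 ≤ f ∧ ∫ z, f z = 1

/-- `f ∈ C([0,T]; G^k)`. -/
def ContinuousInG (T k : ℝ) (f : ℝ → L1xv) : Prop :=
  ∀ t ∈ Icc 0 T, MemG k (f t) ∧
    Tendsto (fun s => gNorm k (f s - f t)) (𝓝[Icc 0 T] t) (𝓝 0)

/-- The density `ρ(f)(x) = ∫ f(x,v) dv`. -/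
noncomputable def density (f : L1xv) (x : Torus) : ℝ := ∫ v : ℝ, f (x, v)

/-- The momentum `J(f)(x) = ∫ v f(x,v) dv`. -/
noncomputable def momentum (f : L1xv) (x : Torus) : ℝ := ∫ v : ℝ, v * f (x, v)

/-! ### Characteristics -/

/-- `(X s t z, V s t z) = Φ_s^t(z)`, for `s, t ∈ [0,T]`, is the flow of the characteristics
`dX/ds = V`, `dV/ds = w_s(X) - V`, with `(X,V) = z` at `s = t`. As `w` is only càdlàg in time, the
differential system is understood in integral form. -/
def IsCharacteristicFlow (T : ℝ) (w : ℝ → Torus → ℝ)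
    (X : ℝ → ℝ → Torus × ℝ → Torus) (V : ℝ → ℝ → Torus × ℝ → ℝ) : Prop :=
  ∀ t ∈ Icc 0 T, ∀ z : Torus × ℝ,
    ContinuousOn (fun s => V s t z) (Icc 0 T) ∧
    IntervalIntegrable (fun r => w r (X r t z)) volume 0 T ∧
    ∀ s ∈ Icc 0 T,
      X s t z = z.1 + ((∫ r in t..s, V r t z : ℝ) : Torus) ∧
      V s t z = z.2 + ∫ r in t..s, (w r (X r t z) - V r t z)

/-- `f_t = f_t[w] = e^t f₀ ∘ Φ_0^t` for all `t ∈ [0,T]`: transport of `f₀` along the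
characteristics associated with `w`. -/
def IsTransported (T : ℝ) (w : ℝ → Torus → ℝ) (f₀ : L1xv) (f : ℝ → L1xv) : Prop :=
  ∃ (X : ℝ → ℝ → Torus × ℝ → Torus) (V : ℝ → ℝ → Torus × ℝ → ℝ),
    IsCharacteristicFlow T w X V ∧
    ∀ t ∈ Icc 0 T, (f t : Torus × ℝ → ℝ) =ᵐ[volume]
      fun z => Real.exp t * f₀ (X 0 t z, V 0 t z)

/-! ### Heat semigroup and mild solutions -/

/-- The heat semigroup `S(t) = exp(t ∂ₓ²)`, `t ≥ 0`, on `L²(𝕋)`: the Fourier multiplier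
`exp(-4π²k²t)`. -/
noncomputable def heat (t : ℝ) (g : L2x) : L2x :=
  ∑' k : ℤ, ((Real.exp (-(4 * Real.pi ^ 2 * (k : ℝ) ^ 2 * t)) : ℝ) : ℂ) •
    (fourierCoeff (g : Torus → ℂ) k • fourierLp 2 k)

/-- The class in `L²(𝕋; ℂ)` of a continuous real function. -/
noncomputable def toL2 (g : C(Torus, ℝ)) : L2x :=
  ContinuousMap.toLp 2 AddCircle.haarAddCircle ℂ
    (⟨fun x => ((g x : ℝ) : ℂ), Complex.continuous_ofReal.comp g.continuous⟩ : C(Torus, ℂ))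

/-- The mild formulation `u_t = S(t)u₀ + ∫_0^t S(t-s)[J(f_s) - ρ(f_s) u_s] ds`, `t ∈ [0,T]`,
of the heat equation. `J(f_s)` makes sense, the source term, denoted `G s`, is in `L²(𝕋)`, and the
integral is a (convergent) Bochner integral in `L²(𝕋)`. -/
def IsHeatMild (T : ℝ) (u₀ : C(Torus, ℝ)) (f : ℝ → L1xv) (u : ℝ → C(Torus, ℝ)) : Prop :=
  ∃ G : ℝ → L2x,
    (∀ s ∈ Icc 0 T,
      Integrable (fun z : Torus × ℝ => z.2 * f s z) ∧
      (G s : Torus → ℂ) =ᵐ[AddCircle.haarAddCircle]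
        fun x => ((momentum (f s) x - density (f s) x * u s x : ℝ) : ℂ)) ∧
    ∀ t ∈ Icc 0 T,
      IntervalIntegrable (fun s => heat (t - s) (G s)) volume 0 t ∧
      toL2 (u t) = heat t (toL2 u₀) + ∫ s in (0 : ℝ)..t, heat (t - s) (G s)

/-- `(f, u)` is a (mild) solution on `[0,T]`, with initial data `(f₀, u₀)`, of the system
`∂_t f + v ∂_x f + ∂_v[(m + u - v) f] = 0`, `∂_t u - ∂_x² u = J(f) - ρ(f) u`. -/
def IsMildSolution (T : ℝ) (m : ℝ → Torus → ℝ) (f₀ : L1xv) (u₀ : C(Torus, ℝ))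
    (f : ℝ → L1xv) (u : ℝ → C(Torus, ℝ)) : Prop :=
  IsTransported T (fun t x => m t x + u t x) f₀ f ∧ IsHeatMild T u₀ f u

end KineticFluid

namespace KineticFluid

/-! ### Fixed points in weighted spaces of paths, integral Gronwall inequality -/

theorem nonpos_of_weighted_contraction {I : Set ℝ} {wt g : ℝ → ℝ} {N : ℝ} (hN : 0 ≤ N)
    (hg : ∀ s ∈ I, g s ≤ N * wt s)
    (h : ∀ N, 0 ≤ N → (∀ s ∈ I, g s ≤ N * wt s) → ∀ s ∈ I, g s ≤ N / 2 * wt s) :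
    ∀ s ∈ I, g s ≤ 0 := by
  have key : ∀ n : ℕ, ∀ s ∈ I, g s ≤ N * (1 / 2) ^ n * wt s := by
    intro n
    induction n with
    | zero => simpa using hg
    | succ n ih =>
      intro s hs
      have := h _ (by positivity) ih s hs
      calc g s ≤ _ := this
        _ = _ := by ring
  intro s hs
  have h0 : Tendsto (fun n : ℕ => N * (1 / 2 : ℝ) ^ n * wt s) atTop (𝓝 (N * 0 * wt s)) :=
    ((tendsto_pow_atTop_nhds_zero_of_lt_one (by norm_num) (by norm_num)).const_mul N).mul_const _
  have := ge_of_tendsto' h0 (fun n => key n s hs)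
  simpa using this

theorem exists_fixedPoint_of_weighted_contraction {Y : Type*} [NormedAddCommGroup Y]
    [CompleteSpace Y] {I : Set ℝ} {wt : ℝ → ℝ} {B : ℝ}
    (hwtB : ∀ s ∈ I, wt s ≤ B) (S : Set (ℝ → Y))
    (Γ : (ℝ → Y) → ℝ → Y) (hΓ : MapsTo Γ S S)
    (hcontr : ∀ y ∈ S, ∀ y' ∈ S, ∀ N, 0 ≤ N → (∀ s ∈ I, ‖y s - y' s‖ ≤ N * wt s) →
      ∀ s ∈ I, ‖Γ y s - Γ y' s‖ ≤ N / 2 * wt s)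
    (hclosed : ∀ (y : ℕ → ℝ → Y) (z : ℝ → Y), (∀ n, y n ∈ S) →
      TendstoUniformlyOn y z atTop I → z ∈ S)
    {y₀ : ℝ → Y} (hy₀ : y₀ ∈ S) {N : ℝ} (hN : 0 ≤ N)
    (hbd : ∀ s ∈ I, ‖Γ y₀ s - y₀ s‖ ≤ N * wt s) :
    ∃ y ∈ S, ∀ s ∈ I, Γ y s = y s := by
  set y : ℕ → ℝ → Y := fun n => Γ^[n] y₀ with hy
  have hyS : ∀ n, y n ∈ S := by
    intro n
    induction n with
    | zero => exact hy₀
    | succ n ih => simp only [hy, Function.iterate_succ_apply']; exact hΓ ih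
  have hstep : ∀ n, ∀ s ∈ I, ‖y (n + 1) s - y n s‖ ≤ N * (1 / 2) ^ n * wt s := by
    intro n
    induction n with
    | zero => simpa [hy] using hbd
    | succ n ih =>
      intro s hs
      have := hcontr _ (hyS (n + 1)) _ (hyS n) _ (by positivity) ih s hs
      have e1 : y (n + 1 + 1) = Γ (y (n + 1)) := by simp only [hy, Function.iterate_succ_apply']
      have e2 : y (n + 1) = Γ (y n) := by simp only [hy, Function.iterate_succ_apply']
      rw [e1]
      nth_rewrite 2 [e2]
      calc _ ≤ _ := this
        _ = _ := by ring
  have hdist : ∀ s ∈ I, ∀ n, dist (y n s) (y (n + 1) s) ≤ (2 * N * wt s) / 2 / 2 ^ n := by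
    intro s hs n
    rw [dist_comm, dist_eq_norm]
    refine (hstep n s hs).trans (le_of_eq ?_)
    rw [one_div, inv_pow]; field_simp
  have hlim : ∀ s, ∃ l, s ∈ I → Tendsto (fun n => y n s) atTop (𝓝 l) := by
    intro s
    by_cases hs : s ∈ I
    · obtain ⟨l, hl⟩ := cauchySeq_tendsto_of_complete (cauchySeq_of_le_geometric_two (hdist s hs))
      exact ⟨l, fun _ => hl⟩
    · exact ⟨0, fun h => absurd h hs⟩
  choose z hz using hlim
  have hrate : ∀ n, ∀ s ∈ I, ‖y n s - z s‖ ≤ 2 * N * (1 / 2) ^ n * wt s := by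
    intro n s hs
    have := dist_le_of_le_geometric_two_of_tendsto (hdist s hs) (hz s hs) n
    rw [← dist_eq_norm]
    refine this.trans (le_of_eq ?_)
    rw [one_div, inv_pow]; field_simp
  have htend0 : ∀ c : ℝ, Tendsto (fun n : ℕ => 2 * N * (1 / 2 : ℝ) ^ n * c) atTop (𝓝 0) := by
    intro c
    have h0 : Tendsto (fun n : ℕ => 2 * N * (1 / 2 : ℝ) ^ n * c) atTop (𝓝 (2 * N * 0 * c)) :=
      ((tendsto_pow_atTop_nhds_zero_of_lt_one (by norm_num) (by norm_num)).const_mul _).mul_const _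
    simpa using h0
  have hunif : TendstoUniformlyOn y z atTop I := by
    rw [Metric.tendstoUniformlyOn_iff]
    intro ε hε
    filter_upwards [(htend0 B).eventually (gt_mem_nhds hε)] with n hn s hs
    rw [dist_comm, dist_eq_norm]
    refine (hrate n s hs).trans_lt (lt_of_le_of_lt ?_ hn)
    exact mul_le_mul_of_nonneg_left (hwtB s hs) (by positivity)
  have hzS := hclosed y z hyS hunif
  refine ⟨z, hzS, fun s hs => ?_⟩
  have hconv : Tendsto (fun n => y (n + 1) s) atTop (𝓝 (Γ z s)) := by
    rw [tendsto_iff_norm_sub_tendsto_zero]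
    refine squeeze_zero (fun _ => norm_nonneg _) (fun n => ?_) (htend0 (wt s / 2))
    have := hcontr _ (hyS n) _ hzS _ (by positivity) (hrate n) s hs
    have e2 : y (n + 1) = Γ (y n) := by simp only [hy, Function.iterate_succ_apply']
    rw [e2]
    refine this.trans (le_of_eq (by ring))
  exact tendsto_nhds_unique hconv ((hz s hs).comp (tendsto_add_atTop_nat 1))

theorem abs_integral_exp_abs_le {l : ℝ} (hl : 0 < l) (t s : ℝ) :
    |∫ r in t..s, Real.exp (l * |r - t|)| ≤ Real.exp (l * |s - t|) / l := by
  have key : ∀ a : ℝ, 0 ≤ a → ∫ r in (0 : ℝ)..a, Real.exp (l * |r|) = (Real.exp (l * a) - 1) / l := by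
    intro a ha
    have : ∫ r in (0 : ℝ)..a, Real.exp (l * |r|) = ∫ r in (0 : ℝ)..a, Real.exp (l * r) := by
      refine intervalIntegral.integral_congr fun r hr => ?_
      rw [uIcc_of_le ha] at hr
      simp only [abs_of_nonneg hr.1]
    rw [this, intervalIntegral.integral_comp_mul_left (fun x => Real.exp x) hl.ne', integral_exp]
    simp [div_eq_inv_mul]
  have e : ∫ r in t..s, Real.exp (l * |r - t|) = ∫ r in (0 : ℝ)..(s - t), Real.exp (l * |r|) := by
    rw [intervalIntegral.integral_comp_sub_right (fun x => Real.exp (l * |x|))]; simp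
  rw [e]
  have hpos : ∀ a : ℝ, 0 ≤ a → |∫ r in (0 : ℝ)..a, Real.exp (l * |r|)| ≤ Real.exp (l * |a|) / l := by
    intro a ha
    rw [key a ha, abs_of_nonneg ha, abs_of_nonneg]
    · gcongr; linarith
    · have : 1 ≤ Real.exp (l * a) := Real.one_le_exp (by positivity)
      exact div_nonneg (by linarith) hl.le
  rcases le_total 0 (s - t) with h | h
  · exact hpos _ h
  · have h2 := hpos (-(s - t)) (by linarith)
    have : ∫ r in (0 : ℝ)..(-(s - t)), Real.exp (l * |r|)
        = - ∫ r in (0 : ℝ)..(s - t), Real.exp (l * |r|) := by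
      have h3 := intervalIntegral.integral_comp_neg (a := 0) (b := s - t)
        (fun x => Real.exp (l * |x|))
      simp only [abs_neg, neg_zero] at h3
      rw [h3, intervalIntegral.integral_symm]
    rwa [this, abs_neg, abs_neg] at h2

theorem abs_integral_le_of_le_exp {l N : ℝ} (hl : 0 < l) (hN : 0 ≤ N) {t s : ℝ} {g : ℝ → ℝ}
    (hg : ∀ r ∈ uIcc t s, |g r| ≤ N * Real.exp (l * |r - t|)) :
    |∫ r in t..s, g r| ≤ N * Real.exp (l * |s - t|) / l := by
  have h1 : |∫ r in t..s, g r| ≤ |∫ r in t..s, N * Real.exp (l * |r - t|)| := by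
    have := intervalIntegral.norm_integral_le_abs_of_norm_le (f := g)
      (g := fun r => N * Real.exp (l * |r - t|)) (a := t) (b := s) (μ := volume) ?_ ?_
    · simpa using this
    · exact ae_restrict_of_forall_mem measurableSet_uIoc
        fun r hr => hg r (uIoc_subset_uIcc hr)
    · exact (by fun_prop : Continuous fun r => N * Real.exp (l * |r - t|)).intervalIntegrable _ _
  refine h1.trans ?_
  rw [intervalIntegral.integral_const_mul, abs_mul, abs_of_nonneg hN, mul_div_assoc]
  exact mul_le_mul_of_nonneg_left (abs_integral_exp_abs_le hl t s) hN

theorem le_exp_of_le_integral {a b : ℝ} {g : ℝ → ℝ} (hg : ContinuousOn g (Icc a b))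
    (hg0 : ∀ s ∈ Icc a b, 0 ≤ g s) {t : ℝ} (ht : t ∈ Icc a b) {A K : ℝ} (hK : 0 < K)
    (h : ∀ s ∈ Icc a b, g s ≤ A + K * |∫ r in t..s, g r|) :
    ∀ s ∈ Icc a b, g s ≤ 2 * A * Real.exp (2 * K * |s - t|) := by
  set wt : ℝ → ℝ := fun s => Real.exp (2 * K * |s - t|) with hwt
  have hwtc : Continuous wt := by fun_prop
  obtain ⟨s₀, hs₀, hmax⟩ := isCompact_Icc.exists_isMaxOn (f := fun s => g s / wt s) ⟨t, ht⟩
    (hg.div hwtc.continuousOn fun s _ => (Real.exp_pos _).ne')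
  set N := g s₀ / wt s₀ with hN
  have hN0 : 0 ≤ N := div_nonneg (hg0 _ hs₀) (Real.exp_pos _).le
  have hle : ∀ s ∈ Icc a b, g s ≤ N * wt s := fun s hs => by
    have : g s / wt s ≤ N := hmax hs
    exact (div_le_iff₀ (Real.exp_pos _)).1 this
  have h1 := h s₀ hs₀
  have h2 : |∫ r in t..s₀, g r| ≤ N * wt s₀ / (2 * K) := by
    refine abs_integral_le_of_le_exp (by positivity) hN0 fun r hr => ?_
    have hr' : r ∈ Icc a b := (uIcc_subset_Icc ht hs₀) hr
    rw [abs_of_nonneg (hg0 _ hr')]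
    exact hle r hr'
  have hgN : g s₀ = N * wt s₀ := by rw [hN, div_mul_cancel₀ _ (Real.exp_pos _).ne']
  have h3 : N * wt s₀ ≤ A + N * wt s₀ / 2 := by
    rw [← hgN]
    refine h1.trans ?_
    have := mul_le_mul_of_nonneg_left h2 hK.le
    have e : K * (N * wt s₀ / (2 * K)) = N * wt s₀ / 2 := by field_simp
    rw [e, hgN.symm] at this
    linarith
  have h4 : 1 ≤ wt s₀ := Real.one_le_exp (by positivity)
  have h5 : N ≤ 2 * A := by nlinarith
  exact fun s hs => (hle s hs).trans (mul_le_mul_of_nonneg_right h5 (Real.exp_pos _).le)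

/-! ### Characteristics of a bounded field, Lipschitz in space and measurable in time -/

structure IsAdmissibleField (T M L : ℝ) (w : ℝ → C(Torus, ℝ)) : Prop where
  aesm : AEStronglyMeasurable w (volume.restrict (Icc 0 T))
  norm_le : ∀ s ∈ Icc 0 T, ‖w s‖ ≤ M
  nonneg : 0 ≤ L
  lip : ∀ s ∈ Icc 0 T, ∀ (x : Torus) (a : ℝ), |w s (x + (a : Torus)) - w s x| ≤ L * |a|

structure IsCharacteristic (T : ℝ) (w : ℝ → C(Torus, ℝ)) (X : ℝ → Torus) (V : ℝ → ℝ) :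
    Prop where
  cont : ContinuousOn V (Icc 0 T)
  pos : ∀ s ∈ Icc 0 T, ∀ t ∈ Icc 0 T, X s = X t + ((∫ r in t..s, V r : ℝ) : Torus)
  vel : ∀ s ∈ Icc 0 T, ∀ t ∈ Icc 0 T, V s = V t + ∫ r in t..s, (w r (X r) - V r)

theorem ContinuousOn.intervalIntegrable_of_mem {E : Type*} [NormedAddCommGroup E] {a b : ℝ}
    {g : ℝ → E} (hg : ContinuousOn g (Icc a b)) {s t : ℝ} (hs : s ∈ Icc a b) (ht : t ∈ Icc a b) :
    IntervalIntegrable g volume s t :=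
  (hg.mono (uIcc_subset_Icc hs ht)).intervalIntegrable

theorem continuousOn_primitive_of_mem {a b : ℝ} {g : ℝ → ℝ}
    (hg : IntegrableOn g (Icc a b)) {t : ℝ} (ht : t ∈ Icc a b) :
    ContinuousOn (fun s => ∫ r in t..s, g r) (Icc a b) := by
  have hab : a ≤ b := ht.1.trans ht.2
  have := intervalIntegral.continuousOn_primitive_interval' (a := t) (b₁ := a) (b₂ := b) (f := g)
    (μ := volume)
    ((intervalIntegrable_iff_integrableOn_Icc_of_le hab).2 hg) (by rwa [uIcc_of_le hab])
  rwa [uIcc_of_le hab] at this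

theorem abs_intervalIntegral_le_of_le {g : ℝ → ℝ} {C a b s t : ℝ} (hs : s ∈ Icc a b)
    (ht : t ∈ Icc a b) (hg : ∀ r ∈ Icc a b, |g r| ≤ C) : |∫ r in t..s, g r| ≤ C * |s - t| := by
  rw [← Real.norm_eq_abs]
  exact intervalIntegral.norm_integral_le_of_norm_le_const fun r hr =>
    hg r (uIcc_subset_Icc ht hs (uIoc_subset_uIcc hr))

namespace IsAdmissibleField

variable {T M L : ℝ} {w : ℝ → C(Torus, ℝ)}

theorem abs_le (hw : IsAdmissibleField T M L w) {s : ℝ} (hs : s ∈ Icc 0 T) (x : Torus) :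
    |w s x| ≤ M :=
  ((w s).norm_coe_le_norm x).trans (hw.norm_le s hs)

theorem mono (hw : IsAdmissibleField T M L w) {T' : ℝ} (h : T' ≤ T) :
    IsAdmissibleField T' M L w where
  aesm := hw.aesm.mono_measure (Measure.restrict_mono (Icc_subset_Icc_right h) le_rfl)
  norm_le s hs := hw.norm_le s ⟨hs.1, hs.2.trans h⟩
  nonneg := hw.nonneg
  lip s hs := hw.lip s ⟨hs.1, hs.2.trans h⟩

theorem integrableOn_comp (hw : IsAdmissibleField T M L w) {X : ℝ → Torus}
    (hX : ContinuousOn X (Icc 0 T)) : IntegrableOn (fun r => w r (X r)) (Icc 0 T) := by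
  have h1 : AEStronglyMeasurable (fun r => w r (X r)) (volume.restrict (Icc 0 T)) := by
    have h2 : AEStronglyMeasurable X (volume.restrict (Icc 0 T)) :=
      hX.aestronglyMeasurable measurableSet_Icc
    exact (continuous_eval (F := C(Torus, ℝ))).comp_aestronglyMeasurable₂ hw.aesm h2
  exact Integrable.of_bound (C := M) h1 (ae_restrict_of_forall_mem measurableSet_Icc fun r hr => hw.abs_le hr _)

end IsAdmissibleField

namespace IsCharacteristic

variable {T M L : ℝ} {w : ℝ → C(Torus, ℝ)} {X : ℝ → Torus} {V : ℝ → ℝ}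

theorem mono (h : IsCharacteristic T w X V) {T' : ℝ} (hT : T' ≤ T) :
    IsCharacteristic T' w X V where
  cont := h.cont.mono (Icc_subset_Icc_right hT)
  pos s hs t ht := h.pos s ⟨hs.1, hs.2.trans hT⟩ t ⟨ht.1, ht.2.trans hT⟩
  vel s hs t ht := h.vel s ⟨hs.1, hs.2.trans hT⟩ t ⟨ht.1, ht.2.trans hT⟩

theorem continuousOn_pos (h : IsCharacteristic T w X V) : ContinuousOn X (Icc 0 T) := by
  intro t ht
  have h1 := continuousOn_primitive_of_mem h.cont.integrableOn_Icc ht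
  have h2 : ContinuousOn (fun s => X t + ((∫ r in t..s, V r : ℝ) : Torus)) (Icc 0 T) :=
    continuousOn_const.add ((AddCircle.continuous_mk' 1).comp_continuousOn h1)
  exact (h2.congr fun s hs => h.pos s hs t ht) t ht

end IsCharacteristic

theorem IsCharacteristicFlow.isCharacteristic {T : ℝ} {w : ℝ → C(Torus, ℝ)}
    {X : ℝ → ℝ → Torus × ℝ → Torus} {V : ℝ → ℝ → Torus × ℝ → ℝ}
    (h : IsCharacteristicFlow T (fun t x => w t x) X V) {t : ℝ} (ht : t ∈ Icc 0 T)
    (z : Torus × ℝ) :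
    IsCharacteristic T w (fun s => X s t z) (fun s => V s t z) ∧ X t t z = z.1 ∧ V t t z = z.2 := by
  obtain ⟨hc, hi, he⟩ := h t ht z
  have h0T : (0 : ℝ) ≤ T := ht.1.trans ht.2
  have hwi : ∀ a ∈ Icc 0 T, ∀ b ∈ Icc 0 T,
      IntervalIntegrable (fun r => w r (X r t z) - V r t z) volume a b := by
    intro a ha b hb
    refine IntervalIntegrable.sub (hi.mono_set ?_) (ContinuousOn.intervalIntegrable_of_mem hc ha hb)
    rw [uIcc_of_le h0T]
    exact uIcc_subset_Icc ha hb
  refine ⟨⟨hc, fun s hs s' hs' => ?_, fun s hs s' hs' => ?_⟩, ?_, ?_⟩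
  · rw [(he s hs).1, (he s' hs').1, add_assoc, ← AddCircle.coe_add,
      intervalIntegral.integral_add_adjacent_intervals
        (ContinuousOn.intervalIntegrable_of_mem hc ht hs')
        (ContinuousOn.intervalIntegrable_of_mem hc hs' hs)]
  · have := intervalIntegral.integral_add_adjacent_intervals (hwi t ht s' hs') (hwi s' hs' s hs)
    rw [(he s hs).2, (he s' hs').2, add_assoc]
    simp only
    rw [this]
  · simpa using (he t ht).1
  · simpa using (he t ht).2

/-- Stability of characteristics with respect to the data and to the field. -/
theorem IsCharacteristic.stability {T M L M' L' : ℝ} {w w' : ℝ → C(Torus, ℝ)}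
    {X X' : ℝ → Torus} {V V' : ℝ → ℝ} (hw : IsAdmissibleField T M L w)
    (hw' : IsAdmissibleField T M' L' w')
    (h : IsCharacteristic T w X V) (h' : IsCharacteristic T w' X' V') {t : ℝ} (ht : t ∈ Icc 0 T)
    {d e : ℝ} (hd : X' t = X t + (d : Torus)) (he : ∀ r ∈ Icc 0 T, ‖w r - w' r‖ ≤ e) :
    ∀ s ∈ Icc 0 T, ∃ d' : ℝ, X' s = X s + (d' : Torus) ∧
      |d'| + |V' s - V s| ≤
        2 * (|d| + |V' t - V t| + e * T) * Real.exp (2 * (2 + L) * T) := by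
  have h0T : (0 : ℝ) ≤ T := ht.1.trans ht.2
  have hL := hw.nonneg
  have he0 : 0 ≤ e := (norm_nonneg _).trans (he t ht)
  have hVV : ContinuousOn (fun r => V' r - V r) (Icc 0 T) := h'.cont.sub h.cont
  set D : ℝ → ℝ := fun s => d + ∫ r in t..s, (V' r - V r) with hD
  have hDc : ContinuousOn D (Icc 0 T) :=
    continuousOn_const.add (continuousOn_primitive_of_mem hVV.integrableOn_Icc ht)
  have hX : ∀ s ∈ Icc 0 T, X' s = X s + (D s : Torus) := by
    intro s hs
    rw [h'.pos s hs t ht, h.pos s hs t ht, hd, hD]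
    simp only
    rw [intervalIntegral.integral_sub (ContinuousOn.intervalIntegrable_of_mem h'.cont ht hs)
      (ContinuousOn.intervalIntegrable_of_mem h.cont ht hs), add_assoc, add_assoc,
      ← AddCircle.coe_add, ← AddCircle.coe_add]
    congr 2
    ring
  set g : ℝ → ℝ := fun s => |D s| + |V' s - V s| with hg
  have hgc : ContinuousOn g (Icc 0 T) := hDc.abs.add hVV.abs
  have hg0 : ∀ s, 0 ≤ g s := fun s => by positivity
  have i1 := hw.integrableOn_comp h.continuousOn_pos
  have i2 := hw'.integrableOn_comp h'.continuousOn_pos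
  have hii : ∀ {f : ℝ → ℝ}, IntegrableOn f (Icc 0 T) → ∀ s ∈ Icc 0 T,
      IntervalIntegrable f volume t s := fun hf s hs =>
    (intervalIntegrable_iff.2 (hf.mono_set
      (uIoc_subset_uIcc.trans (uIcc_subset_Icc ht hs))))
  have hbase : ∀ s ∈ Icc 0 T,
      g s ≤ (|d| + |V' t - V t| + e * T) + (2 + L) * |∫ r in t..s, g r| := by
    intro s hs
    have hsT : |s - t| ≤ T := by
      rw [abs_le]; constructor <;> linarith [hs.1, hs.2, ht.1, ht.2]
    have hgi : IntervalIntegrable g volume t s := ContinuousOn.intervalIntegrable_of_mem hgc ht hs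
    have b1 : |∫ r in t..s, (V' r - V r)| ≤ |∫ r in t..s, g r| := by
      have := intervalIntegral.norm_integral_le_abs_of_norm_le (f := fun r => V' r - V r)
        (g := g) (a := t) (b := s) (μ := volume)
        (ae_of_all _ fun r => by simp only [hg, Real.norm_eq_abs]; linarith [abs_nonneg (D r)]) hgi
      simpa using this
    have b2 : |∫ r in t..s, ((w' r (X' r) - V' r) - (w r (X r) - V r))|
        ≤ |∫ r in t..s, (e + (1 + L) * g r)| := by
      have := intervalIntegral.norm_integral_le_abs_of_norm_le
        (f := fun r => (w' r (X' r) - V' r) - (w r (X r) - V r))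
        (g := fun r => e + (1 + L) * g r) (a := t) (b := s) (μ := volume)
        (ae_restrict_of_forall_mem measurableSet_uIoc fun r hr => ?_)
        (intervalIntegrable_const.add (hgi.const_mul _))
      · simpa using this
      · have hr' : r ∈ Icc 0 T := uIcc_subset_Icc ht hs (uIoc_subset_uIcc hr)
        have c1 : |w' r (X' r) - w r (X' r)| ≤ e := by
          have := (w r - w' r).norm_coe_le_norm (X' r)
          rw [ContinuousMap.sub_apply, norm_sub_rev] at this
          exact this.trans (he r hr')
        have c2 : |w r (X' r) - w r (X r)| ≤ L * |D r| := by
          rw [hX r hr']; exact hw.lip r hr' _ _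
        have c3 : (w' r (X' r) - V' r) - (w r (X r) - V r) =
          (w' r (X' r) - w r (X' r)) + (w r (X' r) - w r (X r)) - (V' r - V r) := by ring
        rw [Real.norm_eq_abs, c3]
        refine (abs_sub _ _).trans ?_
        have := abs_add_le (w' r (X' r) - w r (X' r)) (w r (X' r) - w r (X r))
        simp only [hg]
        nlinarith [abs_nonneg (D r), abs_nonneg (V' r - V r), mul_nonneg hL (abs_nonneg (V' r - V r))]
    have b3 : |∫ r in t..s, (e + (1 + L) * g r)| ≤ e * T + (1 + L) * |∫ r in t..s, g r| := by
      rw [intervalIntegral.integral_add intervalIntegrable_const (hgi.const_mul _),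
        intervalIntegral.integral_const, intervalIntegral.integral_const_mul]
      refine (abs_add_le _ _).trans ?_
      rw [abs_mul, abs_of_nonneg (by linarith : 0 ≤ 1 + L), smul_eq_mul, abs_mul, abs_of_nonneg he0,
        mul_comm]
      gcongr
    have e1 : V' s - V s = (V' t - V t)
        + ∫ r in t..s, ((w' r (X' r) - V' r) - (w r (X r) - V r)) := by
      rw [h'.vel s hs t ht, h.vel s hs t ht, intervalIntegral.integral_sub
        ((hii i2 s hs).sub (ContinuousOn.intervalIntegrable_of_mem h'.cont ht hs))
        ((hii i1 s hs).sub (ContinuousOn.intervalIntegrable_of_mem h.cont ht hs))]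
      ring
    have c1 : |D s| ≤ |d| + |∫ r in t..s, (V' r - V r)| := abs_add_le _ _
    have c2 : |V' s - V s| ≤ |V' t - V t|
        + |∫ r in t..s, ((w' r (X' r) - V' r) - (w r (X r) - V r))| := by
      rw [e1]; exact abs_add_le _ _
    simp only [hg] at *
    linarith
  intro s hs
  refine ⟨D s, hX s hs, ?_⟩
  have hsT : |s - t| ≤ T := by
    rw [abs_le]; constructor <;> linarith [hs.1, hs.2, ht.1, ht.2]
  refine (le_exp_of_le_integral hgc (fun s _ => hg0 s) ht (by linarith : 0 < 2 + L) hbase s hs).trans ?_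
  gcongr

theorem exists_isCharacteristic {T M L : ℝ} {w : ℝ → C(Torus, ℝ)} (hw : IsAdmissibleField T M L w)
    {t : ℝ} (ht : t ∈ Icc 0 T) (z : Torus × ℝ) :
    ∃ (X : ℝ → Torus) (V : ℝ → ℝ), IsCharacteristic T w X V ∧ X t = z.1 ∧ V t = z.2 := by
  have h0T : (0 : ℝ) ≤ T := ht.1.trans ht.2
  have hL := hw.nonneg
  set l : ℝ := 2 * (L + 1) with hl
  have hl2 : 2 ≤ l := by linarith
  have hl0 : 0 < l := by linarith
  set P : (ℝ → ℝ) → ℝ → Torus := fun V s => z.1 + ((∫ r in t..s, V r : ℝ) : Torus) with hP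
  set Γ : (ℝ → ℝ) → ℝ → ℝ := fun V s => z.2 + ∫ r in t..s, (w r (P V r) - V r) with hΓ
  have hPc : ∀ V : ℝ → ℝ, ContinuousOn V (Icc 0 T) → ContinuousOn (P V) (Icc 0 T) := fun V hV =>
    continuousOn_const.add ((AddCircle.continuous_mk' 1).comp_continuousOn
      (continuousOn_primitive_of_mem hV.integrableOn_Icc ht))
  have hint : ∀ V : ℝ → ℝ, ContinuousOn V (Icc 0 T) →
      IntegrableOn (fun r => w r (P V r) - V r) (Icc 0 T) := fun V hV =>
    (hw.integrableOn_comp (hPc V hV)).sub hV.integrableOn_Icc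
  have hii : ∀ {f : ℝ → ℝ}, IntegrableOn f (Icc 0 T) → ∀ s' ∈ Icc 0 T, ∀ s ∈ Icc 0 T,
      IntervalIntegrable f volume s' s := fun hf s' hs' s hs =>
    (intervalIntegrable_iff.2 (hf.mono_set
      (uIoc_subset_uIcc.trans (uIcc_subset_Icc hs' hs))))
  have hmap : ∀ V : ℝ → ℝ, ContinuousOn V (Icc 0 T) → ContinuousOn (Γ V) (Icc 0 T) := fun V hV =>
    continuousOn_const.add (continuousOn_primitive_of_mem (hint V hV) ht)
  obtain ⟨C, hC⟩ : ∃ C, ∀ s ∈ Icc 0 T, ‖Γ (fun _ => 0) s - 0‖ ≤ C :=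
    isCompact_Icc.exists_bound_of_continuousOn ((hmap _ continuousOn_const).sub continuousOn_const)
  have hC0 : 0 ≤ C := (norm_nonneg _).trans (hC t ht)
  obtain ⟨V, hV, hfix⟩ := exists_fixedPoint_of_weighted_contraction (Y := ℝ) (I := Icc 0 T)
    (wt := fun s => Real.exp (l * |s - t|)) (B := Real.exp (l * T))
    (fun s hs => by
      have hsT : |s - t| ≤ T := by
        rw [_root_.abs_le]; constructor <;> linarith [hs.1, hs.2, ht.1, ht.2]
      gcongr)
    {V | ContinuousOn V (Icc 0 T)} Γ hmap
    (by
      intro V hV V' hV' N hN hVV s hs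
      have hVc : ContinuousOn (fun r => V r - V' r) (Icc 0 T) := ContinuousOn.sub hV hV'
      have hdiff : Γ V s - Γ V' s
          = ∫ r in t..s, ((w r (P V r) - V r) - (w r (P V' r) - V' r)) := by
        rw [intervalIntegral.integral_sub (hii (hint V hV) t ht s hs)
          (hii (hint V' hV') t ht s hs)]
        simp only [hΓ]; ring
      rw [hdiff, Real.norm_eq_abs]
      have hb : ∀ r ∈ uIcc t s, |(w r (P V r) - V r) - (w r (P V' r) - V' r)|
          ≤ (L / l + 1) * N * Real.exp (l * |r - t|) := by
        intro r hr
        have hr' : r ∈ Icc 0 T := uIcc_subset_Icc ht hs hr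
        have c0 : |∫ r' in t..r, (V r' - V' r')| ≤ N * Real.exp (l * |r - t|) / l :=
          abs_integral_le_of_le_exp hl0 hN fun r' h' =>
            hVV r' (uIcc_subset_Icc ht hr' h')
        have c1 : P V r = P V' r + ((∫ r' in t..r, (V r' - V' r') : ℝ) : Torus) := by
          rw [intervalIntegral.integral_sub (ContinuousOn.intervalIntegrable_of_mem hV ht hr')
            (ContinuousOn.intervalIntegrable_of_mem hV' ht hr')]
          simp only [hP]
          rw [add_assoc, ← AddCircle.coe_add]
          congr 2
          ring
        have c2 : |w r (P V r) - w r (P V' r)| ≤ L * (N * Real.exp (l * |r - t|) / l) := by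
          rw [c1]
          exact (hw.lip r hr' _ _).trans (mul_le_mul_of_nonneg_left c0 hL)
        have c3 := hVV r hr'
        rw [Real.norm_eq_abs] at c3
        have c4 : (w r (P V r) - V r) - (w r (P V' r) - V' r)
          = (w r (P V r) - w r (P V' r)) - (V r - V' r) := by ring
        rw [c4]
        refine (abs_sub _ _).trans ((add_le_add c2 c3).trans (le_of_eq ?_))
        field_simp
      refine (abs_integral_le_of_le_exp hl0 (by positivity) hb).trans ?_
      rw [mul_div_right_comm]
      refine mul_le_mul_of_nonneg_right ?_ (Real.exp_pos _).le
      have : L / l ≤ L := div_le_self hL (by linarith)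
      rw [div_le_div_iff₀ hl0 two_pos]
      nlinarith [mul_le_mul_of_nonneg_right this hN])
    (fun y z hy hz => hz.continuousOn (Filter.Frequently.of_forall hy))
    (y₀ := fun _ => 0) continuousOn_const hC0
    (fun s hs => (hC s hs).trans (le_mul_of_one_le_right hC0 (Real.one_le_exp (by positivity))))
  refine ⟨P V, V, ⟨hV, fun s hs s' hs' => ?_, fun s hs s' hs' => ?_⟩, by simp [hP], ?_⟩
  · simp only [hP]
    rw [add_assoc, ← AddCircle.coe_add, intervalIntegral.integral_add_adjacent_intervals
        (ContinuousOn.intervalIntegrable_of_mem hV ht hs')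
        (ContinuousOn.intervalIntegrable_of_mem hV hs' hs)]
  · rw [← hfix s hs, ← hfix s' hs']
    simp only [hΓ]
    rw [add_assoc, intervalIntegral.integral_add_adjacent_intervals
      (hii (hint V hV) t ht s' hs') (hii (hint V hV) s' hs' s hs)]
  · rw [← hfix t ht]; simp [hΓ]

theorem exists_isCharacteristicFlow {T M L : ℝ} {w : ℝ → C(Torus, ℝ)}
    (hw : IsAdmissibleField T M L w) :
    ∃ (X : ℝ → ℝ → Torus × ℝ → Torus) (V : ℝ → ℝ → Torus × ℝ → ℝ),
      IsCharacteristicFlow T (fun t x => w t x) X V := by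
  have h : ∀ (t : ℝ) (z : Torus × ℝ), ∃ (X : ℝ → Torus) (V : ℝ → ℝ),
      t ∈ Icc 0 T → IsCharacteristic T w X V ∧ X t = z.1 ∧ V t = z.2 := by
    intro t z
    by_cases ht : t ∈ Icc 0 T
    · obtain ⟨X, V, h⟩ := exists_isCharacteristic hw ht z
      exact ⟨X, V, fun _ => h⟩
    · exact ⟨fun _ => 0, fun _ => 0, fun h => absurd h ht⟩
  choose X V h using h
  refine ⟨fun s t z => X t z s, fun s t z => V t z s, fun t ht z => ?_⟩
  obtain ⟨h1, h2, h3⟩ := h t z ht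
  refine ⟨h1.cont, ?_, fun s hs => ⟨?_, ?_⟩⟩
  · exact (intervalIntegrable_iff_integrableOn_Icc_of_le (ht.1.trans ht.2)).2
      (hw.integrableOn_comp h1.continuousOn_pos)
  · simp only
    rw [h1.pos s hs t ht, h2]
  · simp only
    rw [h1.vel s hs t ht, h3]

/-! ### Regularity of the flow, and its action on the Lebesgue measure -/

theorem exists_coe_eq_abs_eq_norm (y : Torus) : ∃ d : ℝ, (d : Torus) = y ∧ |d| = ‖y‖ := by
  induction y using QuotientAddGroup.induction_on with
  | H a =>
    refine ⟨a - round a, ?_, (UnitAddCircle.norm_eq).symm⟩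
    have : ((round a : ℝ) : Torus) = 0 := by
      have := AddCircle.coe_eq_zero_iff (p := (1 : ℝ)) (x := (round a : ℝ))
      exact this.2 ⟨round a, by simp⟩
    rw [AddCircle.coe_sub, this, sub_zero]

theorem norm_coe_torus_le (a : ℝ) : ‖(a : Torus)‖ ≤ |a| :=
  QuotientAddGroup.norm_mk_le_norm (S := AddSubgroup.zmultiples (1 : ℝ)) (m := a)

theorem IsCharacteristic.abs_vel_le {T M L : ℝ} {w : ℝ → C(Torus, ℝ)} {X : ℝ → Torus} {V : ℝ → ℝ}
    (hw : IsAdmissibleField T M L w) (h : IsCharacteristic T w X V) {t s : ℝ} (ht : t ∈ Icc 0 T)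
    (hs : s ∈ Icc 0 T) : |V s| ≤ 2 * (|V t| + M * T) * Real.exp (2 * T) := by
  have h0T : (0 : ℝ) ≤ T := ht.1.trans ht.2
  have hM : 0 ≤ M := (norm_nonneg _).trans (hw.norm_le t ht)
  have hlen : ∀ s ∈ Icc 0 T, |s - t| ≤ T := fun s hs => by
    rw [abs_le]; constructor <;> linarith [hs.1, hs.2, ht.1, ht.2]
  have := le_exp_of_le_integral (g := fun s => |V s|) (a := 0) (b := T) (t := t)
    (A := |V t| + M * T) (K := 1) h.cont.abs (fun _ _ => abs_nonneg _) ht one_pos ?_ s hs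
  · refine this.trans ?_
    rw [mul_one]
    gcongr
    exact hlen s hs
  · intro s hs
    have hi : IntervalIntegrable (fun r => |V r|) volume t s :=
      ContinuousOn.intervalIntegrable_of_mem h.cont.abs ht hs
    have b2 : |∫ r in t..s, (w r (X r) - V r)| ≤ |∫ r in t..s, (M + |V r|)| := by
      have := intervalIntegral.norm_integral_le_abs_of_norm_le
        (f := fun r => w r (X r) - V r)
        (g := fun r => M + |V r|) (a := t) (b := s) (μ := volume)
        (ae_restrict_of_forall_mem measurableSet_uIoc fun r hr => ?_)
        (intervalIntegrable_const.add hi)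
      · simpa using this
      · have hr' : r ∈ Icc 0 T := uIcc_subset_Icc ht hs (uIoc_subset_uIcc hr)
        exact (abs_sub _ _).trans (add_le_add (hw.abs_le hr' _) le_rfl)
    rw [intervalIntegral.integral_add intervalIntegrable_const hi,
      intervalIntegral.integral_const, smul_eq_mul] at b2
    have b3 := abs_add_le ((s - t) • M) (∫ r in t..s, |V r|)
    rw [smul_eq_mul, abs_mul, abs_of_nonneg hM] at b3
    have b4 := mul_le_mul_of_nonneg_right (hlen s hs) hM
    rw [h.vel s hs t ht]
    have := abs_add_le (V t) (∫ r in t..s, (w r (X r) - V r))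
    linarith

/-- The backward flow map `Φ_0^t`. -/
def backFlow (X : ℝ → ℝ → Torus × ℝ → Torus) (V : ℝ → ℝ → Torus × ℝ → ℝ) (t : ℝ)
    (z : Torus × ℝ) : Torus × ℝ := (X 0 t z, V 0 t z)

section Flow

variable {T M L : ℝ} {w : ℝ → C(Torus, ℝ)} {X : ℝ → ℝ → Torus × ℝ → Torus}
  {V : ℝ → ℝ → Torus × ℝ → ℝ}

theorem zero_mem_of_mem {t : ℝ} (ht : t ∈ Icc 0 T) : (0 : ℝ) ∈ Icc 0 T :=
  ⟨le_rfl, ht.1.trans ht.2⟩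

theorem continuous_backFlow (hw : IsAdmissibleField T M L w)
    (h : IsCharacteristicFlow T (fun t x => w t x) X V) {t : ℝ} (ht : t ∈ Icc 0 T) :
    Continuous (backFlow X V t) := by
  set K : ℝ := 2 * Real.exp (2 * (2 + L) * T) with hK
  have hlip : ∀ z z' : Torus × ℝ,
      dist (backFlow X V t z) (backFlow X V t z') ≤ 2 * K * dist z z' := by
    intro z z'
    obtain ⟨c1, p1, v1⟩ := h.isCharacteristic ht z'
    obtain ⟨c2, p2, v2⟩ := h.isCharacteristic ht z
    obtain ⟨d, hd, hdn⟩ := exists_coe_eq_abs_eq_norm (z.1 - z'.1)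
    obtain ⟨d', hd', hb⟩ := c1.stability hw hw c2 ht (d := d) (e := 0)
      (by simp only [p1, p2, hd]; abel) (by simp) 0 (zero_mem_of_mem ht)
    simp only [v1, v2, hdn] at hb
    have e1 : dist z.1 z'.1 ≤ dist z z' := by rw [Prod.dist_eq]; exact le_max_left _ _
    have e2 : dist z.2 z'.2 ≤ dist z z' := by rw [Prod.dist_eq]; exact le_max_right _ _
    rw [dist_eq_norm] at e1 e2
    rw [Real.norm_eq_abs] at e2
    have hKpos : 0 < K := by positivity
    have hb2 : |d'| + |V 0 t z - V 0 t z'| ≤ 2 * K * dist z z' := by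
      refine hb.trans ?_
      have : 2 * (‖z.1 - z'.1‖ + |z.2 - z'.2| + 0 * T) * Real.exp (2 * (2 + L) * T)
        = K * (‖z.1 - z'.1‖ + |z.2 - z'.2|) := by rw [hK]; ring
      rw [this]
      nlinarith
    rw [Prod.dist_eq]
    refine max_le ?_ ?_
    · simp only [backFlow]
      rw [hd', dist_eq_norm, add_sub_cancel_left]
      exact (norm_coe_torus_le d').trans (by linarith [abs_nonneg (V 0 t z - V 0 t z')])
    · simp only [backFlow]
      rw [dist_eq_norm, Real.norm_eq_abs]
      linarith [abs_nonneg d']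
  exact (LipschitzWith.of_dist_le' hlip).continuous

theorem continuousOn_backFlow_time (hw : IsAdmissibleField T M L w)
    (h : IsCharacteristicFlow T (fun t x => w t x) X V) (z : Torus × ℝ) :
    ContinuousOn (fun t => backFlow X V t z) (Icc 0 T) := by
  intro t ht
  obtain ⟨c1, p1, v1⟩ := h.isCharacteristic ht z
  set K : ℝ := 2 * Real.exp (2 * (2 + L) * T) with hK
  have hKpos : 0 < K := by positivity
  set b : ℝ → ℝ := fun s => |-∫ r in t..s, V r t z| + |z.2 - V s t z| with hb
  have hbc : ContinuousOn b (Icc 0 T) :=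
    (continuousOn_primitive_of_mem c1.cont.integrableOn_Icc ht).neg.abs.add
      (continuousOn_const.sub c1.cont).abs
  have hb0 : b t = 0 := by simp [hb, v1]
  have hlim : Tendsto (fun s => K * b s) (𝓝[Icc 0 T] t) (𝓝 0) := by
    have := (hbc t ht).tendsto.const_mul K
    simpa [hb0] using this
  rw [ContinuousWithinAt, tendsto_iff_dist_tendsto_zero]
  refine squeeze_zero' (Eventually.of_forall fun _ => dist_nonneg) ?_ hlim
  filter_upwards [self_mem_nhdsWithin] with s hs
  obtain ⟨c2, p2, v2⟩ := h.isCharacteristic hs z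
  obtain ⟨d', hd', hbd⟩ := c1.stability hw hw c2 hs (d := -∫ r in t..s, V r t z) (e := 0)
    (by
      have := c1.pos s hs t ht
      simp only [p1, p2] at this ⊢
      rw [this, add_assoc, ← AddCircle.coe_add]
      simp)
    (by simp) 0 (zero_mem_of_mem ht)
  simp only [v2] at hbd
  have hb2 : |d'| + |V 0 s z - V 0 t z| ≤ K * b s := by
    refine hbd.trans (le_of_eq ?_)
    rw [hK, hb]; ring
  rw [Prod.dist_eq]
  refine max_le ?_ ?_
  · simp only [backFlow]
    rw [hd', dist_eq_norm, add_sub_cancel_left]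
    exact (norm_coe_torus_le d').trans (by linarith [abs_nonneg (V 0 s z - V 0 t z)])
  · simp only [backFlow]
    rw [dist_eq_norm, Real.norm_eq_abs]
    linarith [abs_nonneg d']

end Flow

/-! ### The splitting scheme -/

/-- One step, backward in time, of a splitting scheme for the characteristics. -/
noncomputable def shearStep (h : ℝ) (B : C(Torus, ℝ)) (z : Torus × ℝ) : Torus × ℝ :=
  (z.1 + ((-(h * ((1 + h) * z.2 - B z.1)) : ℝ) : Torus), (1 + h) * z.2 - B z.1)

theorem measurePreserving_shear (h : ℝ) :
    MeasurePreserving (fun z : Torus × ℝ => (z.1 + ((-(h * z.2) : ℝ) : Torus), z.2)) := by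
  have h1 : MeasurePreserving
      (fun p : ℝ × Torus => (id p.1, p.2 + ((-(h * p.1) : ℝ) : Torus)))
      (volume.prod volume) (volume.prod volume) := by
    refine (MeasurePreserving.id (volume : Measure ℝ)).skew_product
      (g := fun v x => x + ((-(h * v) : ℝ) : Torus)) ?_ (ae_of_all _ fun v => ?_)
    · have : Continuous (Function.uncurry fun (v : ℝ) (x : Torus) => x + ((-(h * v) : ℝ) : Torus)) :=
        continuous_snd.add ((AddCircle.continuous_mk' 1).comp (by fun_prop))
      exact this.measurable
    · exact (measurePreserving_add_right (volume : Measure Torus) _).map_eq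
  have h2 := (Measure.measurePreserving_swap (μ := (volume : Measure ℝ))
    (ν := (volume : Measure Torus))).comp
      (h1.comp (Measure.measurePreserving_swap (μ := (volume : Measure Torus))
        (ν := (volume : Measure ℝ))))
  exact h2

theorem map_kick {h : ℝ} (hh : 0 ≤ h) (B : C(Torus, ℝ)) :
    Measure.map (fun z : Torus × ℝ => (z.1, (1 + h) * z.2 - B z.1)) volume
      = ENNReal.ofReal ((1 + h)⁻¹) • volume := by
  have hpos : 0 < 1 + h := by linarith
  have h1 : MeasurePreserving (fun z : Torus × ℝ => (id z.1, (1 + h) * z.2 - B z.1))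
      (volume.prod volume) (volume.prod (ENNReal.ofReal ((1 + h)⁻¹) • volume)) := by
    refine (MeasurePreserving.id (volume : Measure Torus)).skew_product
      (g := fun x v => (1 + h) * v - B x) ?_ (ae_of_all _ fun x => ?_)
    · have : Continuous (Function.uncurry fun (x : Torus) (v : ℝ) => (1 + h) * v - B x) := by
        simp only [Function.uncurry_def]; fun_prop
      exact this.measurable
    · have e : (fun v : ℝ => (1 + h) * v - B x) = (fun v => v - B x) ∘ (fun v => (1 + h) * v) := rfl
      rw [e, ← Measure.map_map (by fun_prop) (by fun_prop), Real.map_volume_mul_left hpos.ne',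
        Measure.map_smul, (measurePreserving_sub_right volume (B x)).map_eq,
        abs_of_pos (inv_pos.2 hpos)]
  have h2 := h1.map_eq
  rw [Measure.prod_smul_right] at h2
  exact h2

theorem continuous_shearStep (h : ℝ) (B : C(Torus, ℝ)) : Continuous (shearStep h B) := by
  unfold shearStep
  refine Continuous.prodMk (continuous_fst.add ((AddCircle.continuous_mk' 1).comp ?_)) ?_ <;>
    fun_prop

theorem map_shearStep {h : ℝ} (hh : 0 ≤ h) (B : C(Torus, ℝ)) :
    Measure.map (shearStep h B) volume = ENNReal.ofReal ((1 + h)⁻¹) • volume := by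
  have e : shearStep h B = (fun z : Torus × ℝ => (z.1 + ((-(h * z.2) : ℝ) : Torus), z.2)) ∘
    (fun z : Torus × ℝ => (z.1, (1 + h) * z.2 - B z.1)) := rfl
  rw [e, ← Measure.map_map (measurePreserving_shear h).measurable
    (by fun_prop : Continuous fun z : Torus × ℝ => (z.1, (1 + h) * z.2 - B z.1)).measurable,
    map_kick hh, Measure.map_smul, (measurePreserving_shear h).map_eq]

/-- The first `j` steps, of length `h`, of the splitting scheme started at time `t`. -/
noncomputable def splitting (w : ℝ → C(Torus, ℝ)) (t h : ℝ) : ℕ → Torus × ℝ → Torus × ℝ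
  | 0 => id
  | j + 1 => fun z => shearStep h (∫ r in (t - (j + 1) * h)..(t - j * h), w r) (splitting w t h j z)

theorem continuous_splitting (w : ℝ → C(Torus, ℝ)) (t h : ℝ) (j : ℕ) :
    Continuous (splitting w t h j) := by
  induction j with
  | zero => exact continuous_id
  | succ j ih => exact (continuous_shearStep _ _).comp ih

theorem map_splitting (w : ℝ → C(Torus, ℝ)) (t : ℝ) {h : ℝ} (hh : 0 ≤ h) (j : ℕ) :
    Measure.map (splitting w t h j) volume = ENNReal.ofReal (((1 + h) ^ j)⁻¹) • volume := by
  induction j with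
  | zero => simp [splitting]
  | succ j ih =>
    have e : splitting w t h (j + 1)
      = shearStep h (∫ r in (t - (j + 1) * h)..(t - j * h), w r) ∘ splitting w t h j := rfl
    rw [e, ← Measure.map_map (continuous_shearStep _ _).measurable
      (continuous_splitting w t h j).measurable, ih, Measure.map_smul, map_shearStep hh, smul_smul,
      ← ENNReal.ofReal_mul (by positivity), ← mul_inv, pow_succ]

section Scheme

variable {T M L : ℝ} {w : ℝ → C(Torus, ℝ)}

theorem IsAdmissibleField.intervalIntegrable (hw : IsAdmissibleField T M L w) {s s' : ℝ}
    (hs : s ∈ Icc 0 T) (hs' : s' ∈ Icc 0 T) : IntervalIntegrable w volume s s' := by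
  have : IntegrableOn w (Icc 0 T) := Integrable.of_bound (C := M) hw.aesm
    (ae_restrict_of_forall_mem measurableSet_Icc fun r hr => hw.norm_le r hr)
  exact intervalIntegrable_iff.2 (this.mono_set (uIoc_subset_uIcc.trans (uIcc_subset_Icc hs hs')))

theorem IsAdmissibleField.integral_apply (hw : IsAdmissibleField T M L w) {s s' : ℝ}
    (hs : s ∈ Icc 0 T) (hs' : s' ∈ Icc 0 T) (x : Torus) :
    (∫ r in s..s', w r) x = ∫ r in s..s', w r x := by
  have := (ContinuousMap.evalCLM ℝ x : C(Torus, ℝ) →L[ℝ] ℝ).intervalIntegral_comp_comm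
    (hw.intervalIntegrable hs hs')
  exact this.symm

theorem IsAdmissibleField.norm_integral_le (hw : IsAdmissibleField T M L w) {s s' : ℝ}
    (hs : s ∈ Icc 0 T) (hs' : s' ∈ Icc 0 T) (h : s ≤ s') :
    ‖∫ r in s..s', w r‖ ≤ M * (s' - s) := by
  have := intervalIntegral.norm_integral_le_of_norm_le_const (f := w) (a := s) (b := s') (C := M)
    fun r hr => hw.norm_le r (uIcc_subset_Icc hs hs' (uIoc_subset_uIcc hr))
  rwa [abs_of_nonneg (by linarith : 0 ≤ s' - s)] at this

theorem IsCharacteristic.shearStep_error (hw : IsAdmissibleField T M L w) {X : ℝ → Torus}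
    {V : ℝ → ℝ} (h : IsCharacteristic T w X V) {C : ℝ} (hC : ∀ r ∈ Icc 0 T, |V r| ≤ C) {s s' : ℝ}
    (hs : s ∈ Icc 0 T) (hs' : s' ∈ Icc 0 T) (hss : s' ≤ s) {z : Torus × ℝ} {d : ℝ}
    (hd : z.1 = X s + (d : Torus)) :
    ∃ d' : ℝ, (shearStep (s - s') (∫ r in s'..s, w r) z).1 = X s' + (d' : Torus) ∧
      |d'| + |(shearStep (s - s') (∫ r in s'..s, w r) z).2 - V s'| ≤
        (1 + (s - s') * (1 + (1 + T) * (L + 1))) * (|d| + |z.2 - V s|) +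
          (2 + T) * (L * C + M + C) * (s - s') ^ 2 := by
  have hL := hw.nonneg
  have hC0 : 0 ≤ C := (abs_nonneg _).trans (hC s hs)
  have hM : 0 ≤ M := (norm_nonneg _).trans (hw.norm_le s hs)
  set δ := s - s' with hδ
  have hδ0 : 0 ≤ δ := by linarith
  have hδT : δ ≤ T := by linarith [hs.2, hs'.1]
  set v' := (shearStep δ (∫ r in s'..s, w r) z).2 with hv'
  have hi1 : IntervalIntegrable (fun r => w r (X r) - V r) volume s s' := by
    have := (hw.integrableOn_comp h.continuousOn_pos).sub h.cont.integrableOn_Icc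
    exact intervalIntegrable_iff.2 (this.mono_set (uIoc_subset_uIcc.trans (uIcc_subset_Icc hs hs')))
  have hi2 : IntervalIntegrable (fun r => w r z.1) volume s s' := by
    have := hw.integrableOn_comp (continuousOn_const (c := z.1))
    exact intervalIntegrable_iff.2 (this.mono_set (uIoc_subset_uIcc.trans (uIcc_subset_Icc hs hs')))
  have hiV : IntervalIntegrable V volume s s' := ContinuousOn.intervalIntegrable_of_mem h.cont hs hs'
  have hsub : ∀ r ∈ uIoc s s', r ∈ Icc 0 T := fun r hr =>
    uIcc_subset_Icc hs hs' (uIoc_subset_uIcc hr)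
  have hrs : ∀ r ∈ uIoc s s', |r - s| ≤ δ ∧ |r - s'| ≤ δ := fun r hr => by
    have := uIoc_subset_uIcc hr
    rw [uIcc_of_ge hss] at this
    constructor <;> rw [abs_le] <;> constructor <;> linarith [this.1, this.2]
  have hVV : ∀ r ∈ Icc 0 T, ∀ r' ∈ Icc 0 T, |V r' - V r| ≤ (M + C) * |r - r'| := by
    intro r hr r' hr'
    rw [h.vel r hr r' hr', sub_add_cancel_left, abs_neg]
    exact abs_intervalIntegral_le_of_le hr hr' fun q hq =>
      (abs_sub _ _).trans (add_le_add (hw.abs_le hq _) (hC q hq))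
  have hΔV : ∀ r ∈ uIoc s s', |V s - V r| ≤ (M + C) * δ := fun r hr =>
    (hVV r (hsub r hr) s hs).trans (mul_le_mul_of_nonneg_left (hrs r hr).1 (by linarith))
  have hab : |s' - s| = δ := by rw [abs_sub_comm, abs_of_nonneg hδ0]
  -- the velocity
  have ev : v' - V s' = (z.2 - V s) + ∫ r in s..s', ((w r z.1 - z.2) - (w r (X r) - V r)) := by
    rw [intervalIntegral.integral_sub (hi2.sub intervalIntegrable_const) hi1,
      intervalIntegral.integral_sub hi2 intervalIntegrable_const, intervalIntegral.integral_const,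
      h.vel s' hs' s hs, hv']
    simp only [shearStep]
    rw [hw.integral_apply hs' hs, intervalIntegral.integral_symm s s', smul_eq_mul, hδ]
    ring
  have bv : |v' - V s'| ≤ |z.2 - V s| + (L * |d| + |z.2 - V s| + (L * C + M + C) * δ) * δ := by
    rw [ev]
    refine (abs_add_le _ _).trans (add_le_add le_rfl ?_)
    rw [← Real.norm_eq_abs]
    refine (intervalIntegral.norm_integral_le_of_norm_le_const
      (C := L * |d| + |z.2 - V s| + (L * C + M + C) * δ) fun r hr => ?_).trans (by rw [hab])
    have hr' := hsub r hr
    have c1 : |w r z.1 - w r (X r)| ≤ L * (|d| + C * δ) := by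
      have e : z.1 = X r + ((d - ∫ r' in s..r, V r' : ℝ) : Torus) := by
        rw [hd, h.pos r hr' s hs, add_assoc, ← AddCircle.coe_add]
        congr 2; ring
      rw [e]
      refine (hw.lip r hr' _ _).trans (mul_le_mul_of_nonneg_left ?_ hL)
      refine (abs_sub _ _).trans (add_le_add le_rfl ?_)
      exact (abs_intervalIntegral_le_of_le hr' hs hC).trans
        (mul_le_mul_of_nonneg_left (hrs r hr).1 hC0)
    have c2 := hΔV r hr
    have e : (w r z.1 - z.2) - (w r (X r) - V r)
      = (w r z.1 - w r (X r)) - ((z.2 - V s) + (V s - V r)) := by ring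
    rw [Real.norm_eq_abs, e]
    have := abs_sub (w r z.1 - w r (X r)) ((z.2 - V s) + (V s - V r))
    have := abs_add_le (z.2 - V s) (V s - V r)
    nlinarith
  -- the position
  refine ⟨d + ∫ r in s..s', (v' - V r), ?_, ?_⟩
  · rw [intervalIntegral.integral_sub intervalIntegrable_const hiV, intervalIntegral.integral_const,
      h.pos s' hs' s hs, hv']
    simp only [shearStep]
    rw [hd, add_assoc, add_assoc, ← AddCircle.coe_add, ← AddCircle.coe_add]
    congr 2
    rw [smul_eq_mul, hδ]; ring
  · have bd : |∫ r in s..s', (v' - V r)| ≤ (|v' - V s'| + (M + C) * δ) * δ := by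
      rw [← Real.norm_eq_abs]
      refine (intervalIntegral.norm_integral_le_of_norm_le_const
        (C := |v' - V s'| + (M + C) * δ) fun r hr => ?_).trans (by rw [hab])
      have c2 := (hVV r (hsub r hr) s' hs').trans
        (mul_le_mul_of_nonneg_left (hrs r hr).2 (by linarith))
      have e : v' - V r = (v' - V s') + (V s' - V r) := by ring
      rw [Real.norm_eq_abs, e]
      exact (abs_add_le _ _).trans (add_le_add le_rfl c2)
    have bd' := abs_add_le d (∫ r in s..s', (v' - V r))
    set E := |d| + |z.2 - V s| with hE
    set C₁ := L * C + M + C with hC₁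
    have hE0 : 0 ≤ E := by positivity
    have hC₁0 : 0 ≤ C₁ := by positivity
    have hMC : M + C ≤ C₁ := by rw [hC₁]; nlinarith
    have p1 : L * |d| + |z.2 - V s| ≤ (L + 1) * E := by
      rw [hE]; nlinarith [abs_nonneg d, abs_nonneg (z.2 - V s)]
    have p2 : |v' - V s'| ≤ |z.2 - V s| + ((L + 1) * E + C₁ * δ) * δ :=
      bv.trans (add_le_add le_rfl (mul_le_mul_of_nonneg_right (by linarith) hδ0))
    have p3 : (M + C) * δ * δ ≤ C₁ * δ ^ 2 := by
      rw [mul_assoc, ← sq]; exact mul_le_mul_of_nonneg_right hMC (sq_nonneg _)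
    have p4 : |v' - V s'| * (1 + δ) ≤ (|z.2 - V s| + ((L + 1) * E + C₁ * δ) * δ) * (1 + δ) :=
      mul_le_mul_of_nonneg_right p2 (by linarith)
    have p5 : ((L + 1) * E + C₁ * δ) * δ * δ ≤ ((L + 1) * E + C₁ * δ) * δ * T :=
      mul_le_mul_of_nonneg_left hδT (by positivity)
    have p6 : |z.2 - V s| * δ ≤ E * δ :=
      mul_le_mul_of_nonneg_right (by rw [hE]; linarith [abs_nonneg d]) hδ0
    nlinarith

theorem IsCharacteristic.splitting_error (hw : IsAdmissibleField T M L w) {X : ℝ → Torus}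
    {V : ℝ → ℝ} (h : IsCharacteristic T w X V) {C : ℝ} (hC : ∀ r ∈ Icc 0 T, |V r| ≤ C) {t : ℝ}
    (ht : t ∈ Icc 0 T) {n : ℕ} (hn : 0 < n) {j : ℕ} (hj : j ≤ n) :
    ∃ d : ℝ, (splitting w t (t / n) j (X t, V t)).1 = X (t - j * (t / n)) + (d : Torus) ∧
      |d| + |(splitting w t (t / n) j (X t, V t)).2 - V (t - j * (t / n))| ≤
        j * ((2 + T) * (L * C + M + C) * (t / n) ^ 2) *
          Real.exp ((1 + (1 + T) * (L + 1)) * (j * (t / n))) := by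
  have hL := hw.nonneg
  have hT : 0 ≤ T := ht.1.trans ht.2
  have hC0 : 0 ≤ C := (abs_nonneg _).trans (hC t ht)
  have hM : 0 ≤ M := (norm_nonneg _).trans (hw.norm_le t ht)
  have hn' : (0 : ℝ) < n := by exact_mod_cast hn
  set K := 1 + (1 + T) * (L + 1) with hK
  set K' := (2 + T) * (L * C + M + C) with hK'
  have hK0 : 0 ≤ K := by positivity
  have hK'0 : 0 ≤ K' := by positivity
  have hd0 : 0 ≤ t / n := div_nonneg ht.1 hn'.le
  have hmem : ∀ i : ℕ, i ≤ n → t - i * (t / n) ∈ Icc 0 T := by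
    intro i hi
    have hi' : (i : ℝ) ≤ n := by exact_mod_cast hi
    have h1 : (i : ℝ) * (t / n) ≤ n * (t / n) := mul_le_mul_of_nonneg_right hi' hd0
    have h2 : (n : ℝ) * (t / n) = t := by field_simp
    have h3 : 0 ≤ (i : ℝ) * (t / n) := by positivity
    constructor <;> linarith [ht.1, ht.2]
  induction j with
  | zero => exact ⟨0, by simp [splitting], by simp [splitting]⟩
  | succ j ih =>
    obtain ⟨d, hd, hb⟩ := ih (by omega)
    have hm1 := hmem j (by omega)
    have hm2 := hmem (j + 1) hj
    have hm2' : t - ((j : ℝ) + 1) * (t / n) ∈ Icc 0 T := by simpa using hm2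
    obtain ⟨d', hd', hb'⟩ := h.shearStep_error hw hC hm1 hm2' (by nlinarith) hd
    have es : t - j * (t / n) - (t - ((j : ℝ) + 1) * (t / n)) = t / n := by ring
    rw [es] at hd' hb'
    refine ⟨d', by simpa [splitting] using hd', ?_⟩
    have hgoal : |d'| + |(splitting w t (t / n) (j + 1) (X t, V t)).2
        - V (t - ((j + 1 : ℕ) : ℝ) * (t / n))| ≤ (1 + t / n * K) *
        (|d| + |(splitting w t (t / n) j (X t, V t)).2 - V (t - j * (t / n))|)
          + K' * (t / n) ^ 2 := by
      simpa [splitting] using hb'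
    refine hgoal.trans ?_
    have e1 : 1 + t / n * K ≤ Real.exp (K * (t / n)) := by
      have := Real.add_one_le_exp (K * (t / n)); linarith
    have e2 : Real.exp (K * (((j + 1 : ℕ) : ℝ) * (t / n)))
      = Real.exp (K * (t / n)) * Real.exp (K * (j * (t / n))) := by
      rw [← Real.exp_add]; push_cast; ring_nf
    have e3 : 1 ≤ Real.exp (K * (((j + 1 : ℕ) : ℝ) * (t / n))) := Real.one_le_exp (by positivity)
    have e4 : (1 + t / n * K) *
        (|d| + |(splitting w t (t / n) j (X t, V t)).2 - V (t - j * (t / n))|) ≤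
        Real.exp (K * (t / n)) * (j * (K' * (t / n) ^ 2) * Real.exp (K * (j * (t / n)))) :=
      mul_le_mul e1 hb (by positivity) (by positivity)
    have e5 : Real.exp (K * (t / n)) * (j * (K' * (t / n) ^ 2) * Real.exp (K * (j * (t / n))))
      = j * (K' * (t / n) ^ 2) * Real.exp (K * (((j + 1 : ℕ) : ℝ) * (t / n))) := by
      rw [e2]; ring
    have e6 : K' * (t / n) ^ 2 ≤ K' * (t / n) ^ 2 * Real.exp (K * (((j + 1 : ℕ) : ℝ) * (t / n))) :=
      le_mul_of_one_le_right (by positivity) e3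
    have e7 : ((j + 1 : ℕ) : ℝ) * (K' * (t / n) ^ 2) * Real.exp (K * (((j + 1 : ℕ) : ℝ) * (t / n)))
      = j * (K' * (t / n) ^ 2) * Real.exp (K * (((j + 1 : ℕ) : ℝ) * (t / n)))
        + K' * (t / n) ^ 2 * Real.exp (K * (((j + 1 : ℕ) : ℝ) * (t / n))) := by
      push_cast; ring
    rw [e7]
    linarith

theorem tendsto_splitting (hw : IsAdmissibleField T M L w) {X : ℝ → ℝ → Torus × ℝ → Torus}
    {V : ℝ → ℝ → Torus × ℝ → ℝ} (h : IsCharacteristicFlow T (fun t x => w t x) X V) {t : ℝ}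
    (ht : t ∈ Icc 0 T) (z : Torus × ℝ) :
    Tendsto (fun n : ℕ => splitting w t (t / n) n z) atTop (𝓝 (backFlow X V t z)) := by
  obtain ⟨c, p, v⟩ := h.isCharacteristic ht z
  obtain ⟨C, hC⟩ := isCompact_Icc.exists_bound_of_continuousOn c.cont
  rw [tendsto_iff_dist_tendsto_zero]
  set A : ℝ := (2 + T) * (L * C + M + C) * t ^ 2 * Real.exp ((1 + (1 + T) * (L + 1)) * t) with hA
  have hlim : Tendsto (fun n : ℕ => A / n) atTop (𝓝 0) := tendsto_const_div_atTop_nhds_zero_nat A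
  refine squeeze_zero' (Eventually.of_forall fun _ => dist_nonneg) ?_ hlim
  filter_upwards [eventually_gt_atTop 0] with n hn
  have hn' : (n : ℝ) ≠ 0 := by exact_mod_cast hn.ne'
  obtain ⟨d, hd, hb⟩ := c.splitting_error hw hC ht hn le_rfl
  have e1 : (n : ℝ) * (t / n) = t := by field_simp
  rw [p, v, e1, sub_self] at hd hb
  have e2 : (n : ℝ) * ((2 + T) * (L * C + M + C) * (t / n) ^ 2) *
      Real.exp ((1 + (1 + T) * (L + 1)) * t) = A / n := by
    rw [hA]; field_simp
  rw [e2] at hb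
  rw [Prod.dist_eq]
  refine max_le ?_ ?_
  · simp only [backFlow]
    rw [hd, dist_eq_norm, add_sub_cancel_left]
    exact (norm_coe_torus_le d).trans
      (by linarith [abs_nonneg ((splitting w t (t / n) n z).2 - V 0 t z)])
  · simp only [backFlow]
    rw [dist_eq_norm, Real.norm_eq_abs]
    have := abs_nonneg d
    linarith

theorem abs_le_splitting (hw : IsAdmissibleField T M L w) {t : ℝ} (ht : t ∈ Icc 0 T) {n : ℕ}
    (hn : 0 < n) {j : ℕ} (hj : j ≤ n) (z : Torus × ℝ) :
    |z.2| ≤ |(splitting w t (t / n) j z).2| + M * (j * (t / n)) := by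
  have hn' : (0 : ℝ) < n := by exact_mod_cast hn
  have hd0 : 0 ≤ t / n := div_nonneg ht.1 hn'.le
  have hM : 0 ≤ M := (norm_nonneg _).trans (hw.norm_le t ht)
  have hmem : ∀ i : ℕ, i ≤ n → t - i * (t / n) ∈ Icc 0 T := by
    intro i hi
    have hi' : (i : ℝ) ≤ n := by exact_mod_cast hi
    have h1 : (i : ℝ) * (t / n) ≤ n * (t / n) := mul_le_mul_of_nonneg_right hi' hd0
    have h2 : (n : ℝ) * (t / n) = t := by field_simp
    have h3 : 0 ≤ (i : ℝ) * (t / n) := by positivity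
    constructor <;> linarith [ht.1, ht.2]
  induction j with
  | zero => simp [splitting]
  | succ j ih =>
    refine (ih (by omega)).trans ?_
    have hm1 := hmem j (by omega)
    have hm2' : t - ((j : ℝ) + 1) * (t / n) ∈ Icc 0 T := by simpa using hmem (j + 1) hj
    set y := splitting w t (t / n) j z
    have hB := ((∫ r in (t - (j + 1) * (t / n))..(t - j * (t / n)), w r).norm_coe_le_norm y.1).trans
      (hw.norm_integral_le hm2' hm1 (by nlinarith))
    have es : t - j * (t / n) - (t - ((j : ℝ) + 1) * (t / n)) = t / n := by ring
    rw [es, Real.norm_eq_abs] at hB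
    have e : (splitting w t (t / n) (j + 1) z).2
      = (1 + t / n) * y.2 - (∫ r in (t - (j + 1) * (t / n))..(t - j * (t / n)), w r) y.1 := rfl
    rw [e]
    set b := (∫ r in (t - (j + 1) * (t / n))..(t - j * (t / n)), w r) y.1
    have h1 : |(1 + t / n) * y.2| ≤ |(1 + t / n) * y.2 - b| + |b| := by
      have := abs_add_le ((1 + t / n) * y.2 - b) b
      simpa using this
    rw [abs_mul, abs_of_nonneg (by linarith : 0 ≤ 1 + t / n)] at h1
    have h2 : |y.2| ≤ (1 + t / n) * |y.2| := le_mul_of_one_le_left (abs_nonneg _) (by linarith)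
    push_cast
    linarith

/-- The backward flow multiplies the Lebesgue measure by `exp (-t)`. -/
theorem map_backFlow (hw : IsAdmissibleField T M L w) {X : ℝ → ℝ → Torus × ℝ → Torus}
    {V : ℝ → ℝ → Torus × ℝ → ℝ} (h : IsCharacteristicFlow T (fun t x => w t x) X V) {t : ℝ}
    (ht : t ∈ Icc 0 T) :
    Measure.map (backFlow X V t) volume = ENNReal.ofReal (Real.exp (-t)) • volume := by
  have hcont := continuous_backFlow hw h ht
  have hM : 0 ≤ M := (norm_nonneg _).trans (hw.norm_le t ht)
  have hint : ∀ g : CompactlySupportedContinuousMap (Torus × ℝ) ℝ,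
      ∫ z, g (backFlow X V t z) = Real.exp (-t) * ∫ z, g z := by
    intro g
    obtain ⟨R, hR⟩ : ∃ R : ℝ, ∀ z : Torus × ℝ, R < |z.2| → g z = 0 := by
      have := (g.hasCompactSupport.isCompact.image continuous_snd).isBounded
      obtain ⟨R, hR⟩ := this.exists_norm_le
      refine ⟨R, fun z hz => ?_⟩
      by_contra hne
      exact absurd (hR z.2 ⟨z, subset_tsupport _ hne, rfl⟩) (not_le.2 hz)
    obtain ⟨C, hC⟩ := g.hasCompactSupport.exists_bound_of_continuous g.continuous
    have hC0 : 0 ≤ C := (norm_nonneg _).trans (hC 0)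
    have h1 : Tendsto (fun n : ℕ => ∫ z, g (splitting w t (t / n) n z)) atTop
        (𝓝 (∫ z, g (backFlow X V t z))) := by
      refine tendsto_integral_filter_of_dominated_convergence
        (fun z => (univ ×ˢ Icc (-(R + M * t)) (R + M * t) : Set (Torus × ℝ)).indicator
          (fun _ => C) z) ?_ ?_ ?_ ?_
      · exact Eventually.of_forall fun n =>
          (g.continuous.comp (continuous_splitting w t (t / n) n)).aestronglyMeasurable
      · filter_upwards [eventually_gt_atTop 0] with n hn
        refine ae_of_all _ fun z => ?_
        have hn' : (n : ℝ) ≠ 0 := by exact_mod_cast hn.ne'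
        have hz := abs_le_splitting hw ht hn le_rfl z
        have e1 : (n : ℝ) * (t / n) = t := by field_simp
        rw [e1] at hz
        by_cases hzR : |(splitting w t (t / n) n z).2| ≤ R
        · rw [indicator_of_mem]
          · exact hC _
          · refine ⟨mem_univ _, ?_⟩
            have := abs_le.1 (hz.trans (add_le_add_left hzR _))
            exact this
        · rw [hR _ (not_le.1 hzR), norm_zero]
          exact indicator_nonneg (fun _ _ => hC0) z
      · refine (integrable_indicator_iff (MeasurableSet.univ.prod measurableSet_Icc)).2 ?_
        refine integrableOn_const ?_
        exact (isCompact_univ.prod isCompact_Icc).measure_lt_top.ne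
      · exact ae_of_all _ fun z =>
          (g.continuous.tendsto _).comp (tendsto_splitting hw h ht z)
    have h2 : Tendsto (fun n : ℕ => ∫ z, g (splitting w t (t / n) n z)) atTop
        (𝓝 (Real.exp (-t) * ∫ z, g z)) := by
      have h3 : ∀ n : ℕ, ∫ z, g (splitting w t (t / n) n z) = ((1 + t / n) ^ n)⁻¹ * ∫ z, g z := by
        intro n
        have hd0 : 0 ≤ t / n := div_nonneg ht.1 (Nat.cast_nonneg n)
        have hg : Continuous (g : Torus × ℝ → ℝ) := g.continuous
        rw [← integral_map (continuous_splitting w t (t / n) n).aemeasurable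
          hg.aestronglyMeasurable, map_splitting w t hd0, integral_smul_measure,
          ENNReal.toReal_ofReal (by positivity), smul_eq_mul]
      simp only [h3]
      rw [Real.exp_neg]
      exact ((Real.tendsto_one_add_div_pow_exp t).inv₀ (Real.exp_pos _).ne').mul_const _
    exact tendsto_nhds_unique h1 h2
  have hfin : IsFiniteMeasureOnCompacts (Measure.map (backFlow X V t) volume) := by
    refine ⟨fun K hK => ?_⟩
    obtain ⟨R, hR⟩ := (hK.image continuous_snd).isBounded.exists_norm_le
    rw [Measure.map_apply hcont.measurable hK.measurableSet]
    set R' := 2 * (R + M * T) * Real.exp (2 * T) with hR'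
    refine lt_of_le_of_lt (measure_mono (t := univ ×ˢ Icc (-R') R') fun z hz => ⟨mem_univ _, ?_⟩)
      (isCompact_univ.prod isCompact_Icc).measure_lt_top
    obtain ⟨c, -, v⟩ := h.isCharacteristic ht z
    have h1 := c.abs_vel_le hw (zero_mem_of_mem ht) ht
    have h2 : |V 0 t z| ≤ R := hR _ ⟨_, hz, rfl⟩
    rw [v] at h1
    refine abs_le.1 (h1.trans ?_)
    rw [hR']
    gcongr
  have : (ENNReal.ofReal (Real.exp (-t)) • (volume : Measure (Torus × ℝ))).Regular :=
    Measure.Regular.smul ENNReal.ofReal_ne_top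
  refine Measure.ext_of_integral_eq_on_compactlySupported fun g => ?_
  have hg : Continuous (g : Torus × ℝ → ℝ) := g.continuous
  rw [integral_map hcont.aemeasurable hg.aestronglyMeasurable, integral_smul_measure,
    ENNReal.toReal_ofReal (Real.exp_pos _).le, hint, smul_eq_mul]

end Scheme

/-! ### Test functions and weak derivatives on the phase space -/

instance : (volume : Measure (Torus × ℝ)).IsAddLeftInvariant :=
  inferInstanceAs ((volume : Measure Torus).prod (volume : Measure ℝ)).IsAddLeftInvariant

instance : (volume : Measure (Torus × ℝ)).IsAddRightInvariant :=
  inferInstanceAs ((volume : Measure Torus).prod (volume : Measure ℝ)).IsAddRightInvariant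

/-- The covering map of the phase space. -/
noncomputable def phaseMk (p : ℝ × ℝ) : Torus × ℝ := ((p.1 : Torus), p.2)

theorem phaseMk_add (p p' : ℝ × ℝ) : phaseMk (p + p') = phaseMk p + phaseMk p' := rfl

theorem phaseMk_neg (p : ℝ × ℝ) : phaseMk (-p) = -phaseMk p := rfl

theorem phaseMk_zero : phaseMk 0 = 0 := rfl

theorem isOpenQuotientMap_phaseMk : IsOpenQuotientMap phaseMk :=
  (QuotientAddGroup.isOpenQuotientMap_mk (N := AddSubgroup.zmultiples (1 : ℝ))).prodMap
    IsOpenQuotientMap.id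

theorem continuous_phaseMk : Continuous phaseMk := isOpenQuotientMap_phaseMk.continuous

theorem measurePreserving_phaseMk :
    MeasurePreserving phaseMk (volume.restrict (Ioc 0 1 ×ˢ univ)) volume := by
  have h1 := UnitAddCircle.measurePreserving_mk 0
  rw [zero_add] at h1
  have h2 := h1.prod (MeasurePreserving.id (volume : Measure ℝ))
  have e : (volume : Measure (ℝ × ℝ)).restrict (Ioc 0 1 ×ˢ univ)
      = (volume.restrict (Ioc 0 1)).prod volume := by
    rw [Measure.volume_eq_prod, ← Measure.prod_restrict, Measure.restrict_univ]
  rw [e]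
  exact h2

/-- Smooth compactly supported functions on the phase space. -/
structure IsTest (φ : Torus × ℝ → ℝ) : Prop where
  contDiff : ContDiff ℝ ∞ (fun p : ℝ × ℝ => φ (phaseMk p))
  compact : HasCompactSupport φ

theorem isTest_of_tsupport_subset {ψ : ℝ × ℝ → ℝ} (hψ : ContDiff ℝ ∞ ψ)
    (hc : HasCompactSupport ψ) (hs : tsupport ψ ⊆ Ioo 0 1 ×ˢ univ) :
    ∃ φ, IsTest φ ∧ ∀ p ∈ (Ioc 0 1 ×ˢ univ : Set (ℝ × ℝ)), φ (phaseMk p) = ψ p := by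
  have hz : ∀ p : ℝ × ℝ, p.1 ∉ Ioo (0 : ℝ) 1 → ψ p = 0 := fun p hp =>
    image_eq_zero_of_notMem_tsupport fun h => hp (hs h).1
  set φ : Torus × ℝ → ℝ := fun z => ψ ((AddCircle.equivIco 1 0 z.1 : ℝ), z.2) with hφ
  have hφq : ∀ p : ℝ × ℝ, φ (phaseMk p) = ψ (Int.fract p.1, p.2) := fun p => by
    simp only [hφ, phaseMk]
    rw [AddCircle.coe_equivIco_mk_apply]
    simp
  refine ⟨φ, ⟨?_, ?_⟩, ?_⟩
  · rw [contDiff_iff_contDiffAt]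
    intro p
    by_cases hp : Int.fract p.1 = 0
    · have h0 : ∀ a : ℝ, a ∉ Ioo (0 : ℝ) 1 → ∀ᶠ y in 𝓝 p, ψ (y.1 - p.1 + a, y.2) = 0 := by
        intro a ha
        have h1 : (a, p.2) ∉ tsupport ψ := fun h => ha (hs h).1
        have h2 : ∀ᶠ y in 𝓝 (a, p.2), y ∉ tsupport ψ :=
          (isClosed_tsupport ψ).isOpen_compl.eventually_mem h1
        have h3 : Tendsto (fun y : ℝ × ℝ => (y.1 - p.1 + a, y.2)) (𝓝 p) (𝓝 (a, p.2)) := by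
          have : Continuous fun y : ℝ × ℝ => (y.1 - p.1 + a, y.2) := by fun_prop
          simpa using this.tendsto p
        exact (h3.eventually h2).mono fun y hy => image_eq_zero_of_notMem_tsupport hy
      have hev : (fun y => φ (phaseMk y)) =ᶠ[𝓝 p] fun _ => 0 := by
        have h4 : ∀ᶠ y : ℝ × ℝ in 𝓝 p, |y.1 - p.1| < 1 := by
          have : Continuous fun y : ℝ × ℝ => |y.1 - p.1| := by fun_prop
          exact (this.tendsto p).eventually (gt_mem_nhds (by simp))
        filter_upwards [h0 0 (by simp), h0 1 (by simp), h4] with y h5 h6 h7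
        rw [hφq]
        obtain ⟨n, hn⟩ : ∃ n : ℤ, p.1 = n := ⟨⌊p.1⌋, by
          have := Int.floor_add_fract p.1; rw [hp] at this; linarith⟩
        rw [abs_lt] at h7
        rcases le_total 0 (y.1 - p.1) with h | h
        · have : Int.fract y.1 = y.1 - p.1 + 0 := by
            rw [Int.fract_eq_iff]
            exact ⟨by linarith, by linarith, n, by rw [hn]; ring⟩
          rw [this]; exact h5
        · rcases eq_or_lt_of_le h with h | h
          · have : Int.fract y.1 = y.1 - p.1 + 0 := by
              rw [Int.fract_eq_iff]
              exact ⟨by linarith, by linarith, n, by rw [hn]; ring⟩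
            rw [this]; exact h5
          · have : Int.fract y.1 = y.1 - p.1 + 1 := by
              rw [Int.fract_eq_iff]
              exact ⟨by linarith, by linarith, n - 1, by push_cast; rw [hn]; ring⟩
            rw [this]; exact h6
      exact contDiffAt_const.congr_of_eventuallyEq hev
    · have hev : (fun y => φ (phaseMk y)) =ᶠ[𝓝 p] fun y => ψ (y.1 - ⌊p.1⌋, y.2) := by
        have h1 : (⌊p.1⌋ : ℝ) < p.1 := by
          have h2 := Int.floor_add_fract p.1
          have h3 := lt_of_le_of_ne (Int.fract_nonneg p.1) (Ne.symm hp)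
          linarith
        have h4 : ∀ᶠ y : ℝ × ℝ in 𝓝 p, y.1 ∈ Ioo (⌊p.1⌋ : ℝ) (⌊p.1⌋ + 1) :=
          continuous_fst.continuousAt.eventually
            (isOpen_Ioo.mem_nhds ⟨h1, Int.lt_floor_add_one p.1⟩)
        filter_upwards [h4] with y hy
        rw [hφq]
        have : Int.fract y.1 = y.1 - ⌊p.1⌋ := by
          rw [Int.fract_eq_iff]
          exact ⟨by linarith [hy.1], by linarith [hy.2], ⌊p.1⌋, by ring⟩
        rw [this]
      refine ContDiffAt.congr_of_eventuallyEq ?_ hev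
      exact (hψ.comp (by fun_prop : ContDiff ℝ ∞ fun y : ℝ × ℝ => (y.1 - ⌊p.1⌋, y.2))).contDiffAt
  · refine HasCompactSupport.intro (K := phaseMk '' tsupport ψ)
      (hc.isCompact.image continuous_phaseMk) fun z hz' => ?_
    by_contra hne
    refine hz' ⟨_, subset_tsupport _ hne, ?_⟩
    simp only [phaseMk]
    rw [AddCircle.coe_equivIco]
  · intro p hp
    rw [hφq]
    rcases eq_or_lt_of_le hp.1.2 with h | h
    · rw [hz p (by simp [h]), hz _ (by simp [h])]
    · rw [Int.fract_eq_self.2 ⟨hp.1.1.le, h⟩]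

theorem ae_eq_zero_of_forall_test {F : Torus × ℝ → ℝ} (hF : Integrable F)
    (h : ∀ φ, IsTest φ → ∫ z, F z * φ z = 0) : F =ᵐ[volume] 0 := by
  obtain ⟨F', hF'm, hFF'⟩ := hF.1
  have hF' : Integrable F' := hF.congr hFF'
  refine hFF'.trans ?_
  have hmp := measurePreserving_phaseMk
  have hint : IntegrableOn (fun p => F' (phaseMk p)) (Ioc 0 1 ×ˢ univ) :=
    (hmp.integrable_comp hF'm.aestronglyMeasurable).2 hF'
  have h1 := IsOpen.ae_eq_zero_of_integral_contDiff_smul_eq_zero (E := ℝ × ℝ) (μ := volume)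
    (U := Ioo 0 1 ×ˢ univ) (isOpen_Ioo.prod isOpen_univ) (f := fun p => F' (phaseMk p))
    (hint.mono_set (prod_mono Ioo_subset_Ioc_self le_rfl)).locallyIntegrableOn
    (fun ψ hψ hc hs => by
      obtain ⟨φ, hφ, he⟩ := isTest_of_tsupport_subset hψ hc hs
      have e1 : ∫ p, ψ p • F' (phaseMk p) = ∫ p in Ioc 0 1 ×ˢ univ, ψ p • F' (phaseMk p) := by
        refine (setIntegral_eq_integral_of_forall_compl_eq_zero fun p hp => ?_).symm
        have : p ∉ tsupport ψ := fun hmem => hp (prod_mono Ioo_subset_Ioc_self le_rfl (hs hmem))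
        rw [image_eq_zero_of_notMem_tsupport this, zero_smul]
      have e2 : ∫ p in Ioc 0 1 ×ˢ univ, ψ p • F' (phaseMk p)
          = ∫ p in Ioc 0 1 ×ˢ univ, F' (phaseMk p) * φ (phaseMk p) := by
        refine setIntegral_congr_fun (measurableSet_Ioc.prod MeasurableSet.univ) fun p hp => ?_
        rw [he p hp, smul_eq_mul, mul_comm]
      have hφc : Continuous φ :=
        isOpenQuotientMap_phaseMk.continuous_comp_iff.1 hφ.contDiff.continuous
      have e3 : ∫ p in Ioc 0 1 ×ˢ univ, F' (phaseMk p) * φ (phaseMk p) = ∫ z, F' z * φ z := by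
        have := integral_map (μ := volume.restrict (Ioc 0 1 ×ˢ univ)) hmp.measurable.aemeasurable
          (f := fun z => F' z * φ z)
          (hF'm.aestronglyMeasurable.mul hφc.aestronglyMeasurable)
        rw [hmp.map_eq] at this
        exact this.symm
      rw [e1, e2, e3, ← h φ hφ]
      exact integral_congr_ae (by filter_upwards [hFF'] with z hz; rw [hz]))
  have h2 : ∀ᵐ p ∂(volume.restrict (Ioc 0 1 ×ˢ univ) : Measure (ℝ × ℝ)), F' (phaseMk p) = 0 := by
    have e : (Ioc (0 : ℝ) 1 ×ˢ univ : Set (ℝ × ℝ)) =ᵐ[volume] (Ioo 0 1 ×ˢ univ : Set (ℝ × ℝ)) := by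
      rw [Measure.volume_eq_prod]
      exact (Measure.set_prod_ae_eq (Ioo_ae_eq_Ioc) (ae_eq_refl _)).symm
    rw [Measure.restrict_congr_set e, ae_restrict_iff' (measurableSet_Ioo.prod MeasurableSet.univ)]
    exact h1
  have hset : MeasurableSet {z | F' z = 0} := hF'm.measurable (measurableSet_singleton 0)
  rw [← hmp.map_eq]
  exact (ae_map_iff hmp.measurable.aemeasurable hset).2 h2

namespace IsTest

variable {φ : Torus × ℝ → ℝ}

theorem continuous (hφ : IsTest φ) : Continuous φ :=
  isOpenQuotientMap_phaseMk.continuous_comp_iff.1 hφ.contDiff.continuous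

theorem translate (hφ : IsTest φ) (y : ℝ × ℝ) : IsTest (fun z => φ (z + phaseMk y)) where
  contDiff := by
    have : ContDiff ℝ ∞ fun p : ℝ × ℝ => p + y := by fun_prop
    exact hφ.contDiff.comp this
  compact := by
    have := hφ.compact.comp_homeomorph (Homeomorph.addRight (phaseMk y))
    exact this

/-- The derivative of a test function in the direction `y`. -/
noncomputable def dirDeriv (φ : Torus × ℝ → ℝ) (y : ℝ × ℝ) (z : Torus × ℝ) : ℝ :=
  deriv (fun r : ℝ => φ (z + phaseMk (r • y))) 0

theorem dirDeriv_phaseMk (hφ : IsTest φ) (y p : ℝ × ℝ) :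
    dirDeriv φ y (phaseMk p) = fderiv ℝ (fun p => φ (phaseMk p)) p y := by
  have hd : DifferentiableAt ℝ (fun p => φ (phaseMk p)) p :=
    (hφ.contDiff.differentiable (by simp)).differentiableAt
  have h1 : HasDerivAt (fun r : ℝ => p + r • y) y 0 := by
    simpa using ((hasDerivAt_id (0 : ℝ)).smul_const y).const_add p
  have h2 : HasFDerivAt (fun p => φ (phaseMk p)) (fderiv ℝ (fun p => φ (phaseMk p)) p)
    (p + (0 : ℝ) • y) := by simpa using hd.hasFDerivAt
  exact (h2.comp_hasDerivAt (0 : ℝ) h1).deriv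

theorem hasDerivAt (hφ : IsTest φ) (y : ℝ × ℝ) (z : Torus × ℝ) (s : ℝ) :
    HasDerivAt (fun r : ℝ => φ (z + phaseMk (r • y))) (dirDeriv φ y (z + phaseMk (s • y))) s := by
  obtain ⟨p, rfl⟩ := isOpenQuotientMap_phaseMk.surjective z
  have hd : DifferentiableAt ℝ (fun p => φ (phaseMk p)) (p + s • y) :=
    (hφ.contDiff.differentiable (by simp)).differentiableAt
  have h1 : HasDerivAt (fun r : ℝ => p + r • y) y s := by
    simpa using ((hasDerivAt_id s).smul_const y).const_add p
  rw [← phaseMk_add, hφ.dirDeriv_phaseMk]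
  exact hd.hasFDerivAt.comp_hasDerivAt s h1

theorem continuous_dirDeriv (hφ : IsTest φ) (y : ℝ × ℝ) : Continuous (dirDeriv φ y) := by
  rw [← isOpenQuotientMap_phaseMk.continuous_comp_iff]
  have : dirDeriv φ y ∘ phaseMk = fun p => fderiv ℝ (fun p => φ (phaseMk p)) p y :=
    funext fun p => hφ.dirDeriv_phaseMk y p
  rw [this]
  exact (hφ.contDiff.continuous_fderiv (by simp)).clm_apply continuous_const

theorem hasCompactSupport_dirDeriv (hφ : IsTest φ) (y : ℝ × ℝ) :
    HasCompactSupport (dirDeriv φ y) := by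
  refine HasCompactSupport.intro hφ.compact fun z hz => ?_
  have h1 : ∀ᶠ r : ℝ in 𝓝 0, z + phaseMk (r • y) ∉ tsupport φ := by
    have hc : Continuous fun r : ℝ => z + phaseMk (r • y) :=
      continuous_const.add (continuous_phaseMk.comp (by fun_prop))
    refine hc.continuousAt.eventually ((isClosed_tsupport φ).isOpen_compl.eventually_mem ?_)
    simpa [phaseMk_zero] using hz
  have h2 : (fun r : ℝ => φ (z + phaseMk (r • y))) =ᶠ[𝓝 0] fun _ => 0 :=
    h1.mono fun r hr => image_eq_zero_of_notMem_tsupport hr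
  rw [dirDeriv, h2.deriv_eq, deriv_const]

theorem exists_bound (hφ : IsTest φ) : ∃ C, ∀ z, ‖φ z‖ ≤ C :=
  hφ.compact.exists_bound_of_continuous hφ.continuous

theorem exists_bound_dirDeriv (hφ : IsTest φ) (y : ℝ × ℝ) : ∃ C, ∀ z, ‖dirDeriv φ y z‖ ≤ C :=
  (hφ.hasCompactSupport_dirDeriv y).exists_bound_of_continuous (hφ.continuous_dirDeriv y)

theorem dirDeriv_translate (y y' : ℝ × ℝ) (z : Torus × ℝ) :
    dirDeriv (fun z => φ (z + phaseMk y')) y z = dirDeriv φ y (z + phaseMk y') := by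
  simp only [dirDeriv]
  congr 1
  ext r
  congr 1
  abel

end IsTest

/-- Along `y`, an integrable function with an integrable weak derivative is the integral of it. -/
theorem ae_sub_eq_integral_of_weakDeriv {f g : Torus × ℝ → ℝ} (hf : Integrable f)
    (hg : Integrable g) (hgm : StronglyMeasurable g) {y : ℝ × ℝ}
    (h : ∀ φ, IsTest φ → ∫ z, f z * IsTest.dirDeriv φ y z = -∫ z, g z * φ z) :
    ∀ᵐ z, f (z + phaseMk y) - f z = ∫ s in (0 : ℝ)..1, g (z + phaseMk (s • y)) := by
  have htr : ∀ y' : ℝ × ℝ, MeasurePreserving (fun z : Torus × ℝ => z + phaseMk y') :=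
    fun y' => measurePreserving_add_right volume _
  have hcont2 : Continuous fun p : (Torus × ℝ) × ℝ => p.1 + phaseMk (p.2 • y) :=
    continuous_fst.add (continuous_phaseMk.comp (by fun_prop))
  -- joint integrability
  have hGint : Integrable (fun p : (Torus × ℝ) × ℝ => g (p.1 + phaseMk (p.2 • y)))
      (volume.prod (volume.restrict (Ioc (0 : ℝ) 1))) := by
    have hm : AEStronglyMeasurable (fun p : (Torus × ℝ) × ℝ => g (p.1 + phaseMk (p.2 • y)))
      (volume.prod (volume.restrict (Ioc (0 : ℝ) 1))) :=
      (hgm.comp_measurable hcont2.measurable).aestronglyMeasurable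
    rw [integrable_prod_iff' hm]
    refine ⟨ae_of_all _ fun s => (htr (s • y)).integrable_comp_of_integrable hg, ?_⟩
    have : (fun s : ℝ => ∫ z, ‖g (z + phaseMk (s • y))‖) = fun _ => ∫ z, ‖g z‖ := by
      ext s
      exact integral_add_right_eq_self (fun z => ‖g z‖) _
    rw [this]
    exact integrable_const _
  have hFint : Integrable fun z =>
      f (z + phaseMk y) - f z - ∫ s in (0 : ℝ)..1, g (z + phaseMk (s • y)) := by
    refine (((htr y).integrable_comp_of_integrable hf).sub hf).sub ?_
    have := hGint.integral_prod_left
    simp only [intervalIntegral.integral_of_le zero_le_one]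
    exact this
  have key := ae_eq_zero_of_forall_test hFint fun φ hφ => by
    obtain ⟨C, hC⟩ := hφ.exists_bound
    obtain ⟨C', hC'⟩ := hφ.exists_bound_dirDeriv y
    have i1 : Integrable fun z => f (z + phaseMk y) * φ z :=
      ((htr y).integrable_comp_of_integrable hf).mul_bdd (c := C)
        hφ.continuous.aestronglyMeasurable (ae_of_all _ hC)
    have i2 : Integrable fun z => f z * φ z :=
      hf.mul_bdd (c := C) hφ.continuous.aestronglyMeasurable (ae_of_all _ hC)
    have i3 : Integrable fun z => (∫ s in (0 : ℝ)..1, g (z + phaseMk (s • y))) * φ z := by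
      have := hGint.integral_prod_left
      simp only [intervalIntegral.integral_of_le zero_le_one]
      exact this.mul_bdd (c := C) hφ.continuous.aestronglyMeasurable (ae_of_all _ hC)
    have e0 : ∫ z, (f (z + phaseMk y) - f z - ∫ s in (0 : ℝ)..1, g (z + phaseMk (s • y))) * φ z
        = ((∫ z, f (z + phaseMk y) * φ z) - ∫ z, f z * φ z)
          - ∫ z, (∫ s in (0 : ℝ)..1, g (z + phaseMk (s • y))) * φ z := by
      have i12 : Integrable fun z => f (z + phaseMk y) * φ z - f z * φ z := i1.sub i2
      rw [← integral_sub i1 i2, ← integral_sub i12 i3]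
      exact integral_congr_ae (ae_of_all _ fun z => by simp only; ring)
    -- the increment of `f`
    have e1 : ∫ z, f (z + phaseMk y) * φ z = ∫ z, f z * φ (z - phaseMk y) := by
      rw [← integral_add_right_eq_self (fun z => f z * φ (z - phaseMk y)) (phaseMk y)]
      simp
    have i2' : Integrable fun z => f z * φ (z - phaseMk y) :=
      hf.mul_bdd (c := C) (hφ.continuous.comp (by fun_prop)).aestronglyMeasurable
        (ae_of_all _ fun z => hC _)
    have hcd : Continuous fun p : (Torus × ℝ) × ℝ =>
        IsTest.dirDeriv φ y (p.1 + phaseMk ((-p.2) • y)) :=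
      (hφ.continuous_dirDeriv y).comp
        (continuous_fst.add (continuous_phaseMk.comp (by fun_prop)))
    have e2 : ∀ z, φ (z - phaseMk y) - φ z
        = -∫ s in (0 : ℝ)..1, IsTest.dirDeriv φ y (z + phaseMk ((-s) • y)) := by
      intro z
      have hd : ∀ s ∈ uIcc (0 : ℝ) 1, HasDerivAt (fun r : ℝ => φ (z + phaseMk ((-r) • y)))
          (-(IsTest.dirDeriv φ y (z + phaseMk ((-s) • y)))) s := by
        intro s _
        have := (hφ.hasDerivAt y z (-s)).comp s (hasDerivAt_neg s)
        rw [mul_neg_one] at this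
        exact this
      have h3 := intervalIntegral.integral_eq_sub_of_hasDerivAt hd
        ((Continuous.comp hcd (by fun_prop : Continuous fun s : ℝ => (z, s))).neg.intervalIntegrable
          _ _)
      rw [intervalIntegral.integral_neg] at h3
      rw [h3]
      simp [phaseMk_zero, phaseMk_neg, sub_eq_add_neg]
    have hDint : Integrable (fun p : (Torus × ℝ) × ℝ =>
        f p.1 * IsTest.dirDeriv φ y (p.1 + phaseMk ((-p.2) • y)))
        (volume.prod (volume.restrict (Ioc (0 : ℝ) 1))) := by
      have hf1 : Integrable (fun p : (Torus × ℝ) × ℝ => f p.1)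
        (volume.prod (volume.restrict (Ioc (0 : ℝ) 1))) := hf.comp_fst _
      exact hf1.mul_bdd (c := C') hcd.aestronglyMeasurable (ae_of_all _ fun p => hC' _)
    have e3 : (∫ z, f z * φ (z - phaseMk y)) - ∫ z, f z * φ z
        = -∫ s in (0 : ℝ)..1, ∫ z, f z * IsTest.dirDeriv φ y (z + phaseMk ((-s) • y)) := by
      rw [← integral_sub i2' i2, intervalIntegral.integral_of_le zero_le_one,
        ← integral_integral_swap hDint, ← integral_neg]
      refine integral_congr_ae (ae_of_all _ fun z => ?_)
      simp only
      rw [← mul_sub, e2 z, intervalIntegral.integral_of_le zero_le_one, mul_neg, integral_const_mul]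
    have e4 : ∀ s : ℝ, ∫ z, f z * IsTest.dirDeriv φ y (z + phaseMk ((-s) • y))
        = -∫ z, g (z + phaseMk (s • y)) * φ z := by
      intro s
      have h4 := h _ (hφ.translate ((-s) • y))
      simp only [IsTest.dirDeriv_translate] at h4
      rw [h4, ← integral_add_right_eq_self
        (fun z => g z * φ (z + phaseMk ((-s) • y))) (phaseMk (s • y))]
      congr 1
      refine integral_congr_ae (ae_of_all _ fun z => ?_)
      simp only
      rw [add_assoc z, ← phaseMk_add, neg_smul, add_neg_cancel, phaseMk_zero, add_zero]
    have hGφ : Integrable (fun p : (Torus × ℝ) × ℝ => g (p.1 + phaseMk (p.2 • y)) * φ p.1)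
        (volume.prod (volume.restrict (Ioc (0 : ℝ) 1))) :=
      hGint.mul_bdd (c := C) (hφ.continuous.comp continuous_fst).aestronglyMeasurable
        (ae_of_all _ fun p => hC _)
    have e5 : ∫ z, (∫ s in (0 : ℝ)..1, g (z + phaseMk (s • y))) * φ z
        = ∫ s in (0 : ℝ)..1, ∫ z, g (z + phaseMk (s • y)) * φ z := by
      rw [intervalIntegral.integral_of_le zero_le_one, ← integral_integral_swap hGφ]
      refine integral_congr_ae (ae_of_all _ fun z => ?_)
      simp only
      rw [intervalIntegral.integral_of_le zero_le_one, integral_mul_const]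
    rw [e0, e1, e3, e5]
    simp only [e4]
    rw [intervalIntegral.integral_neg]
    ring
  filter_upwards [key] with z hz
  exact sub_eq_zero.1 hz

/-! ### Weighted `L¹` estimates for translations -/

theorem IsTest.dirDeriv_eq_combination {φ : Torus × ℝ → ℝ} (hφ : IsTest φ) (y : ℝ × ℝ)
    (z : Torus × ℝ) : IsTest.dirDeriv φ y z
      = y.1 * IsTest.dirDeriv φ (1, 0) z + y.2 * IsTest.dirDeriv φ (0, 1) z := by
  obtain ⟨p, rfl⟩ := isOpenQuotientMap_phaseMk.surjective z
  rw [hφ.dirDeriv_phaseMk, hφ.dirDeriv_phaseMk, hφ.dirDeriv_phaseMk, ← smul_eq_mul, ← smul_eq_mul,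
    ← map_smul, ← map_smul, ← map_add]
  congr 1
  ext <;> simp

theorem integrable_of_weight {g : Torus × ℝ → ℝ}
    (hg : Integrable fun z : Torus × ℝ => (1 + |z.2|) * g z) : Integrable g := by
  have hc : Continuous fun z : Torus × ℝ => (1 + |z.2|)⁻¹ :=
    Continuous.inv₀ (by fun_prop) fun z => by positivity
  have := hg.bdd_mul (c := 1) hc.aestronglyMeasurable (ae_of_all _ fun z => by
    rw [Real.norm_eq_abs, abs_of_nonneg (by positivity)]
    exact inv_le_one_of_one_le₀ (by linarith [abs_nonneg z.2]))
  refine this.congr (ae_of_all _ fun z => ?_)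
  have : 1 + |z.2| ≠ 0 := by positivity
  simp only
  rw [← mul_assoc, inv_mul_cancel₀ this, one_mul]

theorem HasWeightedIntegrableGradient.exists_translation_bound {f : Torus × ℝ → ℝ}
    (h : HasWeightedIntegrableGradient f) (hf : Integrable f) :
    ∃ N : ℝ≥0∞, N ≠ ⊤ ∧ ∀ (y : ℝ × ℝ) (r : ℝ), |y.1| ≤ r → |y.2| ≤ r →
      ∫⁻ z, ENNReal.ofReal (1 + |z.2|) * ‖f (z + phaseMk y) - f z‖ₑ
        ≤ ENNReal.ofReal (r * (1 + r)) * N := by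
  obtain ⟨gx, gv, hw, hx, hv⟩ := h
  obtain ⟨gx', hgx', hxx⟩ := (integrable_of_weight hx).1
  obtain ⟨gv', hgv', hvv⟩ := (integrable_of_weight hv).1
  have ix : Integrable gx' := (integrable_of_weight hx).congr hxx
  have iv : Integrable gv' := (integrable_of_weight hv).congr hvv
  have hx' : Integrable fun z : Torus × ℝ => (1 + |z.2|) * gx' z :=
    hx.congr (by filter_upwards [hxx] with z hz; rw [hz])
  have hv' : Integrable fun z : Torus × ℝ => (1 + |z.2|) * gv' z :=
    hv.congr (by filter_upwards [hvv] with z hz; rw [hz])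
  set W : Torus × ℝ → ℝ≥0∞ := fun z => ENNReal.ofReal (1 + |z.2|) with hW
  have hWm : Measurable W := by
    have : Continuous fun z : Torus × ℝ => 1 + |z.2| := by fun_prop
    exact ENNReal.measurable_ofReal.comp this.measurable
  have hWe : ∀ (g : Torus × ℝ → ℝ) z, ‖(1 + |z.2|) * g z‖ₑ = W z * ‖g z‖ₑ := fun g z => by
    rw [enorm_mul, Real.enorm_of_nonneg (by positivity)]
  refine ⟨∫⁻ z, W z * (‖gx' z‖ₑ + ‖gv' z‖ₑ), ?_, fun y r hy1 hy2 => ?_⟩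
  · simp only [mul_add]
    rw [lintegral_add_left (show Measurable fun z => W z * ‖gx' z‖ₑ from hWm.mul hgx'.enorm)]
    simp only [← hWe]
    exact ENNReal.add_ne_top.2 ⟨hx'.2.ne, hv'.2.ne⟩
  have hr0 : 0 ≤ r := (abs_nonneg _).trans hy1
  set g : Torus × ℝ → ℝ := fun z => y.1 * gx' z + y.2 * gv' z with hg
  have hgm : StronglyMeasurable g := (hgx'.const_mul _).add (hgv'.const_mul _)
  have hgi : Integrable g := (ix.const_mul _).add (iv.const_mul _)
  have hweak : ∀ φ, IsTest φ → ∫ z, f z * IsTest.dirDeriv φ y z = -∫ z, g z * φ z := by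
    intro φ hφ
    obtain ⟨C, hC⟩ := hφ.exists_bound
    have id : ∀ y', Integrable fun z => f z * IsTest.dirDeriv φ y' z := fun y' => by
      obtain ⟨C', hC'⟩ := hφ.exists_bound_dirDeriv y'
      exact hf.mul_bdd (c := C') (hφ.continuous_dirDeriv y').aestronglyMeasurable
        (ae_of_all _ hC')
    have ig : ∀ g' : Torus × ℝ → ℝ, Integrable g' → Integrable fun z => g' z * φ z := fun g' hg' =>
      hg'.mul_bdd (c := C) hφ.continuous.aestronglyMeasurable (ae_of_all _ hC)
    obtain ⟨w1, w2⟩ := hw φ hφ.contDiff hφ.compact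
    have e1 : ∀ z : Torus × ℝ, deriv (fun r : ℝ => φ (z.1 + (r : Torus), z.2)) 0
        = IsTest.dirDeriv φ (1, 0) z := fun z => by
      simp only [IsTest.dirDeriv]
      congr 1; ext r; congr 1
      ext <;> simp [phaseMk]
    have e2 : ∀ z : Torus × ℝ, deriv (fun r : ℝ => φ (z.1, z.2 + r)) 0
        = IsTest.dirDeriv φ (0, 1) z := fun z => by
      simp only [IsTest.dirDeriv]
      congr 1; ext r; congr 1
      ext <;> simp [phaseMk]
    simp only [e1] at w1
    simp only [e2] at w2
    have f1 : ∫ z, gx z * φ z = ∫ z, gx' z * φ z :=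
      integral_congr_ae (by filter_upwards [hxx] with z hz; rw [hz])
    have f2 : ∫ z, gv z * φ z = ∫ z, gv' z * φ z :=
      integral_congr_ae (by filter_upwards [hvv] with z hz; rw [hz])
    have c1 : ∫ z, f z * IsTest.dirDeriv φ y z
        = ∫ z, (y.1 * (f z * IsTest.dirDeriv φ (1, 0) z)
          + y.2 * (f z * IsTest.dirDeriv φ (0, 1) z)) :=
      integral_congr_ae (ae_of_all _ fun z => by
        simp only; rw [hφ.dirDeriv_eq_combination y z]; ring)
    have c2 : ∫ z, g z * φ z = ∫ z, (y.1 * (gx' z * φ z) + y.2 * (gv' z * φ z)) :=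
      integral_congr_ae (ae_of_all _ fun z => by simp only [hg]; ring)
    rw [c1, c2, integral_add ((id _).const_mul _) ((id _).const_mul _),
      integral_add ((ig _ ix).const_mul _) ((ig _ iv).const_mul _), integral_const_mul,
      integral_const_mul, integral_const_mul, integral_const_mul, w1, w2, f1, f2]
    ring
  have hae := ae_sub_eq_integral_of_weakDeriv hf hgi hgm hweak
  have hcont2 : Continuous fun p : (Torus × ℝ) × ℝ => p.1 + phaseMk (p.2 • y) :=
    continuous_fst.add (continuous_phaseMk.comp (by fun_prop))
  have hslice : ∀ s ∈ Ioc (0 : ℝ) 1, ∫⁻ z, W z * ‖g (z + phaseMk (s • y))‖ₑ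
      ≤ ENNReal.ofReal (1 + r) * ∫⁻ z, W z * ‖g z‖ₑ := by
    intro s hs
    have e : ∫⁻ z, W z * ‖g (z + phaseMk (s • y))‖ₑ
        = ∫⁻ z, W (z - phaseMk (s • y)) * ‖g z‖ₑ := by
      rw [← lintegral_add_right_eq_self (fun z => W (z - phaseMk (s • y)) * ‖g z‖ₑ)
        (phaseMk (s • y))]
      simp
    rw [e, ← lintegral_const_mul' _ _ ENNReal.ofReal_ne_top]
    refine lintegral_mono fun z => ?_
    rw [← mul_assoc]
    refine mul_le_mul_left ?_ _
    simp only [hW]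
    rw [← ENNReal.ofReal_mul (by linarith)]
    refine ENNReal.ofReal_le_ofReal ?_
    have : (z - phaseMk (s • y)).2 = z.2 - s * y.2 := by simp [phaseMk]
    rw [this]
    have h1 : |z.2 - s * y.2| ≤ |z.2| + r := by
      refine (abs_sub _ _).trans (add_le_add le_rfl ?_)
      rw [abs_mul, abs_of_nonneg hs.1.le]
      calc s * |y.2| ≤ 1 * r := mul_le_mul hs.2 hy2 (abs_nonneg _) zero_le_one
        _ = r := one_mul r
    nlinarith [abs_nonneg z.2]
  calc ∫⁻ z, W z * ‖f (z + phaseMk y) - f z‖ₑ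
      ≤ ∫⁻ z, ∫⁻ s in Ioc (0 : ℝ) 1, W z * ‖g (z + phaseMk (s • y))‖ₑ := by
        refine lintegral_mono_ae ?_
        filter_upwards [hae] with z hz
        rw [hz, intervalIntegral.integral_of_le zero_le_one,
          lintegral_const_mul' _ _ ENNReal.ofReal_ne_top]
        exact mul_le_mul_right (enorm_integral_le_lintegral_enorm _) _
    _ = ∫⁻ s in Ioc (0 : ℝ) 1, ∫⁻ z, W z * ‖g (z + phaseMk (s • y))‖ₑ := by
        refine lintegral_lintegral_swap ?_
        refine Measurable.aemeasurable ?_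
        exact (hWm.comp measurable_fst).mul (hgm.comp_measurable hcont2.measurable).enorm
    _ ≤ ∫⁻ s in Ioc (0 : ℝ) 1, ENNReal.ofReal (1 + r) * ∫⁻ z, W z * ‖g z‖ₑ :=
        setLIntegral_mono' measurableSet_Ioc hslice
    _ = ENNReal.ofReal (1 + r) * ∫⁻ z, W z * ‖g z‖ₑ := by simp
    _ ≤ ENNReal.ofReal (1 + r) * ∫⁻ z, ENNReal.ofReal r * (W z * (‖gx' z‖ₑ + ‖gv' z‖ₑ)) := by
        refine mul_le_mul_right (lintegral_mono fun z => ?_) _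
        rw [← mul_assoc, mul_comm (ENNReal.ofReal r), mul_assoc]
        refine mul_le_mul_right ?_ _
        simp only [hg]
        refine (enorm_add_le _ _).trans ?_
        rw [enorm_mul, enorm_mul, mul_add]
        refine add_le_add (mul_le_mul_left ?_ _) (mul_le_mul_left ?_ _)
        · rw [Real.enorm_eq_ofReal_abs]; exact ENNReal.ofReal_le_ofReal hy1
        · rw [Real.enorm_eq_ofReal_abs]; exact ENNReal.ofReal_le_ofReal hy2
    _ = _ := by
        rw [lintegral_const_mul' _ _ ENNReal.ofReal_ne_top, ← mul_assoc,
          ← ENNReal.ofReal_mul (by linarith), mul_comm r]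

/-! ### Weighted `L¹` stability of the composition with measure scaling maps -/

theorem lintegral_comp_of_map_eq {Ψ : Torus × ℝ → Torus × ℝ} {c : ℝ≥0∞} (hΨ : Measurable Ψ)
    (hc : Measure.map Ψ volume = c • volume) {G : Torus × ℝ → ℝ≥0∞} (hG : Measurable G) :
    ∫⁻ z, G (Ψ z) = c * ∫⁻ z, G z := by
  rw [← lintegral_map hG hΨ, hc, lintegral_smul_measure, smul_eq_mul]

theorem volume_square {r : ℝ} (hr : 0 ≤ r) :
    volume (Icc (-r) r ×ˢ Icc (-r) r : Set (ℝ × ℝ)) = ENNReal.ofReal ((2 * r) ^ 2) := by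
  rw [Measure.volume_eq_prod, Measure.prod_prod, Real.volume_Icc, ← ENNReal.ofReal_mul (by linarith)]
  congr 1; ring

/-- Mean oscillation at scale `r`. -/
noncomputable def oscillation (f : Torus × ℝ → ℝ) (r : ℝ) (z : Torus × ℝ) : ℝ≥0∞ :=
  ∫⁻ y in (Icc (-r) r ×ˢ Icc (-r) r : Set (ℝ × ℝ)), ‖f (z + phaseMk y) - f z‖ₑ

section Oscillation

variable {f : Torus × ℝ → ℝ}

theorem measurable_oscillation_integrand (hf : StronglyMeasurable f) :
    Measurable fun p : (Torus × ℝ) × (ℝ × ℝ) => ‖f (p.1 + phaseMk p.2) - f p.1‖ₑ := by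
  have : Continuous fun p : (Torus × ℝ) × (ℝ × ℝ) => p.1 + phaseMk p.2 :=
    continuous_fst.add (continuous_phaseMk.comp continuous_snd)
  exact ((hf.comp_measurable this.measurable).sub (hf.comp_measurable measurable_fst)).enorm

theorem measurable_oscillation (hf : StronglyMeasurable f) (r : ℝ) :
    Measurable (oscillation f r) :=
  (measurable_oscillation_integrand hf).lintegral_prod_right'

theorem lintegral_oscillation_le (hf : StronglyMeasurable f) {N : ℝ≥0∞}
    (hN : ∀ (y : ℝ × ℝ) (r : ℝ), |y.1| ≤ r → |y.2| ≤ r →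
      ∫⁻ z, ENNReal.ofReal (1 + |z.2|) * ‖f (z + phaseMk y) - f z‖ₑ
        ≤ ENNReal.ofReal (r * (1 + r)) * N) {r : ℝ} (hr : 0 ≤ r) :
    ∫⁻ z, ENNReal.ofReal (1 + |z.2|) * oscillation f r z
      ≤ ENNReal.ofReal ((2 * r) ^ 2 * (r * (1 + r))) * N := by
  have hWm : Measurable fun z : Torus × ℝ => ENNReal.ofReal (1 + |z.2|) := by
    have : Continuous fun z : Torus × ℝ => 1 + |z.2| := by fun_prop
    exact ENNReal.measurable_ofReal.comp this.measurable
  have hms : MeasurableSet (Icc (-r) r ×ˢ Icc (-r) r : Set (ℝ × ℝ)) :=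
    measurableSet_Icc.prod measurableSet_Icc
  calc ∫⁻ z, ENNReal.ofReal (1 + |z.2|) * oscillation f r z
      = ∫⁻ z, ∫⁻ y in (Icc (-r) r ×ˢ Icc (-r) r : Set (ℝ × ℝ)),
          ENNReal.ofReal (1 + |z.2|) * ‖f (z + phaseMk y) - f z‖ₑ := by
        refine lintegral_congr fun z => ?_
        rw [lintegral_const_mul' _ _ ENNReal.ofReal_ne_top, oscillation]
    _ = ∫⁻ y in (Icc (-r) r ×ˢ Icc (-r) r : Set (ℝ × ℝ)), ∫⁻ z,
          ENNReal.ofReal (1 + |z.2|) * ‖f (z + phaseMk y) - f z‖ₑ := by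
        refine lintegral_lintegral_swap (Measurable.aemeasurable ?_)
        exact (hWm.comp measurable_fst).mul (measurable_oscillation_integrand hf)
    _ ≤ ∫⁻ y in (Icc (-r) r ×ˢ Icc (-r) r : Set (ℝ × ℝ)), ENNReal.ofReal (r * (1 + r)) * N :=
        setLIntegral_mono' hms fun y hy => hN y r (abs_le.2 hy.1) (abs_le.2 hy.2)
    _ = _ := by
        rw [setLIntegral_const, volume_square hr, mul_comm, ← mul_assoc,
          ← ENNReal.ofReal_mul (by positivity)]

theorem enorm_sub_le_oscillation (hf : StronglyMeasurable f) {e : ℝ} (he : 0 < e) (z : Torus × ℝ)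
    {d : ℝ × ℝ} (h1 : |d.1| ≤ e) (h2 : |d.2| ≤ e) :
    ENNReal.ofReal ((2 * e) ^ 2) * ‖f z - f (z + phaseMk d)‖ₑ
      ≤ oscillation f (2 * e) z + oscillation f (2 * e) (z + phaseMk d) := by
  have hms : ∀ r : ℝ, MeasurableSet (Icc (-r) r ×ˢ Icc (-r) r : Set (ℝ × ℝ)) := fun r =>
    measurableSet_Icc.prod measurableSet_Icc
  have hmeas : ∀ z : Torus × ℝ, Measurable fun y : ℝ × ℝ => ‖f (z + phaseMk y) - f z‖ₑ := fun z =>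
    (measurable_oscillation_integrand hf).comp (measurable_const.prodMk measurable_id)
  have hd : Measurable fun y : ℝ × ℝ => d + y := (by fun_prop : Continuous _).measurable
  calc ENNReal.ofReal ((2 * e) ^ 2) * ‖f z - f (z + phaseMk d)‖ₑ
      = ∫⁻ y in (Icc (-e) e ×ˢ Icc (-e) e : Set (ℝ × ℝ)), ‖f z - f (z + phaseMk d)‖ₑ := by
        rw [setLIntegral_const, volume_square he.le, mul_comm]
    _ ≤ ∫⁻ y in (Icc (-e) e ×ˢ Icc (-e) e : Set (ℝ × ℝ)), (‖f (z + phaseMk (d + y)) - f z‖ₑ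
          + ‖f (z + phaseMk d + phaseMk y) - f (z + phaseMk d)‖ₑ) := by
        refine lintegral_mono fun y => ?_
        rw [phaseMk_add, ← add_assoc]
        have e : f z - f (z + phaseMk d) = -(f (z + phaseMk d + phaseMk y) - f z)
          + (f (z + phaseMk d + phaseMk y) - f (z + phaseMk d)) := by ring
        rw [e]
        refine (enorm_add_le _ _).trans ?_
        rw [enorm_neg]
    _ = (∫⁻ y in (Icc (-e) e ×ˢ Icc (-e) e : Set (ℝ × ℝ)), ‖f (z + phaseMk (d + y)) - f z‖ₑ)
          + ∫⁻ y in (Icc (-e) e ×ˢ Icc (-e) e : Set (ℝ × ℝ)),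
            ‖f (z + phaseMk d + phaseMk y) - f (z + phaseMk d)‖ₑ :=
        lintegral_add_left ((hmeas z).comp hd) _
    _ ≤ _ := by
        refine add_le_add ?_ ?_
        · rw [oscillation, ← lintegral_indicator (hms e), ← lintegral_indicator (hms (2 * e))]
          refine le_trans (lintegral_mono fun y => ?_) (lintegral_add_left_eq_self _ d).le
          by_cases hy : y ∈ (Icc (-e) e ×ˢ Icc (-e) e : Set (ℝ × ℝ))
          · rw [indicator_of_mem hy, indicator_of_mem]
            have b1 := abs_le.1 h1
            have b2 := abs_le.1 h2
            refine ⟨⟨?_, ?_⟩, ?_, ?_⟩ <;> simp only [Prod.fst_add, Prod.snd_add] <;>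
              linarith [hy.1.1, hy.1.2, hy.2.1, hy.2.2]
          · rw [indicator_of_notMem hy]; exact zero_le
        · refine lintegral_mono_set (prod_mono ?_ ?_) <;>
            exact Icc_subset_Icc (by linarith) (by linarith)

theorem lintegral_comp_sub_comp_le (hf : StronglyMeasurable f) {N : ℝ≥0∞}
    (hN : ∀ (y : ℝ × ℝ) (r : ℝ), |y.1| ≤ r → |y.2| ≤ r →
      ∫⁻ z, ENNReal.ofReal (1 + |z.2|) * ‖f (z + phaseMk y) - f z‖ₑ
        ≤ ENNReal.ofReal (r * (1 + r)) * N)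
    {Ψ Ψ' : Torus × ℝ → Torus × ℝ} {c κ : ℝ} (hc : 0 ≤ c) (hκ : 0 ≤ κ)
    (hΨ : Measurable Ψ) (hΨ' : Measurable Ψ')
    (hm : Measure.map Ψ volume = ENNReal.ofReal c • volume)
    (hm' : Measure.map Ψ' volume = ENNReal.ofReal c • volume)
    (hw : ∀ z, 1 + |z.2| ≤ κ * (1 + |(Ψ z).2|)) (hw' : ∀ z, 1 + |z.2| ≤ κ * (1 + |(Ψ' z).2|))
    {e : ℝ} (he : 0 ≤ e)
    (hd : ∀ z, ∃ d : ℝ × ℝ, Ψ' z = Ψ z + phaseMk d ∧ |d.1| ≤ e ∧ |d.2| ≤ e) :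
    ∫⁻ z, ENNReal.ofReal (1 + |z.2|) * ‖f (Ψ z) - f (Ψ' z)‖ₑ
      ≤ ENNReal.ofReal (16 * κ * c * (e * (1 + 2 * e))) * N := by
  rcases he.eq_or_lt with rfl | he
  · have : ∀ z, Ψ' z = Ψ z := fun z => by
      obtain ⟨d, hdz, h1, h2⟩ := hd z
      have : d = 0 := Prod.ext (abs_nonpos_iff.1 h1) (abs_nonpos_iff.1 h2)
      rw [hdz, this, phaseMk_zero, add_zero]
    simp [this]
  have hWm : Measurable fun z : Torus × ℝ => ENNReal.ofReal (1 + |z.2|) := by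
    have : Continuous fun z : Torus × ℝ => 1 + |z.2| := by fun_prop
    exact ENNReal.measurable_ofReal.comp this.measurable
  have hos := measurable_oscillation hf (2 * e)
  have hG : Measurable fun z : Torus × ℝ =>
    ENNReal.ofReal κ * (ENNReal.ofReal (1 + |z.2|) * oscillation f (2 * e) z) :=
    (hWm.mul hos).const_mul _
  have hpos : 0 < (2 * e) ^ 2 := by positivity
  have h2 := lintegral_oscillation_le hf hN (r := 2 * e) (by linarith)
  have hstep : ENNReal.ofReal ((2 * e) ^ 2) *
      ∫⁻ z, ENNReal.ofReal (1 + |z.2|) * ‖f (Ψ z) - f (Ψ' z)‖ₑ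
      ≤ ENNReal.ofReal ((2 * e) ^ 2) * (ENNReal.ofReal (16 * κ * c * (e * (1 + 2 * e))) * N) := by
    calc ENNReal.ofReal ((2 * e) ^ 2) *
        ∫⁻ z, ENNReal.ofReal (1 + |z.2|) * ‖f (Ψ z) - f (Ψ' z)‖ₑ
        = ∫⁻ z, ENNReal.ofReal (1 + |z.2|) *
            (ENNReal.ofReal ((2 * e) ^ 2) * ‖f (Ψ z) - f (Ψ' z)‖ₑ) := by
          rw [← lintegral_const_mul' _ _ ENNReal.ofReal_ne_top]
          exact lintegral_congr fun z => by ring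
      _ ≤ ∫⁻ z, (ENNReal.ofReal κ *
            (ENNReal.ofReal (1 + |(Ψ z).2|) * oscillation f (2 * e) (Ψ z)) +
            ENNReal.ofReal κ *
            (ENNReal.ofReal (1 + |(Ψ' z).2|) * oscillation f (2 * e) (Ψ' z))) := by
          refine lintegral_mono fun z => ?_
          obtain ⟨d, hdz, h1, h2⟩ := hd z
          have h3 := enorm_sub_le_oscillation hf he (Ψ z) h1 h2
          rw [← hdz] at h3
          refine (mul_le_mul_right h3 _).trans ?_
          rw [mul_add, ← mul_assoc, ← mul_assoc, ← ENNReal.ofReal_mul hκ, ← ENNReal.ofReal_mul hκ]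
          exact add_le_add (mul_le_mul_left (ENNReal.ofReal_le_ofReal (hw z)) _)
            (mul_le_mul_left (ENNReal.ofReal_le_ofReal (hw' z)) _)
      _ = 2 * (ENNReal.ofReal c * (ENNReal.ofReal κ *
            ∫⁻ z, ENNReal.ofReal (1 + |z.2|) * oscillation f (2 * e) z)) := by
          rw [lintegral_add_left (show Measurable fun z => ENNReal.ofReal κ *
            (ENNReal.ofReal (1 + |(Ψ z).2|) * oscillation f (2 * e) (Ψ z)) from hG.comp hΨ), lintegral_comp_of_map_eq hΨ hm hG,
            lintegral_comp_of_map_eq hΨ' hm' hG, lintegral_const_mul' _ _ ENNReal.ofReal_ne_top,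
            ← two_mul]
      _ ≤ 2 * (ENNReal.ofReal c * (ENNReal.ofReal κ *
            (ENNReal.ofReal ((2 * (2 * e)) ^ 2 * (2 * e * (1 + 2 * e))) * N))) := by gcongr
      _ = _ := by
          have e1 : (2 : ℝ≥0∞) = ENNReal.ofReal 2 := by simp
          have e2 : ∀ a b c d : ℝ≥0∞, a * (b * (c * (d * N))) = a * b * c * d * N := fun a b c d => by
            ring
          rw [e1, e2, ← mul_assoc (ENNReal.ofReal ((2 * e) ^ 2)), ← ENNReal.ofReal_mul (by norm_num),
            ← ENNReal.ofReal_mul (by positivity), ← ENNReal.ofReal_mul (by positivity),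
            ← ENNReal.ofReal_mul (by positivity)]
          congr 2; ring
  exact (ENNReal.mul_le_mul_iff_right (ENNReal.ofReal_pos.2 hpos).ne' ENNReal.ofReal_ne_top).1 hstep

end Oscillation

/-! ### Transport of densities along the characteristics -/

theorem measurable_backFlow {T M L : ℝ} {w : ℝ → C(Torus, ℝ)} {X : ℝ → ℝ → Torus × ℝ → Torus}
    {V : ℝ → ℝ → Torus × ℝ → ℝ} (hw : IsAdmissibleField T M L w)
    (h : IsCharacteristicFlow T (fun t x => w t x) X V) {t : ℝ} (ht : t ∈ Icc 0 T) :
    Measurable (backFlow X V t) := (continuous_backFlow hw h ht).measurable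

theorem ofReal_exp_mul_ofReal_exp_neg (t : ℝ) :
    ENNReal.ofReal (Real.exp t) * ENNReal.ofReal (Real.exp (-t)) = 1 := by
  rw [← ENNReal.ofReal_mul (Real.exp_pos _).le, ← Real.exp_add]; simp

theorem stronglyMeasurable_coe (f : L1xv) : StronglyMeasurable f := Lp.stronglyMeasurable f

theorem integrable_coe (f : L1xv) : Integrable f := L1.integrable_coeFn f

section Transport

variable {T M L : ℝ} {w : ℝ → C(Torus, ℝ)} {X : ℝ → ℝ → Torus × ℝ → Torus}
  {V : ℝ → ℝ → Torus × ℝ → ℝ}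

theorem lintegral_comp_backFlow (hw : IsAdmissibleField T M L w)
    (h : IsCharacteristicFlow T (fun t x => w t x) X V) {t : ℝ} (ht : t ∈ Icc 0 T)
    {G : Torus × ℝ → ℝ≥0∞} (hG : Measurable G) :
    ENNReal.ofReal (Real.exp t) * ∫⁻ z, G (backFlow X V t z) = ∫⁻ z, G z := by
  rw [lintegral_comp_of_map_eq (measurable_backFlow hw h ht) (map_backFlow hw h ht) hG, ← mul_assoc,
    ofReal_exp_mul_ofReal_exp_neg, one_mul]

/-- Weighted `L¹` bound for a transported function. -/
theorem lintegral_transport_le (hw : IsAdmissibleField T M L w)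
    (h : IsCharacteristicFlow T (fun t x => w t x) X V) {t : ℝ} (ht : t ∈ Icc 0 T)
    {g : Torus × ℝ → ℝ} (hg : StronglyMeasurable g) {ρ ρ' : Torus × ℝ → ℝ≥0∞} (hρ' : Measurable ρ')
    (hle : ∀ z, ρ z ≤ ρ' (backFlow X V t z)) :
    ∫⁻ z, ρ z * ‖Real.exp t * g (backFlow X V t z)‖ₑ ≤ ∫⁻ z, ρ' z * ‖g z‖ₑ := by
  rw [← lintegral_comp_backFlow hw h ht (show Measurable fun z => ρ' z * ‖g z‖ₑ from
    hρ'.mul hg.enorm), ← lintegral_const_mul' _ _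
    ENNReal.ofReal_ne_top]
  refine lintegral_mono fun z => ?_
  rw [enorm_mul, Real.enorm_of_nonneg (Real.exp_pos _).le, ← mul_assoc, ← mul_assoc,
    mul_comm (ENNReal.ofReal _)]
  gcongr
  exact hle z

/-- Weighted `L²` bound for a transported function. -/
theorem lintegral_sq_transport_le (hw : IsAdmissibleField T M L w)
    (h : IsCharacteristicFlow T (fun t x => w t x) X V) {t : ℝ} (ht : t ∈ Icc 0 T)
    {g : Torus × ℝ → ℝ} (hg : StronglyMeasurable g) {ρ ρ' : Torus × ℝ → ℝ≥0∞} (hρ' : Measurable ρ')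
    (hle : ∀ z, ρ z ≤ ρ' (backFlow X V t z)) :
    ∫⁻ z, ρ z * ‖Real.exp t * g (backFlow X V t z)‖ₑ ^ 2
      ≤ ENNReal.ofReal (Real.exp t) * ∫⁻ z, ρ' z * ‖g z‖ₑ ^ 2 := by
  rw [← lintegral_comp_backFlow hw h ht (show Measurable fun z => ρ' z * ‖g z‖ₑ ^ 2 from
    hρ'.mul (hg.enorm.pow_const 2)), ← lintegral_const_mul' _ _
    ENNReal.ofReal_ne_top, ← lintegral_const_mul' _ _ ENNReal.ofReal_ne_top]
  refine lintegral_mono fun z => ?_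
  rw [enorm_mul, Real.enorm_of_nonneg (Real.exp_pos _).le, mul_pow]
  calc ρ z * (ENNReal.ofReal (Real.exp t) ^ 2 * ‖g (backFlow X V t z)‖ₑ ^ 2)
      ≤ ρ' (backFlow X V t z) * (ENNReal.ofReal (Real.exp t) ^ 2 * ‖g (backFlow X V t z)‖ₑ ^ 2) := by
        gcongr; exact hle z
    _ = _ := by ring

theorem IsCharacteristicFlow.abs_le_backFlow (hw : IsAdmissibleField T M L w)
    (h : IsCharacteristicFlow T (fun t x => w t x) X V) {t : ℝ} (ht : t ∈ Icc 0 T) (z : Torus × ℝ) :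
    |z.2| ≤ 2 * (|(backFlow X V t z).2| + M * T) * Real.exp (2 * T) := by
  obtain ⟨c, -, v⟩ := h.isCharacteristic ht z
  have := c.abs_vel_le hw (zero_mem_of_mem ht) ht
  rwa [v] at this

/-- The weight constant for moments of order `k`. -/
noncomputable def momentConst (T M k : ℝ) : ℝ :=
  1 + (4 * Real.exp (2 * T)) ^ k * (1 + (M * T) ^ k)

theorem one_le_momentConst (hT : 0 ≤ T) (hM : 0 ≤ M) (k : ℝ) : 1 ≤ momentConst T M k := by
  unfold momentConst
  have : 0 ≤ (4 * Real.exp (2 * T)) ^ k * (1 + (M * T) ^ k) := by positivity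
  linarith

theorem IsCharacteristicFlow.weight_le (hw : IsAdmissibleField T M L w)
    (h : IsCharacteristicFlow T (fun t x => w t x) X V) {t : ℝ} (ht : t ∈ Icc 0 T) {k : ℝ}
    (hk : 0 ≤ k) (z : Torus × ℝ) :
    1 + |z.2| ^ k ≤ momentConst T M k * (1 + |(backFlow X V t z).2| ^ k) := by
  have hT : 0 ≤ T := ht.1.trans ht.2
  have hM : 0 ≤ M := (norm_nonneg _).trans (hw.norm_le t ht)
  have h1 := h.abs_le_backFlow hw ht z
  set a := |(backFlow X V t z).2| with ha
  have ha0 : 0 ≤ a := abs_nonneg _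
  have hMT : 0 ≤ M * T := mul_nonneg hM hT
  have h2 : |z.2| ≤ (4 * Real.exp (2 * T)) * max a (M * T) := by
    have := add_le_add (le_max_left a (M * T)) (le_max_right a (M * T))
    nlinarith [Real.exp_pos (2 * T)]
  have h3 : |z.2| ^ k ≤ (4 * Real.exp (2 * T)) ^ k * (a ^ k + (M * T) ^ k) := by
    refine (Real.rpow_le_rpow (abs_nonneg _) h2 hk).trans ?_
    rw [Real.mul_rpow (by positivity) (by positivity)]
    refine mul_le_mul_of_nonneg_left ?_ (by positivity)
    have e1 : 0 ≤ a ^ k := by positivity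
    have e2 : 0 ≤ (M * T) ^ k := by positivity
    rcases max_choice a (M * T) with h | h <;> rw [h] <;> linarith
  unfold momentConst
  have e1 : 0 ≤ a ^ k := by positivity
  have e2 : 0 ≤ (M * T) ^ k := by positivity
  have e3 : 0 ≤ (4 * Real.exp (2 * T)) ^ k := by positivity
  nlinarith [mul_nonneg e3 (mul_nonneg e1 e2), mul_nonneg e3 e1, mul_nonneg e3 e2]

theorem exists_transport (hw : IsAdmissibleField T M L w)
    (h : IsCharacteristicFlow T (fun t x => w t x) X V) (f₀ : L1xv) :
    ∃ f : ℝ → L1xv, ∀ t ∈ Icc 0 T, (f t : Torus × ℝ → ℝ) =ᵐ[volume]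
      fun z => Real.exp t * f₀ (backFlow X V t z) := by
  have hmem : ∀ t ∈ Icc 0 T, MemLp (fun z => Real.exp t * f₀ (backFlow X V t z)) 1 volume := by
    intro t ht
    rw [memLp_one_iff_integrable]
    have hm := ((stronglyMeasurable_coe f₀).comp_measurable (measurable_backFlow hw h ht)).const_mul
      (Real.exp t)
    refine ⟨hm.aestronglyMeasurable, ?_⟩
    have := lintegral_transport_le hw h ht (stronglyMeasurable_coe f₀) (ρ := 1) (ρ' := 1)
      measurable_one (fun _ => le_rfl)
    simp only [Pi.one_apply, one_mul] at this
    exact this.trans_lt (integrable_coe f₀).2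
  refine ⟨fun t => if ht : t ∈ Icc 0 T then (hmem t ht).toLp _ else 0, fun t ht => ?_⟩
  simp only [dif_pos ht]
  exact MemLp.coeFn_toLp _

variable {f₀ : L1xv} {f : ℝ → L1xv}

theorem gNorm_transport_le (hw : IsAdmissibleField T M L w)
    (h : IsCharacteristicFlow T (fun t x => w t x) X V) {t : ℝ} (ht : t ∈ Icc 0 T)
    {g : Torus × ℝ → ℝ} (hg : StronglyMeasurable g) {k : ℝ} (hk : 0 ≤ k) :
    ∫⁻ z, ENNReal.ofReal (1 + |z.2| ^ k) * ‖Real.exp t * g (backFlow X V t z)‖ₑ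
      ≤ ENNReal.ofReal (momentConst T M k) * ∫⁻ z, ENNReal.ofReal (1 + |z.2| ^ k) * ‖g z‖ₑ := by
  have hT : 0 ≤ T := ht.1.trans ht.2
  have hM : 0 ≤ M := (norm_nonneg _).trans (hw.norm_le t ht)
  have hκ : 0 ≤ momentConst T M k := zero_le_one.trans (one_le_momentConst hT hM k)
  have hm : Measurable fun z : Torus × ℝ => ENNReal.ofReal (1 + |z.2| ^ k) := by fun_prop
  have := lintegral_transport_le hw h ht hg
    (ρ := fun z => ENNReal.ofReal (1 + |z.2| ^ k))
    (ρ' := fun z => ENNReal.ofReal (momentConst T M k) * ENNReal.ofReal (1 + |z.2| ^ k))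
    (hm.const_mul _) (fun z => by
      rw [← ENNReal.ofReal_mul hκ]
      exact ENNReal.ofReal_le_ofReal (h.weight_le hw ht hk z))
  refine this.trans (le_of_eq ?_)
  rw [← lintegral_const_mul' _ _ ENNReal.ofReal_ne_top]
  simp only [mul_assoc]

theorem lintegral_congr_enorm {f g : Torus × ℝ → ℝ} (h : f =ᵐ[volume] g)
    (ρ : Torus × ℝ → ℝ≥0∞) : ∫⁻ z, ρ z * ‖f z‖ₑ = ∫⁻ z, ρ z * ‖g z‖ₑ :=
  lintegral_congr_ae (by filter_upwards [h] with z hz; rw [hz])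

theorem exists_compact_approx {k : ℝ} (hk : 0 ≤ k) (hf₀ : MemG k f₀) {e : ℝ≥0∞} (he : e ≠ 0) :
    ∃ g : Torus × ℝ → ℝ, HasCompactSupport g ∧ Continuous g ∧
      ∫⁻ z, ENNReal.ofReal (1 + |z.2| ^ k) * ‖f₀ z - g z‖ₑ ≤ e := by
  have hWc : Continuous fun z : Torus × ℝ => 1 + |z.2| ^ k :=
    continuous_const.add ((continuous_abs.comp continuous_snd).rpow_const fun _ => Or.inr hk)
  have hWpos : ∀ z : Torus × ℝ, 0 < 1 + |z.2| ^ k := fun z => by positivity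
  have hWe : ∀ (z : Torus × ℝ) (a : ℝ), ‖(1 + |z.2| ^ k) * a‖ₑ
      = ENNReal.ofReal (1 + |z.2| ^ k) * ‖a‖ₑ := fun z a => by
    rw [enorm_mul, Real.enorm_of_nonneg (hWpos z).le]
  have hint : Integrable fun z : Torus × ℝ => (1 + |z.2| ^ k) * f₀ z := by
    refine ⟨(hWc.stronglyMeasurable.mul (stronglyMeasurable_coe f₀)).aestronglyMeasurable, ?_⟩
    rw [HasFiniteIntegral]
    simp only [hWe]
    exact hf₀
  obtain ⟨g, hgc, hgle, hg, -⟩ := hint.exists_hasCompactSupport_lintegral_sub_le he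
  refine ⟨fun z => (1 + |z.2| ^ k)⁻¹ * g z, hgc.mul_left,
    (hWc.inv₀ fun z => (hWpos z).ne').mul hg, ?_⟩
  refine le_trans (le_of_eq (lintegral_congr fun z => ?_)) hgle
  rw [← hWe, mul_sub, ← mul_assoc, mul_inv_cancel₀ (hWpos z).ne', one_mul]

theorem continuousInG_of_transport (hw : IsAdmissibleField T M L w)
    (h : IsCharacteristicFlow T (fun t x => w t x) X V)
    (hf : ∀ t ∈ Icc 0 T, (f t : Torus × ℝ → ℝ) =ᵐ[volume]
      fun z => Real.exp t * f₀ (backFlow X V t z)) {k : ℝ} (hk : 0 ≤ k) (hf₀ : MemG k f₀) :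
    ContinuousInG T k f := by
  intro t ht
  have hT : 0 ≤ T := ht.1.trans ht.2
  have hM : 0 ≤ M := (norm_nonneg _).trans (hw.norm_le t ht)
  have hWc : Continuous fun z : Torus × ℝ => 1 + |z.2| ^ k :=
    continuous_const.add ((continuous_abs.comp continuous_snd).rpow_const fun _ => Or.inr hk)
  set W : Torus × ℝ → ℝ≥0∞ := fun z => ENNReal.ofReal (1 + |z.2| ^ k) with hW
  have hWm : Measurable W := ENNReal.measurable_ofReal.comp hWc.measurable
  set κ := ENNReal.ofReal (momentConst T M k) with hκ
  constructor
  · rw [MemG, gNorm, lintegral_congr_enorm (hf t ht)]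
    exact (gNorm_transport_le hw h ht (stronglyMeasurable_coe f₀) hk).trans_lt
      (ENNReal.mul_lt_top ENNReal.ofReal_lt_top hf₀)
  rw [ENNReal.tendsto_nhds_zero]
  intro e he
  set κ' := κ + 1 with hκ'
  have hκ'0 : κ' ≠ 0 := by simp [hκ']
  have hκ't : κ' ≠ ⊤ := by simp [hκ', hκ]
  obtain ⟨g, hgc, hg, hgle⟩ := exists_compact_approx hk hf₀ (e := e / 4 / κ')
    (ENNReal.div_pos (ENNReal.div_pos he.ne' (by simp)).ne' hκ't).ne'
  have hκe : κ * (e / 4 / κ') ≤ e / 4 := by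
    calc κ * (e / 4 / κ') ≤ κ' * (e / 4 / κ') := by gcongr; simp [hκ']
      _ = e / 4 := ENNReal.mul_div_cancel hκ'0 hκ't
  -- the compactly supported part
  obtain ⟨R, hR⟩ : ∃ R : ℝ, ∀ z : Torus × ℝ, R < |z.2| → g z = 0 := by
    obtain ⟨R, hR⟩ := (hgc.isCompact.image continuous_snd).isBounded.exists_norm_le
    refine ⟨R, fun z hz => ?_⟩
    by_contra hne
    exact absurd (hR z.2 ⟨z, subset_tsupport _ hne, rfl⟩) (not_le.2 hz)
  obtain ⟨C, hC⟩ := hgc.exists_bound_of_continuous hg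
  have hC0 : 0 ≤ C := (norm_nonneg _).trans (hC 0)
  set R' := 2 * (R + M * T) * Real.exp (2 * T) with hR'
  set S : Set (Torus × ℝ) := univ ×ˢ Icc (-R') R' with hS
  set F : ℝ → Torus × ℝ → ℝ := fun s z => Real.exp s * g (backFlow X V s z) with hF
  have hFb : ∀ s ∈ Icc 0 T, ∀ z, ‖F s z‖ ≤ S.indicator (fun _ => Real.exp T * C) z := by
    intro s hs z
    by_cases hz : |(backFlow X V s z).2| ≤ R
    · rw [indicator_of_mem]
      · simp only [hF]
        rw [norm_mul, Real.norm_of_nonneg (Real.exp_pos _).le]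
        exact mul_le_mul (Real.exp_le_exp.2 hs.2) (hC _) (norm_nonneg _) (Real.exp_pos _).le
      · refine ⟨mem_univ _, abs_le.1 ((h.abs_le_backFlow hw hs z).trans ?_)⟩
        rw [hR']
        gcongr
    · simp only [hF]
      rw [hR _ (not_le.1 hz), mul_zero, norm_zero]
      exact indicator_nonneg (fun _ _ => by positivity) z
  have hFm : ∀ s ∈ Icc 0 T, Measurable (F s) := fun s hs =>
    ((hg.measurable.comp (measurable_backFlow hw h hs)).const_mul _)
  have hlim : Tendsto (fun s => ∫⁻ z, W z * ‖F s z - F t z‖ₑ) (𝓝[Icc 0 T] t) (𝓝 0) := by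
    have : ∫⁻ z : Torus × ℝ, (0 : ℝ≥0∞) = 0 := by simp
    rw [← this]
    refine tendsto_lintegral_filter_of_dominated_convergence
      (fun z => W z * S.indicator (fun _ => ENNReal.ofReal (2 * (Real.exp T * C))) z) ?_ ?_ ?_ ?_
    · filter_upwards [self_mem_nhdsWithin] with s hs
      exact hWm.mul ((hFm s hs).sub (hFm t ht)).enorm
    · filter_upwards [self_mem_nhdsWithin] with s hs
      refine ae_of_all _ fun z => mul_le_mul_right ?_ _
      have h1 := hFb s hs z
      have h2 := hFb t ht z
      have h3 := norm_sub_le (F s z) (F t z)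
      by_cases hz : z ∈ S
      · rw [indicator_of_mem hz] at h1 h2 ⊢
        rw [← ofReal_norm]
        exact ENNReal.ofReal_le_ofReal (by linarith)
      · rw [indicator_of_notMem hz] at h1 h2 ⊢
        rw [← ofReal_norm]
        exact (ENNReal.ofReal_of_nonpos (by linarith)).le
    · have hSm : MeasurableSet S := MeasurableSet.univ.prod measurableSet_Icc
      have hSc : IsCompact S := isCompact_univ.prod isCompact_Icc
      have e1 : ∀ z, W z * S.indicator (fun _ => ENNReal.ofReal (2 * (Real.exp T * C))) z
          = S.indicator (fun z => W z * ENNReal.ofReal (2 * (Real.exp T * C))) z := fun z => by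
        by_cases hz : z ∈ S <;> simp [hz]
      simp only [e1]
      rw [lintegral_indicator hSm, lintegral_mul_const' _ _ ENNReal.ofReal_ne_top]
      refine ENNReal.mul_ne_top ?_ ENNReal.ofReal_ne_top
      have h4 := (hWc.continuousOn.integrableOn_compact (μ := volume) hSc).2
      rw [HasFiniteIntegral] at h4
      refine (lt_of_le_of_lt (lintegral_mono fun z => ?_) h4).ne
      rw [Real.enorm_of_nonneg (by positivity)]
    · refine ae_of_all _ fun z => ?_
      have hc : ContinuousWithinAt (fun s => F s z) (Icc 0 T) t :=
        (Real.continuous_exp.continuousWithinAt).mul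
          (hg.continuousAt.comp_continuousWithinAt (continuousOn_backFlow_time hw h z t ht))
      have h5 : Tendsto (fun s => F s z - F t z) (𝓝[Icc 0 T] t) (𝓝 0) := by
        have := hc.tendsto.sub_const (F t z)
        simpa using this
      have h6 : Tendsto (fun s => ‖F s z - F t z‖ₑ) (𝓝[Icc 0 T] t) (𝓝 0) := by
        have := h5.enorm
        simpa using this
      have := ENNReal.Tendsto.const_mul (a := W z) h6 (Or.inr ENNReal.ofReal_ne_top)
      simpa using this
  have hev := (ENNReal.tendsto_nhds_zero.1 hlim) (e / 4) (ENNReal.div_pos he.ne' (by simp))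
  filter_upwards [hev, self_mem_nhdsWithin] with s hse hs
  have hsub : StronglyMeasurable fun z => f₀ z - g z :=
    (stronglyMeasurable_coe f₀).sub hg.stronglyMeasurable
  set D : ℝ → Torus × ℝ → ℝ := fun s z => Real.exp s * (f₀ (backFlow X V s z) - g (backFlow X V s z))
    with hD
  have hDm : ∀ s ∈ Icc 0 T, Measurable (D s) := fun s hs =>
    ((hsub.measurable.comp (measurable_backFlow hw h hs)).const_mul _)
  have hDle : ∀ s ∈ Icc 0 T, ∫⁻ z, W z * ‖D s z‖ₑ ≤ e / 4 := fun s hs =>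
    (gNorm_transport_le hw h hs hsub hk).trans ((mul_le_mul_right hgle _).trans hκe)
  have hcoe : (f s - f t : L1xv) =ᵐ[volume] fun z => D s z - D t z + (F s z - F t z) := by
    filter_upwards [Lp.coeFn_sub (f s) (f t), hf s hs, hf t ht] with z h1 h2 h3
    rw [h1, Pi.sub_apply, h2, h3]
    simp only [hD, hF]; ring
  rw [gNorm, lintegral_congr_enorm hcoe]
  calc ∫⁻ z, W z * ‖D s z - D t z + (F s z - F t z)‖ₑ
      ≤ ∫⁻ z, (W z * ‖D s z‖ₑ + (W z * ‖D t z‖ₑ + W z * ‖F s z - F t z‖ₑ)) := by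
        refine lintegral_mono fun z => ?_
        rw [← mul_add, ← mul_add]
        refine mul_le_mul_right ?_ _
        rw [← add_assoc]
        refine (enorm_add_le _ _).trans (add_le_add ?_ le_rfl)
        rw [sub_eq_add_neg]
        refine (enorm_add_le _ _).trans ?_
        rw [enorm_neg]
    _ = (∫⁻ z, W z * ‖D s z‖ₑ) + ((∫⁻ z, W z * ‖D t z‖ₑ) + ∫⁻ z, W z * ‖F s z - F t z‖ₑ) := by
        rw [lintegral_add_left (show Measurable fun z => W z * ‖D s z‖ₑ from
          hWm.mul (hDm s hs).enorm), lintegral_add_left (show Measurable fun z => W z * ‖D t z‖ₑ from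
          hWm.mul (hDm t ht).enorm)]
    _ ≤ e / 4 + (e / 4 + e / 4) := by gcongr; exacts [hDle s hs, hDle t ht]
    _ ≤ e / 4 + (e / 4 + e / 4) + e / 4 := le_self_add
    _ = e := by
        have : e / 4 = e / 2 / 2 := by
          rw [div_eq_mul_inv, div_eq_mul_inv, div_eq_mul_inv, mul_assoc,
            ← ENNReal.mul_inv (by simp) (by simp)]
          norm_num
        rw [this, add_assoc, add_assoc, ENNReal.add_halves, ← add_assoc, ENNReal.add_halves,
          ENNReal.add_halves]

theorem memG0_of_transport (hw : IsAdmissibleField T M L w)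
    (h : IsCharacteristicFlow T (fun t x => w t x) X V)
    (hf : ∀ t ∈ Icc 0 T, (f t : Torus × ℝ → ℝ) =ᵐ[volume]
      fun z => Real.exp t * f₀ (backFlow X V t z)) {k : ℝ} (hk : 0 ≤ k) (hf₀ : MemG0 k f₀)
    {t : ℝ} (ht : t ∈ Icc 0 T) : MemG0 k (f t) := by
  have hmap := map_backFlow hw h ht
  have hmeas := measurable_backFlow hw h ht
  refine ⟨(continuousInG_of_transport hw h hf hk hf₀.1 t ht).1, ?_, ?_⟩
  · rw [← Lp.coeFn_nonneg]
    have h0 : ∀ᵐ z, 0 ≤ f₀ z := (Lp.coeFn_nonneg f₀).2 hf₀.2.1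
    have h1 : ∀ᵐ z, 0 ≤ f₀ (backFlow X V t z) := by
      refine ae_of_ae_map (p := fun z => 0 ≤ f₀ z) hmeas.aemeasurable ?_
      rw [hmap]
      exact Measure.ae_smul_measure h0 _
    filter_upwards [hf t ht, h1] with z h2 h3
    rw [h2]
    exact mul_nonneg (Real.exp_pos _).le h3
  · rw [integral_congr_ae (hf t ht), integral_const_mul,
      ← integral_map hmeas.aemeasurable (stronglyMeasurable_coe f₀).aestronglyMeasurable, hmap,
      integral_smul_measure, hf₀.2.2, ENNReal.toReal_ofReal (Real.exp_pos _).le, smul_eq_mul,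
      mul_one, ← Real.exp_add, add_neg_cancel, Real.exp_zero]

end Transport

/-- Lipschitz dependence of the transported density on the field. -/
theorem exists_transport_lipschitz (f₀ : L1xv) (hf₀' : HasWeightedIntegrableGradient f₀)
    (T M L : ℝ) :
    ∃ K : ℝ, 0 ≤ K ∧ ∀ (w w' : ℝ → C(Torus, ℝ)) (X X' : ℝ → ℝ → Torus × ℝ → Torus)
      (V V' : ℝ → ℝ → Torus × ℝ → ℝ) (f f' : ℝ → L1xv),
      IsAdmissibleField T M L w → IsAdmissibleField T M L w' →
      IsCharacteristicFlow T (fun t x => w t x) X V →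
      IsCharacteristicFlow T (fun t x => w' t x) X' V' →
      (∀ t ∈ Icc 0 T, (f t : Torus × ℝ → ℝ) =ᵐ[volume]
        fun z => Real.exp t * f₀ (backFlow X V t z)) →
      (∀ t ∈ Icc 0 T, (f' t : Torus × ℝ → ℝ) =ᵐ[volume]
        fun z => Real.exp t * f₀ (backFlow X' V' t z)) →
      ∀ t ∈ Icc 0 T, ∀ e : ℝ, (∀ r ∈ Icc 0 t, ‖w r - w' r‖ ≤ e) →
        ∫⁻ z, ENNReal.ofReal (1 + |z.2|) * ‖f t z - f' t z‖ₑ ≤ ENNReal.ofReal (K * e) := by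
  obtain ⟨N', hNt, hN⟩ := hf₀'.exists_translation_bound (integrable_coe f₀)
  obtain ⟨N, hN0, rfl⟩ : ∃ N : ℝ, 0 ≤ N ∧ N' = ENNReal.ofReal N :=
    ⟨N'.toReal, ENNReal.toReal_nonneg, (ENNReal.ofReal_toReal hNt).symm⟩
  set A : ℝ := 2 * T * Real.exp (2 * (2 + L) * T) with hA
  set κ := momentConst T M 1 with hκ
  refine ⟨max 0 (16 * κ * (A * (1 + 2 * (A * (2 * M)))) * N), le_max_left _ _, ?_⟩
  intro w w' X X' V V' f f' hw hw' h h' hf hf' t ht e he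
  have hT : 0 ≤ T := ht.1.trans ht.2
  have hM : 0 ≤ M := (norm_nonneg _).trans (hw.norm_le t ht)
  have hL := hw.nonneg
  have hA0 : 0 ≤ A := by positivity
  have hκ1 : 1 ≤ κ := one_le_momentConst hT hM 1
  set e' := min e (2 * M) with he'
  have hee : ∀ r ∈ Icc 0 t, ‖w r - w' r‖ ≤ e' := fun r hr => by
    have hr' : r ∈ Icc 0 T := ⟨hr.1, hr.2.trans ht.2⟩
    refine le_min (he r hr) ((norm_sub_le _ _).trans ?_)
    linarith [hw.norm_le r hr', hw'.norm_le r hr']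
  have htt : t ∈ Icc 0 t := ⟨ht.1, le_rfl⟩
  have he'0 : 0 ≤ e' := (norm_nonneg _).trans (hee t htt)
  have hd : ∀ z, ∃ d : ℝ × ℝ, backFlow X' V' t z = backFlow X V t z + phaseMk d ∧
      |d.1| ≤ A * e' ∧ |d.2| ≤ A * e' := by
    intro z
    obtain ⟨c, p, v⟩ := h.isCharacteristic ht z
    obtain ⟨c', p', v'⟩ := h'.isCharacteristic ht z
    obtain ⟨d, hd, hb⟩ := (c.mono ht.2).stability (hw.mono ht.2) (hw'.mono ht.2) (c'.mono ht.2)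
      htt (d := 0) (e := e') (by simp only [p, p']; simp) hee 0 ⟨le_rfl, ht.1⟩
    simp only [v, v', sub_self, abs_zero, zero_add] at hb
    have hb' : |d| + |V' 0 t z - V 0 t z| ≤ A * e' := by
      refine hb.trans ?_
      have : A * e' = 2 * (e' * T) * Real.exp (2 * (2 + L) * T) := by rw [hA]; ring
      rw [this]
      have := ht.1
      gcongr
      · exact ht.2
      · exact ht.2
    refine ⟨(d, V' 0 t z - V 0 t z), ?_, ?_, ?_⟩
    · exact Prod.ext hd (by simp [backFlow, phaseMk])
    · simp only; linarith [abs_nonneg (V' 0 t z - V 0 t z)]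
    · simp only; linarith [abs_nonneg d]
  have hwt : ∀ {w : ℝ → C(Torus, ℝ)} {X : ℝ → ℝ → Torus × ℝ → Torus}
      {V : ℝ → ℝ → Torus × ℝ → ℝ}, IsAdmissibleField T M L w →
      IsCharacteristicFlow T (fun t x => w t x) X V →
      ∀ z : Torus × ℝ, 1 + |z.2| ≤ κ * (1 + |(backFlow X V t z).2|) := by
    intro w X V hw h z
    simpa using h.weight_le hw ht zero_le_one z
  have key := lintegral_comp_sub_comp_le (stronglyMeasurable_coe f₀) hN (Real.exp_pos (-t)).le
    (zero_le_one.trans hκ1) (measurable_backFlow hw h ht) (measurable_backFlow hw' h' ht)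
    (map_backFlow hw h ht) (map_backFlow hw' h' ht) (hwt hw h) (hwt hw' h')
    (mul_nonneg hA0 he'0) hd
  have e1 : ∫⁻ z, ENNReal.ofReal (1 + |z.2|) * ‖f t z - f' t z‖ₑ
      = ENNReal.ofReal (Real.exp t) * ∫⁻ z, ENNReal.ofReal (1 + |z.2|) *
        ‖f₀ (backFlow X V t z) - f₀ (backFlow X' V' t z)‖ₑ := by
    rw [← lintegral_const_mul' _ _ ENNReal.ofReal_ne_top]
    refine lintegral_congr_ae ?_
    filter_upwards [hf t ht, hf' t ht] with z h1 h2
    rw [h1, h2, ← mul_sub, enorm_mul, Real.enorm_of_nonneg (Real.exp_pos _).le]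
    ring
  rw [e1]
  refine (mul_le_mul_right key _).trans ?_
  rw [← mul_assoc, ← ENNReal.ofReal_mul (Real.exp_pos _).le,
    ← ENNReal.ofReal_mul (by positivity)]
  refine ENNReal.ofReal_le_ofReal ?_
  have e2 : Real.exp t * Real.exp (-t) = 1 := by rw [← Real.exp_add]; simp
  have e3 : Real.exp t * (16 * κ * Real.exp (-t) * (A * e' * (1 + 2 * (A * e')))) * N
      = (16 * κ * (A * (1 + 2 * (A * e'))) * N) * e' := by
    calc _ = (Real.exp t * Real.exp (-t)) *
        ((16 * κ * (A * (1 + 2 * (A * e'))) * N) * e') := by ring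
      _ = _ := by rw [e2, one_mul]
  rw [e3]
  refine mul_le_mul (le_trans ?_ (le_max_right _ _)) (min_le_left _ _) he'0 (le_max_left _ _)
  have : e' ≤ 2 * M := min_le_right _ _
  gcongr

/-! ### Fourier coefficients of real continuous functions on the torus -/

theorem volume_torus : (volume : Measure Torus) = AddCircle.haarAddCircle := by
  rw [AddCircle.volume_eq_smul_haarAddCircle, ENNReal.ofReal_one, one_smul]

noncomputable def realCoeff (g : Torus → ℝ) (k : ℤ) : ℂ :=
  fourierCoeff (fun x : Torus => ((g x : ℝ) : ℂ)) k

def complexify (g : C(Torus, ℝ)) : C(Torus, ℂ) :=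
  ⟨fun x => ((g x : ℝ) : ℂ), Complex.continuous_ofReal.comp g.continuous⟩

theorem norm_fourier_apply (k : ℤ) (x : Torus) : ‖fourier k x‖ = 1 := by
  rw [fourier_apply, Circle.norm_coe]

theorem integrable_haar_of_continuous {g : Torus → ℂ} (hg : Continuous g) :
    Integrable g AddCircle.haarAddCircle :=
  (BoundedContinuousFunction.mkOfCompact ⟨g, hg⟩).integrable _

theorem realCoeff_sub (g h : C(Torus, ℝ)) (k : ℤ) :
    realCoeff (g - h : C(Torus, ℝ)) k = realCoeff g k - realCoeff h k := by
  simp only [realCoeff, fourierCoeff]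
  rw [← integral_sub]
  · refine integral_congr_ae (Eventually.of_forall fun x => ?_)
    simp only [ContinuousMap.sub_apply, Complex.ofReal_sub, smul_sub]
  · exact integrable_haar_of_continuous
      ((fourier (-k)).continuous.smul (complexify g).continuous)
  · exact integrable_haar_of_continuous
      ((fourier (-k)).continuous.smul (complexify h).continuous)

theorem hasSum_realCoeff {g : C(Torus, ℝ)} (hg : Summable fun k => ‖realCoeff g k‖) (x : Torus) :
    HasSum (fun k => realCoeff g k • fourier k x) ((g x : ℝ) : ℂ) :=
  has_pointwise_sum_fourier_series_of_summable (f := complexify g) hg.of_norm x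

theorem norm_le_tsum_of_coeff_le {g : C(Torus, ℝ)} {b : ℤ → ℝ} (hb : Summable b)
    (h : ∀ k, ‖realCoeff g k‖ ≤ b k) : ‖g‖ ≤ ∑' k, b k := by
  have hs : Summable fun k => ‖realCoeff g k‖ := hb.of_nonneg_of_le (fun _ => norm_nonneg _) h
  refine (ContinuousMap.norm_le _ (tsum_nonneg fun k => (norm_nonneg _).trans (h k))).2 fun x => ?_
  rw [← Complex.norm_real, ← (hasSum_realCoeff hs x).tsum_eq]
  refine tsum_of_norm_bounded hb.hasSum fun k => ?_
  rw [norm_smul, norm_fourier_apply, mul_one]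
  exact h k

theorem norm_fourier_add_sub_le (k : ℤ) (x : Torus) (a : ℝ) :
    ‖fourier k (x + (a : Torus)) - fourier k x‖ ≤ 2 * Real.pi * |(k : ℝ)| * |a| := by
  have h1 : fourier k (x + (a : Torus)) = fourier k x * fourier k (a : Torus) := by
    rw [fourier_apply, fourier_apply, fourier_apply, smul_add, AddCircle.toCircle_add,
      Circle.coe_mul]
  rw [h1, ← mul_sub_one, norm_mul, norm_fourier_apply, one_mul, fourier_coe_apply]
  have h2 : 2 * (Real.pi : ℂ) * Complex.I * (k : ℂ) * (a : ℂ) / ((1 : ℝ) : ℂ)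
      = Complex.I * ((2 * Real.pi * k * a : ℝ) : ℂ) := by
    push_cast; ring
  rw [h2]
  refine Real.norm_exp_I_mul_ofReal_sub_one_le.trans (le_of_eq ?_)
  rw [Real.norm_eq_abs, abs_mul, abs_mul, abs_of_pos Real.two_pi_pos]

theorem abs_add_sub_le_tsum {g : C(Torus, ℝ)}
    (hg : Summable fun k : ℤ => (1 + |(k : ℝ)|) * ‖realCoeff g k‖) (x : Torus) (a : ℝ) :
    |g (x + (a : Torus)) - g x|
      ≤ 2 * Real.pi * (∑' k : ℤ, (1 + |(k : ℝ)|) * ‖realCoeff g k‖) * |a| := by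
  have hs : Summable fun k => ‖realCoeff g k‖ := hg.of_nonneg_of_le (fun _ => norm_nonneg _)
    fun k => le_mul_of_one_le_left (norm_nonneg _) (by linarith [abs_nonneg (k : ℝ)])
  rw [← Real.norm_eq_abs, ← Complex.norm_real, Complex.ofReal_sub,
    ← ((hasSum_realCoeff hs (x + (a : Torus))).sub (hasSum_realCoeff hs x)).tsum_eq]
  have := (hg.hasSum.mul_left (2 * Real.pi)).mul_right |a|
  refine tsum_of_norm_bounded this fun k => ?_
  rw [← smul_sub, norm_smul]
  refine (mul_le_mul_of_nonneg_left (norm_fourier_add_sub_le k x a) (norm_nonneg _)).trans ?_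
  have h3 : 0 ≤ 2 * Real.pi * ‖realCoeff g k‖ * |a| := by positivity
  nlinarith

theorem exists_of_summable_coeff {c : ℤ → ℂ} (hc : Summable fun k => ‖c k‖)
    (hconj : ∀ k, c (-k) = star (c k)) : ∃ g : C(Torus, ℝ), ∀ k, realCoeff g k = c k := by
  have hn : ∀ k, ‖c k • (fourier k : C(Torus, ℂ))‖ = ‖c k‖ := fun k => by
    rw [norm_smul, fourier_norm, mul_one]
  have hsum : Summable fun k => c k • (fourier k : C(Torus, ℂ)) :=
    Summable.of_norm (by simpa only [hn] using hc)
  set F : C(Torus, ℂ) := ∑' k, c k • (fourier k : C(Torus, ℂ)) with hF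
  have hFs : HasSum (fun k => c k • (fourier k : C(Torus, ℂ))) F := hsum.hasSum
  have hpt : ∀ x, HasSum (fun k => c k • fourier k x) (F x) := fun x => by
    have := (ContinuousMap.evalCLM ℂ x).hasSum hFs
    simpa using this
  have hreal : ∀ x, ((F x).re : ℂ) = F x := fun x => by
    rw [← Complex.conj_eq_iff_re]
    have h1 := (hpt x).star
    have h2 := (Equiv.neg ℤ).hasSum_iff.2 (hpt x)
    have h3 : (fun k => star (c k • fourier k x)) =
        (fun k => c k • fourier k x) ∘ (Equiv.neg ℤ) := by
      funext k
      rw [Function.comp_apply, Equiv.neg_apply, hconj, fourier_neg, smul_eq_mul, smul_eq_mul,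
        star_mul', starRingEnd_apply]
    rw [h3] at h1
    exact h1.unique h2
  refine ⟨⟨fun x => (F x).re, Complex.continuous_re.comp F.continuous⟩, fun k => ?_⟩
  have h1 : realCoeff (⟨fun x => (F x).re, Complex.continuous_re.comp F.continuous⟩ : C(Torus, ℝ)) k
      = fourierCoeff F k := by
    simp only [realCoeff, ContinuousMap.coe_mk, hreal]
  rw [h1]
  have h2 : HasSum (fun j => c j • fourierCoeff (fourier j : C(Torus, ℂ)) k) (fourierCoeff F k) := by
    have h3 := (innerSL ℂ (fourierBasis (T := 1) k)).hasSum
      ((ContinuousMap.toLp (E := ℂ) 2 AddCircle.haarAddCircle ℂ).hasSum hFs)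
    have h4 : ∀ q : C(Torus, ℂ), innerSL ℂ (fourierBasis (T := 1) k)
        (ContinuousMap.toLp (E := ℂ) 2 AddCircle.haarAddCircle ℂ q) = fourierCoeff q k := fun q => by
      rw [innerSL_apply_apply, ← fourierBasis.repr_apply_apply, fourierBasis_repr, fourierCoeff_toLp]
    simp only [h4] at h3
    refine h3.congr_fun fun j => ?_
    exact (fourierCoeff.const_smul _ _ _).symm
  refine h2.unique ?_
  convert hasSum_ite_eq k (c k) using 2 with j
  rw [fourierCoeff_fourier, Pi.single_apply]
  by_cases hjk : j = k
  · simp [hjk]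
  · simp [hjk, Ne.symm hjk]

/-! ### Sobolev norms -/

theorem sobolevNormSq_eq (σ : ℝ) (g : C(Torus, ℝ)) : sobolevNormSq σ g =
    ∑' k : ℤ, ENNReal.ofReal ((1 + (k : ℝ) ^ 2) ^ σ * ‖realCoeff g k‖ ^ 2) := by
  refine tsum_congr fun k => ?_
  rw [ENNReal.ofReal_mul (by positivity), ENNReal.ofReal_pow (norm_nonneg _), ofReal_norm]
  rfl

theorem summable_of_sobolevNormSq_le {σ B : ℝ} {g : C(Torus, ℝ)}
    (h : sobolevNormSq σ g ≤ ENNReal.ofReal B) (hB : 0 ≤ B) :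
    Summable (fun k : ℤ => (1 + (k : ℝ) ^ 2) ^ σ * ‖realCoeff g k‖ ^ 2) ∧
      ∑' k : ℤ, (1 + (k : ℝ) ^ 2) ^ σ * ‖realCoeff g k‖ ^ 2 ≤ B := by
  rw [sobolevNormSq_eq] at h
  have h0 : ∀ k : ℤ, 0 ≤ (1 + (k : ℝ) ^ 2) ^ σ * ‖realCoeff g k‖ ^ 2 := fun k => by positivity
  have hs := ENNReal.summable_toReal (ne_top_of_le_ne_top ENNReal.ofReal_ne_top h)
  simp only [ENNReal.toReal_ofReal (h0 _)] at hs
  refine ⟨hs, ?_⟩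
  rwa [← ENNReal.ofReal_tsum_of_nonneg h0 hs, ENNReal.ofReal_le_ofReal_iff hB] at h

theorem sobolevNormSq_le_of_sum_le {σ : ℝ} {B : ℝ} {g : C(Torus, ℝ)}
    (h : ∀ F : Finset ℤ, ∑ k ∈ F, (1 + (k : ℝ) ^ 2) ^ σ * ‖realCoeff g k‖ ^ 2 ≤ B) :
    sobolevNormSq σ g ≤ ENNReal.ofReal B := by
  rw [sobolevNormSq_eq, ENNReal.tsum_eq_iSup_sum]
  refine iSup_le fun F => ?_
  rw [← ENNReal.ofReal_sum_of_nonneg fun k _ => by positivity]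
  exact ENNReal.ofReal_le_ofReal (h F)

theorem sobolevNormSq_mono {σ σ' : ℝ} (h : σ ≤ σ') (g : C(Torus, ℝ)) :
    sobolevNormSq σ g ≤ sobolevNormSq σ' g := by
  refine ENNReal.tsum_le_tsum fun k => ?_
  gcongr
  nlinarith [sq_nonneg (k : ℝ)]

theorem one_add_abs_sq_le (k : ℤ) : (1 + |(k : ℝ)|) ^ 2 ≤ 2 * (1 + (k : ℝ) ^ 2) := by
  nlinarith [sq_nonneg (1 - |(k : ℝ)|), sq_abs (k : ℝ)]

theorem summable_one_add_sq_rpow {a : ℝ} (ha : 1 / 2 < a) :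
    Summable fun k : ℤ => (1 + (k : ℝ) ^ 2) ^ (-a) := by
  have h1 : Summable fun k : ℤ => |(k : ℝ)| ^ (-(2 * a)) :=
    Real.summable_abs_int_rpow (by linarith)
  have h2 : Summable fun k : ℤ => if k = 0 then (1 : ℝ) else 0 :=
    (hasSum_ite_eq (0 : ℤ) (1 : ℝ)).summable
  refine (h2.add h1).of_nonneg_of_le (fun k => by positivity) fun k => ?_
  rcases eq_or_ne k 0 with rfl | hk
  · simp only [Int.cast_zero, if_true]
    have : (0 : ℝ) ≤ |(0 : ℝ)| ^ (-(2 * a)) := by positivity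
    norm_num at this ⊢
    exact this
  · have hk' : 0 < |(k : ℝ)| := abs_pos.2 (Int.cast_ne_zero.2 hk)
    rw [if_neg hk, zero_add, neg_mul_eq_mul_neg, Real.rpow_mul hk'.le, Real.rpow_two, sq_abs]
    refine Real.rpow_le_rpow_of_nonpos (by rw [← sq_abs]; positivity) (by linarith) (by linarith)

theorem exists_sobolev_embedding {σ : ℝ} (hσ : 3 / 2 < σ) : ∃ C : ℝ, 0 ≤ C ∧
    ∀ (g : C(Torus, ℝ)) (B : ℝ), 0 < B → sobolevNormSq σ g ≤ ENNReal.ofReal (B ^ 2) →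
      (Summable fun k : ℤ => (1 + |(k : ℝ)|) * ‖realCoeff g k‖) ∧
      ∑' k : ℤ, (1 + |(k : ℝ)|) * ‖realCoeff g k‖ ≤ C * B ∧
      ‖g‖ ≤ C * B ∧ ∀ x (a : ℝ), |g (x + (a : Torus)) - g x| ≤ C * B * |a| := by
  have hw := summable_one_add_sq_rpow (a := σ - 1) (by linarith)
  set W := ∑' k : ℤ, (1 + (k : ℝ) ^ 2) ^ (-(σ - 1))
  have hW : 0 ≤ W := tsum_nonneg fun k => by positivity
  refine ⟨2 * Real.pi * (2 * W + 1), by positivity, fun g B hB hg => ?_⟩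
  obtain ⟨h1, h2⟩ := summable_of_sobolevNormSq_le hg (sq_nonneg B)
  have h3 : ∀ k : ℤ, (1 + |(k : ℝ)|) * ‖realCoeff g k‖ ≤
      2 * B * (1 + (k : ℝ) ^ 2) ^ (-(σ - 1)) +
        B⁻¹ * ((1 + (k : ℝ) ^ 2) ^ σ * ‖realCoeff g k‖ ^ 2) := fun k => by
    have h0 : (0 : ℝ) < 1 + (k : ℝ) ^ 2 := by positivity
    set p := (1 + (k : ℝ) ^ 2) ^ σ
    have hp : 0 < p := Real.rpow_pos_of_pos h0 _
    have hq : (1 + (k : ℝ) ^ 2) ^ (-(σ - 1)) = (1 + (k : ℝ) ^ 2) / p := by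
      rw [neg_sub, Real.rpow_sub h0, Real.rpow_one]
    have h4 := one_add_abs_sq_le k
    set y := 1 + |(k : ℝ)|
    set r := ‖realCoeff g k‖
    have h5 : B * y ^ 2 / p ≤ 2 * B * ((1 + (k : ℝ) ^ 2) / p) := by
      rw [← mul_div_assoc]
      refine div_le_div_of_nonneg_right ?_ hp.le
      linarith [mul_le_mul_of_nonneg_left h4 hB.le]
    have h6 : 0 ≤ B * y ^ 2 / p + B⁻¹ * (p * r ^ 2) - 2 * (y * r) := by
      have : B * y ^ 2 / p + B⁻¹ * (p * r ^ 2) - 2 * (y * r)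
          = (B * y - p * r) ^ 2 / (B * p) := by
        field_simp
        ring
      rw [this]
      positivity
    have h7 : 0 ≤ y * r := by positivity
    rw [hq]
    linarith
  have h4 := (hw.mul_left (2 * B)).add (h1.mul_left B⁻¹)
  have h5 : Summable fun k : ℤ => (1 + |(k : ℝ)|) * ‖realCoeff g k‖ :=
    h4.of_nonneg_of_le (fun k => by positivity) h3
  have h6 : ∑' k : ℤ, (1 + |(k : ℝ)|) * ‖realCoeff g k‖ ≤ (2 * W + 1) * B := by
    refine (h5.tsum_le_tsum h3 h4).trans ?_
    rw [(hw.mul_left (2 * B)).tsum_add (h1.mul_left B⁻¹), tsum_mul_left, tsum_mul_left]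
    have : B⁻¹ * ∑' k : ℤ, (1 + (k : ℝ) ^ 2) ^ σ * ‖realCoeff g k‖ ^ 2 ≤ B := by
      rw [inv_mul_le_iff₀ hB, ← sq]
      exact h2
    linarith
  have hpi : (1 : ℝ) ≤ 2 * Real.pi := by linarith [Real.pi_gt_three]
  have h7 : (2 * W + 1) * B ≤ 2 * Real.pi * (2 * W + 1) * B := by
    rw [mul_assoc]
    exact le_mul_of_one_le_left (by positivity) hpi
  refine ⟨h5, h6.trans h7, ?_, fun x a => (abs_add_sub_le_tsum h5 x a).trans ?_⟩
  · refine (norm_le_tsum_of_coeff_le h5 fun k => ?_).trans (h6.trans h7)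
    exact le_mul_of_one_le_left (norm_nonneg _) (by linarith [abs_nonneg (k : ℝ)])
  · rw [mul_assoc (2 * Real.pi) (2 * W + 1) B]
    gcongr

/-! ### The embedding of `W^{2,∞}(𝕋)` into `H²(𝕋)` -/

theorem hasDerivAt_fourier_add (k : ℤ) (x : Torus) :
    HasDerivAt (fun r : ℝ => fourier k (x + (r : Torus)))
      (2 * Real.pi * Complex.I * k * fourier k x) 0 := by
  have h1 : (fun r : ℝ => fourier k (x + (r : Torus)))
      = fun r : ℝ => fourier k x * fourier k (r : Torus) := by
    funext r
    rw [fourier_apply, fourier_apply, fourier_apply, smul_add, AddCircle.toCircle_add,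
      Circle.coe_mul]
  rw [h1]
  have h2 := (hasDerivAt_fourier (1 : ℝ) k 0).const_mul (fourier k x)
  have h3 : fourier k x * (2 * Real.pi * Complex.I * k / ((1 : ℝ) : ℂ) * fourier k ((0 : ℝ) : Torus))
      = 2 * Real.pi * Complex.I * k * fourier k x := by
    rw [show ((0 : ℝ) : Torus) = 0 from rfl, fourier_eval_zero]
    push_cast
    ring
  rwa [h3] at h2

theorem contDiff_fourier_coe (k : ℤ) : ContDiff ℝ ∞ fun x : ℝ => fourier k (x : Torus) := by
  simp only [fourier_coe_apply]
  exact (((contDiff_const.mul Complex.ofRealCLM.contDiff).div_const _).cexp)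

theorem realCoeff_of_isWeakDeriv {g h : Torus → ℝ} (hg : Integrable g) (hh : Integrable h)
    (hgh : IsWeakDeriv g h) (k : ℤ) :
    realCoeff h k = 2 * Real.pi * Complex.I * k * realCoeff g k := by
  set e : Torus → ℂ := fun x => fourier (-k) x
  set e' : Torus → ℂ := fun x => 2 * Real.pi * Complex.I * ((-k : ℤ) : ℂ) * fourier (-k) x
  have hd : ∀ x, HasDerivAt (fun r : ℝ => e (x + (r : Torus))) (e' x) 0 :=
    fun x => hasDerivAt_fourier_add (-k) x
  have hre := hgh (fun x => (e x).re) (Complex.reCLM.contDiff.comp (contDiff_fourier_coe (-k)))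
  have him := hgh (fun x => (e x).im) (Complex.imCLM.contDiff.comp (contDiff_fourier_coe (-k)))
  have hdre : ∀ x, deriv (fun r : ℝ => (e (x + (r : Torus))).re) 0 = (e' x).re := fun x =>
    (Complex.reCLM.hasFDerivAt.comp_hasDerivAt 0 (hd x)).deriv
  have hdim : ∀ x, deriv (fun r : ℝ => (e (x + (r : Torus))).im) 0 = (e' x).im := fun x =>
    (Complex.imCLM.hasFDerivAt.comp_hasDerivAt 0 (hd x)).deriv
  simp only [hdre, hdim] at hre him
  have hce : Continuous e := (fourier (-k)).continuous
  have hce' : Continuous e' := continuous_const.mul (fourier (-k)).continuous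
  have key : ∀ (q : Torus → ℝ) (_ : Integrable q) (b : Torus → ℂ) (_ : Continuous b),
      ∫ x, ((q x : ℝ) : ℂ) * b x
        = ((∫ x, q x * (b x).re : ℝ) : ℂ) + ((∫ x, q x * (b x).im : ℝ) : ℂ) * Complex.I := by
    intro q hq b hb
    obtain ⟨C, hC⟩ := isCompact_univ.exists_bound_of_continuousOn hb.continuousOn
    have hi : Integrable (fun x => ((q x : ℝ) : ℂ) * b x) :=
      hq.ofReal.mul_bdd (c := C) hb.aestronglyMeasurable (Eventually.of_forall fun x => hC x (mem_univ x))
    rw [← integral_re_add_im hi]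
    have h1 : ∀ x, RCLike.re (((q x : ℝ) : ℂ) * b x) = q x * (b x).re := fun x => by simp
    have h2 : ∀ x, RCLike.im (((q x : ℝ) : ℂ) * b x) = q x * (b x).im := fun x => by simp
    simp only [h1, h2]
    rfl
  have h1 : ∫ x, ((g x : ℝ) : ℂ) * e' x = - ∫ x, ((h x : ℝ) : ℂ) * e x := by
    rw [key g hg e' hce', key h hh e hce, hre, him]
    push_cast
    ring
  have h2 : ∫ x, ((g x : ℝ) : ℂ) * e' x
      = 2 * Real.pi * Complex.I * ((-k : ℤ) : ℂ) * ∫ x, ((g x : ℝ) : ℂ) * e x := by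
    rw [← integral_const_mul]
    refine integral_congr_ae (Eventually.of_forall fun x => ?_)
    simp only [e, e']
    ring
  have h3 : ∀ q : Torus → ℝ, realCoeff q k = ∫ x, ((q x : ℝ) : ℂ) * e x := fun q => by
    rw [realCoeff, fourierCoeff, volume_torus]
    refine integral_congr_ae (Eventually.of_forall fun x => ?_)
    simp only [e, smul_eq_mul]
    ring
  rw [h3, h3, ← neg_eq_iff_eq_neg.2 h1, h2]
  push_cast
  ring

theorem hasSum_sq_realCoeff {g : Torus → ℝ} (hg : MemLp g 2 volume) :
    HasSum (fun k => ‖realCoeff g k‖ ^ 2) (∫ x, g x ^ 2) := by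
  have h1 : MemLp (fun x => ((g x : ℝ) : ℂ)) 2 (AddCircle.haarAddCircle : Measure Torus) := by
    rw [← volume_torus]
    exact hg.ofReal
  have h2 := hasSum_sq_fourierCoeff h1.toLp
  have h3 : fourierCoeff (h1.toLp : Torus → ℂ) = realCoeff g := by
    rw [fourierCoeff_congr_ae h1.coeFn_toLp]
    rfl
  rw [h3] at h2
  convert h2 using 1
  rw [volume_torus]
  refine integral_congr_ae ?_
  filter_upwards [h1.coeFn_toLp] with x hx
  rw [hx, Complex.norm_real, Real.norm_eq_abs, sq_abs]

theorem integral_sq_le_of_eLpNorm_top {g : Torus → ℝ} {M : ℝ}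
    (h : eLpNorm g ∞ volume ≤ ENNReal.ofReal M) (hM : 0 ≤ M) : ∫ x, g x ^ 2 ≤ M ^ 2 := by
  have h1 : ∀ᵐ x, ‖g x ^ 2‖ ≤ M ^ 2 := by
    have h2 := ae_le_eLpNormEssSup (f := g) (μ := volume)
    rw [eLpNorm_exponent_top] at h
    filter_upwards [h2] with x hx
    have h3 : ‖g x‖ ≤ M := by
      have := hx.trans h
      rwa [← ofReal_norm, ENNReal.ofReal_le_ofReal_iff hM] at this
    rw [norm_pow]
    gcongr
  have h2 := norm_integral_le_of_norm_le_const h1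
  rw [volume_torus, probReal_univ, mul_one, ← volume_torus] at h2
  exact (le_abs_self _).trans h2

theorem sobolevNormSq_two_le {g : C(Torus, ℝ)} {M : ℝ} (hM : 0 ≤ M) (hg : W2InftyNormLE g M) :
    sobolevNormSq 2 g ≤ ENNReal.ofReal ((2 * M) ^ 2) := by
  obtain ⟨g', g'', h0, h1, h2, hd, hd', hle⟩ := hg
  have hi : ∀ {q : Torus → ℝ}, MemLp q ∞ volume → Integrable q := fun hq => hq.integrable (by simp)
  have hc : ∀ k, ‖realCoeff g'' k‖ = (2 * Real.pi * |(k : ℝ)|) ^ 2 * ‖realCoeff g k‖ := fun k => by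
    rw [realCoeff_of_isWeakDeriv (hi h1) (hi h2) hd', realCoeff_of_isWeakDeriv (hi h0) (hi h1) hd]
    simp only [norm_mul, Complex.norm_I, Complex.norm_real, Complex.norm_intCast,
      Complex.norm_ofNat, Real.norm_eq_abs, abs_of_pos Real.pi_pos]
    ring
  have hs0 := hasSum_sq_realCoeff (h0.mono_exponent le_top)
  have hs2 := hasSum_sq_realCoeff (h2.mono_exponent le_top)
  have hb0 : ∫ x, g x ^ 2 ≤ M ^ 2 := integral_sq_le_of_eLpNorm_top
    ((le_self_add.trans le_self_add).trans hle) hM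
  have hb2 : ∫ x, g'' x ^ 2 ≤ M ^ 2 := integral_sq_le_of_eLpNorm_top (le_add_self.trans hle) hM
  refine sobolevNormSq_le_of_sum_le fun F => ?_
  have h3 : ∀ k : ℤ, (1 + (k : ℝ) ^ 2) ^ (2 : ℝ) * ‖realCoeff g k‖ ^ 2
      ≤ ‖realCoeff g k‖ ^ 2 + ‖realCoeff g'' k‖ ^ 2 := fun k => by
    rw [hc, Real.rpow_two, mul_pow]
    rcases eq_or_ne k 0 with rfl | hk
    · simp
    · have h4 : (1 : ℝ) ≤ (k : ℝ) ^ 2 := by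
        have : (1 : ℤ) ≤ k ^ 2 := by have := sq_pos_of_ne_zero hk; omega
        exact_mod_cast this
      have h5 : 1 + (k : ℝ) ^ 2 ≤ (2 * Real.pi * |(k : ℝ)|) ^ 2 := by
        rw [mul_pow, sq_abs]
        have h7 : (2 : ℝ) ≤ (2 * Real.pi) ^ 2 := by nlinarith [Real.pi_gt_three]
        nlinarith
      have h6 : (1 + (k : ℝ) ^ 2) ^ 2 ≤ ((2 * Real.pi * |(k : ℝ)|) ^ 2) ^ 2 := by gcongr
      nlinarith [sq_nonneg ‖realCoeff g k‖]
  refine (Finset.sum_le_sum fun k _ => h3 k).trans ?_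
  rw [Finset.sum_add_distrib]
  have h4 := sum_le_hasSum F (fun k _ => sq_nonneg _) hs0
  have h5 := sum_le_hasSum F (fun k _ => sq_nonneg _) hs2
  nlinarith [sq_nonneg M]

theorem exists_bound_of_W2Infty {E : Type*} [NormedAddCommGroup E] [NormedSpace ℝ E]
    (ι : E →ₗ[ℝ] C(Torus, ℝ)) (hι : ∃ C : ℝ, ∀ n : E, W2InftyNormLE (ι n) (C * ‖n‖)) :
    ∃ K : ℝ, 0 ≤ K ∧ ∀ n, ‖ι n‖ ≤ K * ‖n‖ ∧
      ∀ x (a : ℝ), |ι n (x + (a : Torus)) - ι n x| ≤ K * ‖n‖ * |a| := by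
  obtain ⟨C, hC⟩ := hι
  obtain ⟨C', hC', hemb⟩ := exists_sobolev_embedding (σ := 2) (by norm_num)
  refine ⟨C' * (2 * (|C| + 1)), by positivity, fun n => ?_⟩
  rcases eq_or_ne n 0 with rfl | hn
  · simp
  have hn' : 0 < ‖n‖ := norm_pos_iff.2 hn
  have h1 : W2InftyNormLE (ι n) ((|C| + 1) * ‖n‖) := by
    obtain ⟨g', g'', h0, h1, h2, hd, hd', hle⟩ := hC n
    refine ⟨g', g'', h0, h1, h2, hd, hd', hle.trans (ENNReal.ofReal_le_ofReal ?_)⟩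
    gcongr
    linarith [le_abs_self C]
  have h2 := hemb (ι n) (2 * ((|C| + 1) * ‖n‖)) (by positivity)
    (sobolevNormSq_two_le (by positivity) h1)
  refine ⟨h2.2.2.1.trans (le_of_eq (by ring)), fun x a => (h2.2.2.2 x a).trans (le_of_eq (by ring))⟩

/-! ### Càdlàg paths -/

theorem IsCadlagOn.exists_bound {E : Type*} [NormedAddCommGroup E] {T : ℝ} {m : ℝ → E}
    (hm : IsCadlagOn T m) : ∃ C, ∀ t ∈ Icc 0 T, ‖m t‖ ≤ C := by
  have hbd : ∀ {l : Filter ℝ} {y : E}, Tendsto m l (𝓝 y) → ∃ C, ∀ᶠ s in l, ‖m s‖ ≤ C := by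
    intro l y h
    exact ⟨‖y‖ + 1, (h.norm.eventually (gt_mem_nhds (lt_add_one _))).mono fun s hs => le_of_lt hs⟩
  have hloc : ∀ t ∈ Icc 0 T, ∃ u ∈ 𝓝[Icc 0 T] t, ∃ C, ∀ s ∈ u, ‖m s‖ ≤ C := by
    intro t ht
    obtain ⟨C₁, h₁⟩ : ∃ C, ∀ᶠ s in 𝓝[Iio t] t, s ∈ Icc 0 T → ‖m s‖ ≤ C := by
      rcases ht.1.eq_or_lt with rfl | h0
      · refine ⟨0, eventually_mem_nhdsWithin.mono fun s hs hs' => ?_⟩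
        exact absurd hs'.1 (not_le.2 hs)
      · obtain ⟨l, hl⟩ := hm.2 t ⟨h0, ht.2⟩
        obtain ⟨C, hC⟩ := hbd hl
        exact ⟨C, hC.mono fun s hs _ => hs⟩
    obtain ⟨C₂, h₂⟩ : ∃ C, ∀ᶠ s in 𝓝[Ici t] t, s ∈ Icc 0 T → ‖m s‖ ≤ C := by
      rcases ht.2.eq_or_lt with rfl | hT
      · refine ⟨‖m t‖, eventually_mem_nhdsWithin.mono fun s hs hs' => ?_⟩
        rw [le_antisymm hs'.2 hs]
      · obtain ⟨C, hC⟩ := hbd (hm.1 t ⟨ht.1, hT⟩)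
        exact ⟨C, hC.mono fun s hs _ => hs⟩
    have h3 : ∀ᶠ s in 𝓝 t, s ∈ Icc 0 T → ‖m s‖ ≤ max C₁ C₂ := by
      rw [← nhdsLT_sup_nhdsGE, eventually_sup]
      exact ⟨h₁.mono fun s hs h => (hs h).trans (le_max_left _ _),
        h₂.mono fun s hs h => (hs h).trans (le_max_right _ _)⟩
    exact ⟨{s | ‖m s‖ ≤ max C₁ C₂}, eventually_nhdsWithin_iff.2 h3, max C₁ C₂, fun s hs => hs⟩
  refine isCompact_Icc.induction_on (p := fun A => ∃ C, ∀ t ∈ A, ‖m t‖ ≤ C) ⟨0, by simp⟩ ?_ ?_ ?_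
  · rintro s t hst ⟨C, hC⟩
    exact ⟨C, fun x hx => hC x (hst hx)⟩
  · rintro s t ⟨C, hC⟩ ⟨C', hC'⟩
    exact ⟨max C C', fun x hx => hx.elim (fun h => (hC x h).trans (le_max_left _ _))
      fun h => (hC' x h).trans (le_max_right _ _)⟩
  · exact hloc

theorem IsCadlagOn.aestronglyMeasurable {E : Type*} [NormedAddCommGroup E] {T : ℝ} {m : ℝ → E}
    (hm : IsCadlagOn T m) : AEStronglyMeasurable m (volume.restrict (Icc 0 T)) := by
  set q : ℕ → ℝ → ℝ := fun n t => ((⌊(n + 1 : ℝ) * t⌋ : ℝ) + 1) / (n + 1) with hq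
  have hqm : ∀ n, StronglyMeasurable fun t => m (q n t) := fun n => by
    have h1 : StronglyMeasurable fun j : ℤ => m (((j : ℝ) + 1) / (n + 1)) :=
      StronglyMeasurable.of_discrete
    exact h1.comp_measurable (Int.measurable_floor.comp (measurable_const_mul (n + 1 : ℝ)))
  refine aestronglyMeasurable_of_tendsto_ae atTop (fun n => (hqm n).aestronglyMeasurable) ?_
  have h1 : ∀ᵐ t ∂(volume.restrict (Icc 0 T)), t ≠ T :=
    ae_restrict_of_ae (Measure.ae_ne volume T)
  filter_upwards [h1, ae_restrict_mem measurableSet_Icc] with t htT ht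
  have hlt : t < T := lt_of_le_of_ne ht.2 htT
  have h2 : ∀ n : ℕ, t ≤ q n t ∧ q n t ≤ t + 1 / (n + 1) := fun n => by
    have hn : (0 : ℝ) < n + 1 := by positivity
    simp only [hq]
    constructor
    · rw [le_div_iff₀ hn]
      linarith [Int.lt_floor_add_one ((n + 1 : ℝ) * t)]
    · have h4 : (t + 1 / ((n : ℝ) + 1)) * (n + 1) = (n + 1) * t + 1 := by
        field_simp
      rw [div_le_iff₀ hn, h4]
      linarith [Int.floor_le ((n + 1 : ℝ) * t)]
  have h3 : Tendsto (fun n => q n t) atTop (𝓝[Ici t] t) := by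
    refine tendsto_nhdsWithin_iff.2 ⟨?_, Eventually.of_forall fun n => (h2 n).1⟩
    have h4 : Tendsto (fun n : ℕ => t + 1 / ((n : ℝ) + 1)) atTop (𝓝 (t + 0)) :=
      tendsto_const_nhds.add tendsto_one_div_add_atTop_nhds_zero_nat
    rw [add_zero] at h4
    exact tendsto_of_tendsto_of_tendsto_of_le_of_le tendsto_const_nhds h4
      (fun n => (h2 n).1) fun n => (h2 n).2
  exact (hm.1 t ⟨ht.1, hlt⟩).tendsto.comp h3

/-! ### The heat semigroup and Duhamel's formula on the Fourier side -/

noncomputable def heatRate (k : ℤ) : ℝ := 4 * Real.pi ^ 2 * (k : ℝ) ^ 2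

theorem heatRate_nonneg (k : ℤ) : 0 ≤ heatRate k := by unfold heatRate; positivity

theorem heatRate_neg (k : ℤ) : heatRate (-k) = heatRate k := by
  unfold heatRate; push_cast; ring

theorem exp_heatRate_le_one (k : ℤ) {t : ℝ} (ht : 0 ≤ t) : Real.exp (-(heatRate k * t)) ≤ 1 :=
  Real.exp_le_one_iff.2 (neg_nonpos.2 (mul_nonneg (heatRate_nonneg k) ht))

noncomputable def coeffL (k : ℤ) : L2x →L[ℂ] ℂ := innerSL ℂ (fourierBasis (T := 1) k)

theorem coeffL_apply (k : ℤ) (g : L2x) : coeffL k g = fourierCoeff (g : Torus → ℂ) k := by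
  rw [coeffL, innerSL_apply_apply, ← fourierBasis.repr_apply_apply, fourierBasis_repr]

theorem eq_of_coeffL_eq {g h : L2x} (hgh : ∀ k, coeffL k g = coeffL k h) : g = h := by
  refine (fourierBasis (T := 1)).repr.injective (lp.ext (funext fun k => ?_))
  have := hgh k
  rwa [coeffL_apply, coeffL_apply, ← fourierBasis_repr, ← fourierBasis_repr] at this

theorem coeffL_toL2 (g : C(Torus, ℝ)) (k : ℤ) : coeffL k (toL2 g) = realCoeff g k := by
  rw [coeffL_apply]
  exact fourierCoeff_toLp (complexify g) k

theorem hasSum_sq_coeffL (g : L2x) : HasSum (fun k => ‖coeffL k g‖ ^ 2) (‖g‖ ^ 2) := by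
  have h := lp.hasSum_norm (p := 2) (by simp) ((fourierBasis (T := 1)).repr g)
  simp only [ENNReal.toReal_ofNat, Real.rpow_two, fourierBasis_repr,
    LinearIsometryEquiv.norm_map] at h
  simpa only [coeffL_apply] using h

theorem exists_hasSum_heat {t : ℝ} (ht : 0 ≤ t) (g : L2x) :
    (∀ k, coeffL k (heat t g) = (Real.exp (-(heatRate k * t)) : ℂ) * coeffL k g) ∧
    HasSum (fun k : ℤ => ((Real.exp (-(heatRate k * t)) : ℝ) : ℂ) • (coeffL k g • fourierLp 2 k))
      (heat t g) := by
  set x := (fourierBasis (T := 1)).repr g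
  have hmem : Memℓp (fun k => ((Real.exp (-(heatRate k * t)) : ℝ) : ℂ) * x k) 2 := by
    have h1 := lp.memℓp x
    refine memℓp_gen ?_
    have h2 := h1.summable (by simp)
    refine h2.of_nonneg_of_le (fun k => by positivity) fun k => ?_
    refine Real.rpow_le_rpow (norm_nonneg _) ?_ (by simp)
    rw [norm_mul, Complex.norm_real, Real.norm_eq_abs, Real.abs_exp]
    exact mul_le_of_le_one_left (norm_nonneg _) (exp_heatRate_le_one k ht)
  set y : lp (fun _ : ℤ => ℂ) 2 := ⟨_, hmem⟩
  have hx : ∀ k, x k = coeffL k g := fun k => by rw [coeffL_apply, ← fourierBasis_repr]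
  have hsum : HasSum
      (fun k : ℤ => ((Real.exp (-(heatRate k * t)) : ℝ) : ℂ) • (coeffL k g • fourierLp 2 k))
      ((fourierBasis (T := 1)).repr.symm y) := by
    have h1 := (fourierBasis (T := 1)).hasSum_repr_symm y
    rw [coe_fourierBasis] at h1
    refine h1.congr_fun fun k => ?_
    rw [smul_smul, ← hx]
  have heq : heat t g = (fourierBasis (T := 1)).repr.symm y := by
    rw [← hsum.tsum_eq, heat]
    refine tsum_congr fun k => ?_
    rw [coeffL_apply, heatRate]
  refine ⟨fun k => ?_, heq ▸ hsum⟩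
  rw [heq, coeffL_apply, ← fourierBasis_repr, LinearIsometryEquiv.apply_symm_apply, ← hx]

theorem coeffL_heat {t : ℝ} (ht : 0 ≤ t) (g : L2x) (k : ℤ) :
    coeffL k (heat t g) = (Real.exp (-(heatRate k * t)) : ℂ) * coeffL k g :=
  (exists_hasSum_heat ht g).1 k

theorem norm_heat_le {t : ℝ} (ht : 0 ≤ t) (g : L2x) : ‖heat t g‖ ≤ ‖g‖ := by
  refine abs_le_of_sq_le_sq' ?_ (norm_nonneg g) |>.2
  refine hasSum_le (fun k => ?_) (hasSum_sq_coeffL (heat t g)) (hasSum_sq_coeffL g)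
  rw [coeffL_heat ht, norm_mul, Complex.norm_real, Real.norm_eq_abs, Real.abs_exp]
  gcongr
  exact mul_le_of_le_one_left (norm_nonneg _) (exp_heatRate_le_one k ht)

theorem intervalIntegrable_heat {G : ℝ → L2x} {B t : ℝ} (ht : 0 ≤ t)
    (hB : ∀ s ∈ Icc 0 t, ‖G s‖ ≤ B)
    (hc : ∀ k, ContinuousOn (fun s => coeffL k (G s)) (Icc 0 t)) :
    IntervalIntegrable (fun s => heat (t - s) (G s)) volume 0 t := by
  rw [intervalIntegrable_iff_integrableOn_Icc_of_le ht]
  have hm : AEStronglyMeasurable (fun s => heat (t - s) (G s)) (volume.restrict (Icc 0 t)) := by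
    refine aestronglyMeasurable_of_tendsto_ae (u := (atTop : Filter (Finset ℤ)))
      (f := fun F s => ∑ k ∈ F, ((Real.exp (-(heatRate k * (t - s))) : ℝ) : ℂ) •
        (coeffL k (G s) • fourierLp 2 k)) (fun F => ?_) ?_
    · refine ContinuousOn.aestronglyMeasurable ?_ measurableSet_Icc
      refine continuousOn_finsetSum _ fun k _ => ?_
      have h1 : Continuous fun s : ℝ => ((Real.exp (-(heatRate k * (t - s))) : ℝ) : ℂ) := by
        fun_prop
      exact h1.continuousOn.smul ((hc k).smul continuousOn_const)
    · filter_upwards [ae_restrict_mem measurableSet_Icc] with s hs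
      exact (exists_hasSum_heat (sub_nonneg.2 hs.2) (G s)).2
  refine Integrable.of_bound hm B ?_
  filter_upwards [ae_restrict_mem measurableSet_Icc] with s hs
  exact (norm_heat_le (sub_nonneg.2 hs.2) _).trans (hB s hs)

theorem duhamel_iff {G : ℝ → L2x} {t : ℝ} (ht : 0 ≤ t) {u u₀ : C(Torus, ℝ)}
    (hG : IntervalIntegrable (fun s => heat (t - s) (G s)) volume 0 t) :
    toL2 u = heat t (toL2 u₀) + ∫ s in (0 : ℝ)..t, heat (t - s) (G s) ↔
      ∀ k, realCoeff u k = (Real.exp (-(heatRate k * t)) : ℂ) * realCoeff u₀ k +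
        ∫ s in (0 : ℝ)..t, (Real.exp (-(heatRate k * (t - s))) : ℂ) * coeffL k (G s) := by
  have h1 : ∀ k, coeffL k (heat t (toL2 u₀) + ∫ s in (0 : ℝ)..t, heat (t - s) (G s)) =
      (Real.exp (-(heatRate k * t)) : ℂ) * realCoeff u₀ k +
        ∫ s in (0 : ℝ)..t, (Real.exp (-(heatRate k * (t - s))) : ℂ) * coeffL k (G s) := fun k => by
    rw [map_add, coeffL_heat ht, coeffL_toL2, ← (coeffL k).intervalIntegral_comp_comm hG]
    congr 1
    refine intervalIntegral.integral_congr fun s hs => ?_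
    rw [uIcc_of_le ht] at hs
    exact coeffL_heat (sub_nonneg.2 hs.2) (G s) k
  constructor
  · intro h k
    rw [← coeffL_toL2, h, h1]
  · intro h
    refine eq_of_coeffL_eq fun k => ?_
    rw [coeffL_toL2, h1, h]

/-! ### The source term of the heat equation -/

theorem gNorm_one (f : L1xv) : gNorm 1 f = ∫⁻ z, ENNReal.ofReal (1 + |z.2|) * ‖f z‖ₑ := by
  simp only [gNorm, Real.rpow_one]

theorem integrable_weight_of_lintegral_lt_top {F : Torus × ℝ → ℝ} (hF : AEStronglyMeasurable F)
    (h : ∫⁻ z, ENNReal.ofReal (1 + |z.2|) * ‖F z‖ₑ < ⊤) :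
    Integrable (fun z => (1 + |z.2|) * F z) := by
  refine ⟨(by fun_prop : Continuous fun z : Torus × ℝ => 1 + |z.2|).aestronglyMeasurable.mul hF, ?_⟩
  refine lt_of_le_of_lt (lintegral_mono fun z => ?_) h
  rw [enorm_mul, Real.enorm_of_nonneg (by positivity)]

theorem MemG.integrable_weight {f : L1xv} (hf : MemG 1 f) :
    Integrable (fun z => (1 + |z.2|) * f z) :=
  integrable_weight_of_lintegral_lt_top (stronglyMeasurable_coe f).aestronglyMeasurable
    ((gNorm_one f).symm.trans_lt hf)

theorem integrable_mul_of_abs_le {F : Torus × ℝ → ℝ} (hFm : AEStronglyMeasurable F)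
    (hF : Integrable (fun z => (1 + |z.2|) * F z))
    {a : Torus × ℝ → ℝ} (ha : Continuous a) {C : ℝ} (hC : ∀ z, |a z| ≤ C * (1 + |z.2|)) :
    Integrable (fun z => a z * F z) := by
  refine (hF.norm.const_mul C).mono' (ha.aestronglyMeasurable.mul hFm)
    (Eventually.of_forall fun z => ?_)
  rw [norm_mul, norm_mul, ← mul_assoc, Real.norm_eq_abs,
    Real.norm_of_nonneg (show 0 ≤ 1 + |z.2| by positivity)]
  exact mul_le_mul_of_nonneg_right (hC z) (norm_nonneg _)

theorem abs_sub_apply_le (u : C(Torus, ℝ)) (z : Torus × ℝ) :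
    |z.2 - u z.1| ≤ (1 + ‖u‖) * (1 + |z.2|) := by
  have h1 := u.norm_coe_le_norm z.1
  rw [Real.norm_eq_abs] at h1
  have h2 := abs_sub z.2 (u z.1)
  nlinarith [abs_nonneg z.2, norm_nonneg u, mul_nonneg (norm_nonneg u) (abs_nonneg z.2)]

theorem continuous_snd_sub (u : C(Torus, ℝ)) : Continuous fun z : Torus × ℝ => z.2 - u z.1 :=
  continuous_snd.sub (u.continuous.comp continuous_fst)

theorem integrable_snd_sub_mul {F : Torus × ℝ → ℝ} (hFm : AEStronglyMeasurable F)
    (hF : Integrable (fun z => (1 + |z.2|) * F z)) (u : C(Torus, ℝ)) :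
    Integrable (fun z => (z.2 - u z.1) * F z) :=
  integrable_mul_of_abs_le hFm hF (continuous_snd_sub u) (abs_sub_apply_le u)

noncomputable def source (f : L1xv) (u : C(Torus, ℝ)) (x : Torus) : ℝ :=
  momentum f x - density f x * u x

/-- The `k`-th Fourier coefficient of `∫ (v - u(x)) F(x,v) dv`. -/
noncomputable def sourceCoeff (F : Torus × ℝ → ℝ) (u : C(Torus, ℝ)) (k : ℤ) : ℂ :=
  ∫ z : Torus × ℝ, fourier (-k) z.1 * (((z.2 - u z.1) * F z : ℝ) : ℂ)

theorem integrable_fourier_mul {q : Torus × ℝ → ℝ} (hq : Integrable q) (k : ℤ) :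
    Integrable (fun z : Torus × ℝ => fourier k z.1 * ((q z : ℝ) : ℂ)) := by
  refine hq.ofReal.bdd_mul (c := 1)
    ((fourier k).continuous.comp continuous_fst).aestronglyMeasurable
    (Eventually.of_forall fun z => (norm_fourier_apply k z.1).le)

theorem source_ae_eq {f : L1xv} (hf : Integrable (fun z => (1 + |z.2|) * f z)) (u : C(Torus, ℝ)) :
    ∀ᵐ x, source f u x = ∫ v, (v - u x) * f (x, v) := by
  have hm := (stronglyMeasurable_coe f).aestronglyMeasurable (μ := volume)
  have h1 : Integrable (fun z : Torus × ℝ => z.2 * f z) :=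
    integrable_mul_of_abs_le hm hf continuous_snd (C := 1) fun z => by linarith [abs_nonneg z.2]
  have h2 := integrable_coe f
  filter_upwards [Integrable.prod_right_ae (μ := volume) (ν := volume) h1,
    Integrable.prod_right_ae (μ := volume) (ν := volume) h2] with x hx1 hx2
  simp only [source, momentum, density, sub_mul]
  rw [integral_sub hx1 (hx2.const_mul _), integral_const_mul]
  ring

theorem fourierCoeff_source {f : L1xv} (hf : Integrable (fun z => (1 + |z.2|) * f z))
    (u : C(Torus, ℝ)) (k : ℤ) :
    fourierCoeff (fun x => ((source f u x : ℝ) : ℂ)) k = sourceCoeff f u k := by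
  have hm := (stronglyMeasurable_coe f).aestronglyMeasurable (μ := volume)
  have h1 := integrable_fourier_mul (integrable_snd_sub_mul hm hf u) (-k)
  rw [sourceCoeff, fourierCoeff, ← volume_torus]
  refine Eq.trans ?_ (integral_prod (μ := volume) (ν := volume) _ h1).symm
  refine integral_congr_ae ?_
  filter_upwards [source_ae_eq hf u] with x hx
  simp only [smul_eq_mul]
  rw [integral_const_mul, integral_complex_ofReal, hx]

theorem sourceCoeff_neg (F : Torus × ℝ → ℝ) (u : C(Torus, ℝ)) (k : ℤ) :
    sourceCoeff F u (-k) = star (sourceCoeff F u k) := by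
  rw [sourceCoeff, sourceCoeff, Complex.star_def, ← integral_conj]
  refine integral_congr_ae (Eventually.of_forall fun z => ?_)
  simp only [map_mul, Complex.conj_ofReal, fourier_neg, Complex.conj_conj]

theorem integral_abs_le_of_lintegral_le {q : Torus × ℝ → ℝ} {ρ : Torus × ℝ → ℝ} {P : ℝ}
    {F : Torus × ℝ → ℝ} (hρ : ∀ z, 0 ≤ ρ z) (hq : ∀ z, |q z| ≤ ρ z * |F z|)
    (h : ∫⁻ z, ENNReal.ofReal (ρ z) * ‖F z‖ₑ ≤ ENNReal.ofReal P) (hP : 0 ≤ P) :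
    ∫ z, |q z| ≤ P := by
  by_cases hi : Integrable (fun z => |q z|)
  · rw [← ENNReal.ofReal_le_ofReal_iff hP,
      ofReal_integral_eq_lintegral_ofReal hi (Eventually.of_forall fun z => abs_nonneg _)]
    refine le_trans (lintegral_mono fun z => ?_) h
    rw [← ofReal_norm, ← ENNReal.ofReal_mul (hρ z)]
    exact ENNReal.ofReal_le_ofReal (hq z)
  · rw [integral_undef hi]
    exact hP

theorem norm_integral_fourier_mul_le (q : Torus × ℝ → ℝ) (k : ℤ) :
    ‖∫ z : Torus × ℝ, fourier k z.1 * ((q z : ℝ) : ℂ)‖ ≤ ∫ z, |q z| := by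
  refine (norm_integral_le_integral_norm _).trans (le_of_eq ?_)
  refine integral_congr_ae (Eventually.of_forall fun z => ?_)
  simp only [norm_mul, norm_fourier_apply, one_mul, Complex.norm_real, Real.norm_eq_abs]

section Bounds

variable {F F' : Torus × ℝ → ℝ}

theorem norm_sourceCoeff_le (hFm : AEStronglyMeasurable F)
    (hF : Integrable (fun z => (1 + |z.2|) * F z)) {P Q : ℝ} (hP : 0 ≤ P) (hQ : 0 ≤ Q)
    (h1 : ∫⁻ z, ENNReal.ofReal |z.2| * ‖F z‖ₑ ≤ ENNReal.ofReal P)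
    (h2 : ∫⁻ z, ‖F z‖ₑ ≤ ENNReal.ofReal Q) (u : C(Torus, ℝ)) (k : ℤ) :
    ‖sourceCoeff F u k‖ ≤ P + ‖u‖ * Q := by
  have i1 : Integrable (fun z : Torus × ℝ => z.2 * F z) :=
    integrable_mul_of_abs_le hFm hF continuous_snd (C := 1) fun z => by linarith [abs_nonneg z.2]
  have i2 : Integrable (fun z : Torus × ℝ => u z.1 * F z) :=
    integrable_mul_of_abs_le hFm hF (u.continuous.comp continuous_fst) (C := ‖u‖) fun z => by
      have := u.norm_coe_le_norm z.1
      rw [Real.norm_eq_abs] at this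
      nlinarith [norm_nonneg u, abs_nonneg z.2, mul_nonneg (norm_nonneg u) (abs_nonneg z.2)]
  have e : sourceCoeff F u k = (∫ z : Torus × ℝ, fourier (-k) z.1 * ((z.2 * F z : ℝ) : ℂ))
      - ∫ z : Torus × ℝ, fourier (-k) z.1 * ((u z.1 * F z : ℝ) : ℂ) := by
    rw [← integral_sub (integrable_fourier_mul i1 _) (integrable_fourier_mul i2 _), sourceCoeff]
    refine integral_congr_ae (Eventually.of_forall fun z => ?_)
    simp only [sub_mul, Complex.ofReal_sub, mul_sub]
  rw [e]
  refine (norm_sub_le _ _).trans (add_le_add ?_ ?_)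
  · refine (norm_integral_fourier_mul_le _ _).trans ?_
    exact integral_abs_le_of_lintegral_le (fun z => abs_nonneg z.2) (fun z => (abs_mul _ _).le) h1 hP
  · refine (norm_integral_fourier_mul_le _ _).trans ?_
    refine integral_abs_le_of_lintegral_le (ρ := fun _ => ‖u‖) (F := F) (fun z => norm_nonneg _)
      (fun z => ?_) ?_ (by positivity)
    · rw [abs_mul]
      exact mul_le_mul_of_nonneg_right (u.norm_coe_le_norm z.1) (abs_nonneg _)
    · rw [lintegral_const_mul' _ _ ENNReal.ofReal_ne_top, ENNReal.ofReal_mul (norm_nonneg _)]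
      gcongr

theorem norm_sourceCoeff_sub_le (hFm : AEStronglyMeasurable F)
    (hF : Integrable (fun z => (1 + |z.2|) * F z)) (hFm' : AEStronglyMeasurable F')
    (hF' : Integrable (fun z => (1 + |z.2|) * F' z)) {P Q : ℝ} (hP : 0 ≤ P) (hQ : 0 ≤ Q)
    (h1 : ∫⁻ z, ENNReal.ofReal (1 + |z.2|) * ‖F z - F' z‖ₑ ≤ ENNReal.ofReal P)
    (h2 : ∫⁻ z, ENNReal.ofReal (1 + |z.2|) * ‖F' z‖ₑ ≤ ENNReal.ofReal Q)
    (u u' : C(Torus, ℝ)) (k : ℤ) :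
    ‖sourceCoeff F u k - sourceCoeff F' u' k‖ ≤ (1 + ‖u‖) * P + ‖u - u'‖ * Q := by
  have i0 := integrable_snd_sub_mul hFm hF u
  have i0' := integrable_snd_sub_mul hFm' hF' u'
  have i1 : Integrable (fun z : Torus × ℝ => (z.2 - u z.1) * (F z - F' z)) := by
    refine (i0.sub (integrable_snd_sub_mul hFm' hF' u)).congr (Eventually.of_forall fun z => ?_)
    simp only [Pi.sub_apply, mul_sub]
  have i2 : Integrable (fun z : Torus × ℝ => (u' z.1 - u z.1) * F' z) := by
    refine ((integrable_snd_sub_mul hFm' hF' u).sub i0').congr (Eventually.of_forall fun z => ?_)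
    simp only [Pi.sub_apply]
    ring
  have e : sourceCoeff F u k - sourceCoeff F' u' k =
      (∫ z : Torus × ℝ, fourier (-k) z.1 * (((z.2 - u z.1) * (F z - F' z) : ℝ) : ℂ))
      + ∫ z : Torus × ℝ, fourier (-k) z.1 * (((u' z.1 - u z.1) * F' z : ℝ) : ℂ) := by
    rw [← integral_add (integrable_fourier_mul i1 _) (integrable_fourier_mul i2 _), sourceCoeff,
      sourceCoeff, ← integral_sub (integrable_fourier_mul i0 _) (integrable_fourier_mul i0' _)]
    refine integral_congr_ae (Eventually.of_forall fun z => ?_)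
    push_cast
    ring
  rw [e]
  have hmul : ∀ {c : ℝ} {R : ℝ} {H : Torus × ℝ → ℝ}, 0 ≤ c →
      ∫⁻ z, ENNReal.ofReal (1 + |z.2|) * ‖H z‖ₑ ≤ ENNReal.ofReal R →
      ∫⁻ z, ENNReal.ofReal (c * (1 + |z.2|)) * ‖H z‖ₑ ≤ ENNReal.ofReal (c * R) := by
    intro c R H hc hR
    simp only [ENNReal.ofReal_mul hc, mul_assoc]
    rw [lintegral_const_mul' _ _ ENNReal.ofReal_ne_top]
    gcongr
  refine (norm_add_le _ _).trans (add_le_add ?_ ?_)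
  · refine (norm_integral_fourier_mul_le _ _).trans ?_
    refine integral_abs_le_of_lintegral_le (ρ := fun z => (1 + ‖u‖) * (1 + |z.2|))
      (F := fun z => F z - F' z) (fun z => by positivity) (fun z => ?_)
      (hmul (by positivity) h1) (by positivity)
    rw [abs_mul]
    exact mul_le_mul_of_nonneg_right (abs_sub_apply_le u z) (abs_nonneg _)
  · refine (norm_integral_fourier_mul_le _ _).trans ?_
    refine integral_abs_le_of_lintegral_le (ρ := fun z => ‖u - u'‖ * (1 + |z.2|)) (F := F')
      (fun z => by positivity) (fun z => ?_) (hmul (by positivity) h2) (by positivity)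
    rw [abs_mul]
    refine mul_le_mul_of_nonneg_right ?_ (abs_nonneg _)
    have := (u - u').norm_coe_le_norm z.1
    rw [ContinuousMap.sub_apply, Real.norm_eq_abs, abs_sub_comm] at this
    nlinarith [norm_nonneg (u - u'), abs_nonneg z.2, mul_nonneg (norm_nonneg (u - u')) (abs_nonneg z.2)]

end Bounds

/-! ### Weighted `L²` bounds -/

theorem one_add_abs_mul_le (v y : ℝ) :
    (1 + |v|) * |y| ≤ 2 * (1 + v ^ 2)⁻¹ + 2 * ((1 + |v| ^ 4) * |y| ^ 2) := by
  have h0 : (0 : ℝ) < 1 + v ^ 2 := by positivity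
  have hv : |v| ^ 2 = v ^ 2 := sq_abs v
  have h1 : (1 + |v|) ^ 2 ≤ 2 * (1 + v ^ 2) := by nlinarith [sq_nonneg (1 - |v|)]
  have h2 : (1 + v ^ 2) ^ 2 ≤ 2 * (1 + |v| ^ 4) := by
    have : |v| ^ 4 = (v ^ 2) ^ 2 := by rw [← hv]; ring
    rw [this]; nlinarith [sq_nonneg (1 - v ^ 2)]
  set p := (1 + |v|) * (1 + v ^ 2)⁻¹
  set q := (1 + v ^ 2) * |y|
  have hpq : (1 + |v|) * |y| = p * q := by simp only [p, q]; field_simp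
  have hp : p ^ 2 ≤ 2 * (1 + v ^ 2)⁻¹ := by
    simp only [p, mul_pow]
    calc (1 + |v|) ^ 2 * (1 + v ^ 2)⁻¹ ^ 2 ≤ 2 * (1 + v ^ 2) * (1 + v ^ 2)⁻¹ ^ 2 := by gcongr
      _ = _ := by field_simp
  have hq : q ^ 2 ≤ 2 * ((1 + |v| ^ 4) * |y| ^ 2) := by
    simp only [q, mul_pow]
    rw [← mul_assoc]
    gcongr
  rw [hpq]
  nlinarith [sq_nonneg (p - q), sq_nonneg p, sq_nonneg q]

theorem memG_one_of_weighted_sq {f : L1xv}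
    (hf : Integrable (fun z : Torus × ℝ => (1 + |z.2| ^ 4) * |f z| ^ 2)) : MemG 1 f := by
  have h1 : Integrable (fun z : Torus × ℝ => (1 + z.2 ^ 2)⁻¹) := by
    rw [Measure.volume_eq_prod]
    exact integrable_inv_one_add_sq.comp_snd _
  have h2 := (h1.const_mul 2).add (hf.const_mul 2)
  rw [MemG, gNorm_one]
  refine lt_of_le_of_lt (lintegral_mono fun z => ?_) h2.2
  rw [← ofReal_norm, ← ofReal_norm, ← ENNReal.ofReal_mul (by positivity)]
  refine ENNReal.ofReal_le_ofReal ((one_add_abs_mul_le z.2 (f z)).trans (le_abs_self _))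

theorem enorm_integral_sq_le {q : ℝ → ℝ} (u : C(Torus, ℝ)) (x : Torus) (hq : StronglyMeasurable q) :
    ‖((∫ v, (v - u x) * q v : ℝ) : ℂ)‖ₑ ^ 2 ≤ ENNReal.ofReal (4 * Real.pi * (1 + ‖u‖) ^ 2) *
      ∫⁻ v, ENNReal.ofReal (1 + |v| ^ (4 : ℝ)) * ‖q v‖ₑ ^ 2 := by
  set a : ℝ → ℝ≥0∞ := fun v => ENNReal.ofReal ((1 + ‖u‖) * ((1 + |v|) * (1 + v ^ 2)⁻¹))
  set b : ℝ → ℝ≥0∞ := fun v => ENNReal.ofReal (1 + v ^ 2) * ‖q v‖ₑ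
  have ha : Measurable a := by
    refine ENNReal.measurable_ofReal.comp (measurable_const.mul (Measurable.mul (by fun_prop) ?_))
    exact Measurable.inv (by fun_prop)
  have hb : Measurable b := Measurable.mul (by fun_prop) hq.enorm
  have h1 : ‖((∫ v, (v - u x) * q v : ℝ) : ℂ)‖ₑ ≤ ∫⁻ v, (a * b) v := by
    rw [← ofReal_norm, Complex.norm_real, ofReal_norm]
    refine (enorm_integral_le_lintegral_enorm _).trans (lintegral_mono fun v => ?_)
    rw [Pi.mul_apply, enorm_mul, ← mul_assoc, ← ENNReal.ofReal_mul (by positivity)]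
    gcongr
    rw [← ofReal_norm, Real.norm_eq_abs]
    refine ENNReal.ofReal_le_ofReal ((abs_sub_apply_le u (x, v)).trans (le_of_eq ?_))
    have : (0 : ℝ) < 1 + v ^ 2 := by positivity
    field_simp
  have h2 := ENNReal.lintegral_mul_le_Lp_mul_Lq volume Real.HolderConjugate.two_two ha.aemeasurable
    hb.aemeasurable
  have h3 : ‖((∫ v, (v - u x) * q v : ℝ) : ℂ)‖ₑ ^ 2 ≤ (∫⁻ v, a v ^ 2) * ∫⁻ v, b v ^ 2 := by
    refine (pow_le_pow_left₀ zero_le (h1.trans h2) 2).trans (le_of_eq ?_)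
    simp only [ENNReal.rpow_two]
    rw [mul_pow, ← ENNReal.rpow_two, ← ENNReal.rpow_two, ← ENNReal.rpow_mul, ← ENNReal.rpow_mul]
    norm_num
  refine h3.trans ?_
  have h4 : ∫⁻ v, a v ^ 2 ≤ ENNReal.ofReal (2 * Real.pi * (1 + ‖u‖) ^ 2) := by
    have e : 2 * Real.pi * (1 + ‖u‖) ^ 2 = ∫ v : ℝ, 2 * (1 + ‖u‖) ^ 2 * (1 + v ^ 2)⁻¹ := by
      rw [integral_const_mul, integral_univ_inv_one_add_sq]
      ring
    rw [e, ofReal_integral_eq_lintegral_ofReal (integrable_inv_one_add_sq.const_mul _)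
      (Eventually.of_forall fun v => by positivity)]
    refine lintegral_mono fun v => ?_
    rw [← ENNReal.ofReal_pow (by positivity)]
    refine ENNReal.ofReal_le_ofReal ?_
    have h0 : (0 : ℝ) < 1 + v ^ 2 := by positivity
    have hv : |v| ^ 2 = v ^ 2 := sq_abs v
    have h5 : (1 + |v|) ^ 2 ≤ 2 * (1 + v ^ 2) := by nlinarith [sq_nonneg (1 - |v|)]
    calc ((1 + ‖u‖) * ((1 + |v|) * (1 + v ^ 2)⁻¹)) ^ 2
        = (1 + ‖u‖) ^ 2 * ((1 + |v|) ^ 2 * (1 + v ^ 2)⁻¹ ^ 2) := by ring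
      _ ≤ (1 + ‖u‖) ^ 2 * (2 * (1 + v ^ 2) * (1 + v ^ 2)⁻¹ ^ 2) := by gcongr
      _ = _ := by field_simp
  have h5 : ∫⁻ v, b v ^ 2 ≤
      2 * ∫⁻ v, ENNReal.ofReal (1 + |v| ^ (4 : ℝ)) * ‖q v‖ₑ ^ 2 := by
    rw [← lintegral_const_mul' _ _ (by simp)]
    refine lintegral_mono fun v => ?_
    simp only [b]
    rw [mul_pow, ← mul_assoc, ← ENNReal.ofReal_pow (by positivity)]
    gcongr
    rw [← ENNReal.ofReal_ofNat 2, ← ENNReal.ofReal_mul (by norm_num)]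
    refine ENNReal.ofReal_le_ofReal ?_
    have h6 : |v| ^ (4 : ℝ) = (v ^ 2) ^ 2 := by
      rw [← sq_abs v, ← pow_mul]
      exact_mod_cast Real.rpow_natCast |v| 4
    rw [h6]
    nlinarith [sq_nonneg (1 - v ^ 2)]
  refine (mul_le_mul' h4 h5).trans (le_of_eq ?_)
  rw [← mul_assoc, ← ENNReal.ofReal_ofNat 2, ← ENNReal.ofReal_mul (by positivity)]
  congr 2
  ring

theorem exists_source_bound : ∃ C : ℝ, 0 ≤ C ∧ ∀ (f : L1xv) (u : C(Torus, ℝ)) (S : ℝ),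
    MemG 1 f → 0 ≤ S →
    ∫⁻ z, ENNReal.ofReal (1 + |z.2| ^ (4 : ℝ)) * ‖f z‖ₑ ^ 2 ≤ ENNReal.ofReal S →
    ∃ G : L2x, (G : Torus → ℂ) =ᵐ[AddCircle.haarAddCircle] (fun x => ((source f u x : ℝ) : ℂ)) ∧
      ‖G‖ ^ 2 ≤ C * (1 + ‖u‖) ^ 2 * S := by
  refine ⟨4 * Real.pi, by positivity, fun f u S hf hS hle => ?_⟩
  have hfw := hf.integrable_weight
  have hpt : ∀ᵐ x, ‖((source f u x : ℝ) : ℂ)‖ₑ ^ 2 ≤ ENNReal.ofReal (4 * Real.pi * (1 + ‖u‖) ^ 2) *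
      ∫⁻ v, ENNReal.ofReal (1 + |v| ^ (4 : ℝ)) * ‖f (x, v)‖ₑ ^ 2 := by
    filter_upwards [source_ae_eq hfw u] with x hx
    rw [hx]
    exact enorm_integral_sq_le u x ((stronglyMeasurable_coe f).comp_measurable measurable_prodMk_left)
  have hm : AEStronglyMeasurable (fun x => ((source f u x : ℝ) : ℂ))
      (AddCircle.haarAddCircle : Measure Torus) := by
    have h1 : StronglyMeasurable fun x => momentum f x :=
      StronglyMeasurable.integral_prod_right' (f := fun z : Torus × ℝ => z.2 * f z)
        (continuous_snd.stronglyMeasurable.mul (stronglyMeasurable_coe f))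
    have h2 : StronglyMeasurable fun x => density f x :=
      StronglyMeasurable.integral_prod_right' (f := fun z : Torus × ℝ => f z)
        (stronglyMeasurable_coe f)
    exact Complex.continuous_ofReal.comp_aestronglyMeasurable
      (h1.sub (h2.mul u.continuous.stronglyMeasurable)).aestronglyMeasurable
  have hint : ∫⁻ x, ‖((source f u x : ℝ) : ℂ)‖ₑ ^ 2 ∂(AddCircle.haarAddCircle : Measure Torus)
      ≤ ENNReal.ofReal (4 * Real.pi * (1 + ‖u‖) ^ 2 * S) := by
    rw [← volume_torus, ENNReal.ofReal_mul (by positivity)]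
    refine (lintegral_mono_ae hpt).trans ?_
    rw [lintegral_const_mul' _ _ ENNReal.ofReal_ne_top]
    gcongr
    refine le_trans (le_of_eq ?_) hle
    refine (lintegral_prod (μ := (volume : Measure Torus)) (ν := (volume : Measure ℝ))
      (fun z : Torus × ℝ => ENNReal.ofReal (1 + |z.2| ^ (4 : ℝ)) * ‖f z‖ₑ ^ 2) ?_).symm
    exact Measurable.aemeasurable (Measurable.mul (by fun_prop)
      ((stronglyMeasurable_coe f).enorm.pow_const 2))
  have hsq : Integrable (fun x => ‖((source f u x : ℝ) : ℂ)‖ ^ 2)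
      (AddCircle.haarAddCircle : Measure Torus) := by
    refine ⟨hm.norm.pow 2, ?_⟩
    refine lt_of_le_of_lt (lintegral_mono fun x => ?_) (hint.trans_lt ENNReal.ofReal_lt_top)
    rw [enorm_pow, enorm_norm]
  have hmem := (memLp_two_iff_integrable_sq_norm hm).2 hsq
  refine ⟨hmem.toLp, hmem.coeFn_toLp, ?_⟩
  have h1 := hasSum_sq_fourierCoeff hmem.toLp
  have h2 := hasSum_sq_coeffL hmem.toLp
  simp only [coeffL_apply] at h2
  have h3 : ∫ x, ‖(hmem.toLp : Torus → ℂ) x‖ ^ 2 ∂AddCircle.haarAddCircle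
      = ∫ x : Torus, ‖((source f u x : ℝ) : ℂ)‖ ^ 2 ∂AddCircle.haarAddCircle :=
    integral_congr_ae (by filter_upwards [hmem.coeFn_toLp] with x hx; rw [hx])
  rw [h2.unique h1, h3, ← ENNReal.ofReal_le_ofReal_iff (by positivity),
    ofReal_integral_eq_lintegral_ofReal hsq (Eventually.of_forall fun x => by positivity)]
  refine le_trans (lintegral_mono fun x => ?_) hint
  rw [ENNReal.ofReal_pow (norm_nonneg _), ofReal_norm]

/-! ### Estimates for Duhamel's formula -/

noncomputable def duhamel (c : ℝ) (a : ℝ → ℂ) (t : ℝ) : ℂ :=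
  ∫ s in (0 : ℝ)..t, ((Real.exp (-(c * (t - s))) : ℝ) : ℂ) * a s

section Duhamel

variable {T : ℝ} {a a' : ℝ → ℂ}

theorem continuous_heatKernel (c t : ℝ) :
    Continuous fun s : ℝ => ((Real.exp (-(c * (t - s))) : ℝ) : ℂ) := by fun_prop

theorem intervalIntegrable_duhamel (ha : ContinuousOn a (Icc 0 T)) (c : ℝ) {t : ℝ}
    (ht : t ∈ Icc 0 T) :
    IntervalIntegrable (fun s => ((Real.exp (-(c * (t - s))) : ℝ) : ℂ) * a s) volume 0 t :=
  ContinuousOn.intervalIntegrable_of_mem ((continuous_heatKernel c t).continuousOn.mul ha)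
    (zero_mem_of_mem ht) ht

theorem duhamel_sub (ha : ContinuousOn a (Icc 0 T)) (ha' : ContinuousOn a' (Icc 0 T)) (c : ℝ)
    {t : ℝ} (ht : t ∈ Icc 0 T) :
    duhamel c a t - duhamel c a' t = duhamel c (fun s => a s - a' s) t := by
  rw [duhamel, duhamel, ← intervalIntegral.integral_sub (intervalIntegrable_duhamel ha c ht)
    (intervalIntegrable_duhamel ha' c ht), duhamel]
  simp only [mul_sub]

theorem duhamel_congr {c t : ℝ} (ht : 0 ≤ t) (h : ∀ s ∈ Icc 0 t, a s = a' s) :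
    duhamel c a t = duhamel c a' t := by
  refine intervalIntegral.integral_congr fun s hs => ?_
  rw [uIcc_of_le ht] at hs
  simp only [h s hs]

theorem duhamel_star (c t : ℝ) : duhamel c (fun s => star (a s)) t = star (duhamel c a t) := by
  simp only [duhamel, Complex.star_def, intervalIntegral, map_sub, ← integral_conj, map_mul,
    Complex.conj_ofReal]

theorem continuousOn_duhamel (ha : ContinuousOn a (Icc 0 T)) (c : ℝ) :
    ContinuousOn (duhamel c a) (Icc 0 T) := by
  have h1 : ∀ t, duhamel c a t = ((Real.exp (-(c * t)) : ℝ) : ℂ) *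
      ∫ s in (0 : ℝ)..t, ((Real.exp (c * s) : ℝ) : ℂ) * a s := fun t => by
    rw [← intervalIntegral.integral_const_mul, duhamel]
    refine intervalIntegral.integral_congr fun s _ => ?_
    rw [← mul_assoc, ← Complex.ofReal_mul, ← Real.exp_add]
    congr 3
    ring
  simp only [funext h1]
  refine ContinuousOn.mul (by fun_prop) ?_
  rcases le_or_gt 0 T with hT | hT
  · have h2 : ContinuousOn (fun s => ((Real.exp (c * s) : ℝ) : ℂ) * a s) (Icc 0 T) :=
      ContinuousOn.mul (by fun_prop) ha
    have := intervalIntegral.continuousOn_primitive_interval (a := 0) (b := T) (μ := volume)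
      (by rw [uIcc_of_le hT]; exact h2.integrableOn_Icc)
    rwa [uIcc_of_le hT] at this
  · rw [Icc_eq_empty (not_le.2 hT)]
    exact continuousOn_empty _

theorem norm_duhamel_le {c l A t : ℝ} (hcl : 0 < l + c) (hA : 0 ≤ A) (ht : 0 ≤ t)
    (h : ∀ s ∈ Icc 0 t, ‖a s‖ ≤ A * Real.exp (l * s)) :
    ‖duhamel c a t‖ ≤ A * (l + c)⁻¹ * Real.exp (l * t) := by
  have hd : ∀ s ∈ uIcc 0 t, HasDerivAt
      (fun s => A * (l + c)⁻¹ * (Real.exp (-(c * t)) * Real.exp ((l + c) * s)))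
      (A * (Real.exp (-(c * (t - s))) * Real.exp (l * s))) s := fun s _ => by
    have h1 : HasDerivAt (fun s => Real.exp ((l + c) * s)) (Real.exp ((l + c) * s) * (l + c)) s := by
      simpa using ((hasDerivAt_id s).const_mul (l + c)).exp
    have h2 := (h1.const_mul (Real.exp (-(c * t)))).const_mul (A * (l + c)⁻¹)
    refine h2.congr_deriv ?_
    have h3 : Real.exp (-(c * (t - s))) * Real.exp (l * s)
        = Real.exp (-(c * t)) * Real.exp ((l + c) * s) := by
      rw [← Real.exp_add, ← Real.exp_add]
      congr 1
      ring
    rw [h3]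
    field_simp
  have hi := intervalIntegral.integral_eq_sub_of_hasDerivAt hd
    (Continuous.intervalIntegrable (by fun_prop) _ _)
  have hle : ‖duhamel c a t‖ ≤ ∫ s in (0 : ℝ)..t,
      A * (Real.exp (-(c * (t - s))) * Real.exp (l * s)) := by
    refine intervalIntegral.norm_integral_le_of_norm_le ht (Eventually.of_forall fun s hs => ?_)
      (Continuous.intervalIntegrable (by fun_prop) _ _)
    rw [norm_mul, Complex.norm_real, Real.norm_eq_abs, Real.abs_exp]
    have := h s ⟨hs.1.le, hs.2⟩
    calc _ ≤ Real.exp (-(c * (t - s))) * (A * Real.exp (l * s)) := by gcongr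
      _ = _ := by ring
  rw [hi] at hle
  refine hle.trans ?_
  have h4 : Real.exp (-(c * t)) * Real.exp ((l + c) * t) = Real.exp (l * t) := by
    rw [← Real.exp_add]
    congr 1
    ring
  rw [h4]
  have : 0 ≤ A * (l + c)⁻¹ * (Real.exp (-(c * t)) * Real.exp ((l + c) * 0)) := by positivity
  linarith

theorem norm_integral_mul_sq_le {w : ℝ → ℝ} {t : ℝ} (ht : 0 ≤ t) (hw : Continuous w)
    (hw0 : ∀ s, 0 ≤ w s) (ha : ContinuousOn a (Icc 0 t)) :
    ‖∫ s in (0 : ℝ)..t, ((w s : ℝ) : ℂ) * a s‖ ^ 2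
      ≤ (∫ s in (0 : ℝ)..t, w s) * ∫ s in (0 : ℝ)..t, w s * ‖a s‖ ^ 2 := by
  rw [← uIcc_of_le ht] at ha
  have i0 : IntervalIntegrable w volume 0 t := hw.intervalIntegrable _ _
  have i1 : IntervalIntegrable (fun s => w s * ‖a s‖) volume 0 t :=
    (hw.continuousOn.mul ha.norm).intervalIntegrable
  have i2 : IntervalIntegrable (fun s => w s * ‖a s‖ ^ 2) volume 0 t :=
    (hw.continuousOn.mul (ha.norm.pow 2)).intervalIntegrable
  have h1 : ‖∫ s in (0 : ℝ)..t, ((w s : ℝ) : ℂ) * a s‖ ≤ ∫ s in (0 : ℝ)..t, w s * ‖a s‖ := by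
    refine intervalIntegral.norm_integral_le_of_norm_le ht (Eventually.of_forall fun s hs => ?_) i1
    rw [norm_mul, Complex.norm_real, Real.norm_of_nonneg (hw0 s)]
  have h2 : ∀ x : ℝ, 0 ≤ (∫ s in (0 : ℝ)..t, w s) * (x * x) +
      (-2 * ∫ s in (0 : ℝ)..t, w s * ‖a s‖) * x + ∫ s in (0 : ℝ)..t, w s * ‖a s‖ ^ 2 := fun x => by
    have e : (∫ s in (0 : ℝ)..t, w s) * (x * x) +
      (-2 * ∫ s in (0 : ℝ)..t, w s * ‖a s‖) * x + ∫ s in (0 : ℝ)..t, w s * ‖a s‖ ^ 2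
        = ∫ s in (0 : ℝ)..t, (w s * (x * x) + w s * ‖a s‖ * (-2 * x) + w s * ‖a s‖ ^ 2) := by
      rw [intervalIntegral.integral_add ((i0.mul_const _).add (i1.mul_const _)) i2,
        intervalIntegral.integral_add (i0.mul_const _) (i1.mul_const _),
        intervalIntegral.integral_mul_const, intervalIntegral.integral_mul_const]
      ring
    rw [e]
    refine intervalIntegral.integral_nonneg ht fun s _ => ?_
    have : w s * (x * x) + w s * ‖a s‖ * (-2 * x) + w s * ‖a s‖ ^ 2 = w s * (x - ‖a s‖) ^ 2 := by
      ring
    rw [this]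
    exact mul_nonneg (hw0 s) (sq_nonneg _)
  have h3 := discrim_le_zero h2
  rw [discrim] at h3
  have h4 := pow_le_pow_left₀ (norm_nonneg _) h1 2
  linarith

theorem rpow_mul_exp_le {c τ r : ℝ} (hc : 0 < c) (hτ : 0 < τ) (hr : r ∈ Icc (0 : ℝ) 1) :
    c ^ r * Real.exp (-(c * τ)) ≤ τ ^ (-r) := by
  have h1 : (c * τ) ^ r ≤ Real.exp (c * τ) := by
    have h0 : 0 < c * τ := mul_pos hc hτ
    refine le_trans ?_ (Real.add_one_le_exp _)
    rcases le_total (c * τ) 1 with h | h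
    · exact (Real.rpow_le_one h0.le h hr.1).trans (by linarith)
    · calc (c * τ) ^ r ≤ (c * τ) ^ (1 : ℝ) := Real.rpow_le_rpow_of_exponent_le h hr.2
        _ ≤ _ := by rw [Real.rpow_one]; linarith
  rw [Real.mul_rpow hc.le hτ.le] at h1
  rw [Real.exp_neg, Real.rpow_neg hτ.le, ← div_eq_mul_inv, div_le_iff₀ (Real.exp_pos _),
    ← div_eq_inv_mul, le_div_iff₀ (Real.rpow_pos_of_pos hτ r)]
  exact h1

theorem one_add_sq_le_heatRate {k : ℤ} (hk : k ≠ 0) : 1 + (k : ℝ) ^ 2 ≤ heatRate k := by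
  have h4 : (1 : ℝ) ≤ (k : ℝ) ^ 2 := by
    have : (1 : ℤ) ≤ k ^ 2 := by have := sq_pos_of_ne_zero hk; omega
    exact_mod_cast this
  unfold heatRate
  have : (2 : ℝ) ≤ 4 * Real.pi ^ 2 := by nlinarith [Real.pi_gt_three]
  nlinarith

theorem intervalIntegrable_sub_rpow {r t : ℝ} (hr : -1 < r) :
    IntervalIntegrable (fun s => (t - s) ^ r) volume 0 t := by
  have := (intervalIntegral.intervalIntegrable_rpow' (a := 0) (b := t) hr).comp_sub_left t
  simpa using this.symm

theorem integral_sub_rpow {r t : ℝ} (hr : -1 < r) :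
    ∫ s in (0 : ℝ)..t, (t - s) ^ r = t ^ (r + 1) / (r + 1) := by
  rw [intervalIntegral.integral_comp_sub_left (fun s => s ^ r) t, sub_self, sub_zero,
    integral_rpow (Or.inl hr), Real.zero_rpow (by linarith), sub_zero]

theorem weight_mul_norm_duhamel_sq_le (k : ℤ) {β : ℝ} (hβ : β ∈ Ico (1 : ℝ) 2) {t : ℝ} (ht : 0 ≤ t)
    (ha : ContinuousOn a (Icc 0 t)) :
    (1 + (k : ℝ) ^ 2) ^ β * ‖duhamel (heatRate k) a t‖ ^ 2
      ≤ ∫ s in (0 : ℝ)..t, ((t - s) ^ (-(β - 1)) + t) * ‖a s‖ ^ 2 := by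
  have hw : Continuous fun s : ℝ => Real.exp (-(heatRate k * (t - s))) := by fun_prop
  have h1 := norm_integral_mul_sq_le ht hw (fun s => (Real.exp_pos _).le) ha
  have ha' : ContinuousOn (fun s => ‖a s‖ ^ 2) (uIcc 0 t) := by
    rw [uIcc_of_le ht]
    exact ha.norm.pow 2
  have i1 : IntervalIntegrable (fun s => ((t - s) ^ (-(β - 1)) + t) * ‖a s‖ ^ 2) volume 0 t :=
    IntervalIntegrable.mul_continuousOn ((intervalIntegrable_sub_rpow (by linarith [hβ.2])).add
      intervalIntegrable_const) ha'
  have i2 : IntervalIntegrable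
      (fun s => Real.exp (-(heatRate k * (t - s))) * ‖a s‖ ^ 2) volume 0 t :=
    (hw.intervalIntegrable _ _).mul_continuousOn ha'
  rcases eq_or_ne k 0 with rfl | hk
  · have h0 : heatRate 0 = 0 := by simp [heatRate]
    simp only [h0, zero_mul, neg_zero, Real.exp_zero, intervalIntegral.integral_const, sub_zero,
      one_mul, smul_eq_mul, mul_one] at h1 i2
    rw [duhamel, h0]
    simp only [zero_mul, neg_zero, Real.exp_zero, Int.cast_zero]
    norm_num
    norm_num at h1
    refine h1.trans ?_
    rw [← intervalIntegral.integral_const_mul]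
    refine intervalIntegral.integral_mono_on ht (i2.const_mul t) (by simpa using i1) fun s hs => ?_
    have : 0 ≤ (t - s) ^ (1 - β) := Real.rpow_nonneg (sub_nonneg.2 hs.2) _
    nlinarith [sq_nonneg ‖a s‖, mul_nonneg this (sq_nonneg ‖a s‖)]
  · have hc := one_add_sq_le_heatRate hk
    have hc0 : 0 < heatRate k := lt_of_lt_of_le (by positivity) hc
    have h2 : ∫ s in (0 : ℝ)..t, Real.exp (-(heatRate k * (t - s))) ≤ (heatRate k)⁻¹ := by
      have h3 := norm_duhamel_le (a := fun _ => 1) (c := heatRate k) (l := 0) (A := 1) (t := t)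
        (by linarith) zero_le_one ht (by simp)
      simp only [duhamel, mul_one, one_mul, zero_add, zero_mul, Real.exp_zero] at h3
      rw [intervalIntegral.integral_ofReal, Complex.norm_real] at h3
      exact (le_abs_self _).trans h3
    have h3 : ∀ s ∈ Ioo 0 t, heatRate k ^ (β - 1) * (Real.exp (-(heatRate k * (t - s))) * ‖a s‖ ^ 2)
        ≤ ((t - s) ^ (-(β - 1)) + t) * ‖a s‖ ^ 2 := fun s hs => by
      have h5 := rpow_mul_exp_le hc0 (sub_pos.2 hs.2) (r := β - 1)
        ⟨by linarith [hβ.1], by linarith [hβ.2]⟩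
      rw [← mul_assoc]
      gcongr
      linarith
    calc (1 + (k : ℝ) ^ 2) ^ β * ‖duhamel (heatRate k) a t‖ ^ 2
        ≤ heatRate k ^ β * ((heatRate k)⁻¹ *
          ∫ s in (0 : ℝ)..t, Real.exp (-(heatRate k * (t - s))) * ‖a s‖ ^ 2) := by
          refine mul_le_mul (Real.rpow_le_rpow (by positivity) hc (by linarith [hβ.1]))
            (h1.trans ?_) (by positivity) (by positivity)
          refine mul_le_mul_of_nonneg_right h2 ?_
          exact intervalIntegral.integral_nonneg ht fun s _ => by positivity
      _ = ∫ s in (0 : ℝ)..t, heatRate k ^ (β - 1) *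
            (Real.exp (-(heatRate k * (t - s))) * ‖a s‖ ^ 2) := by
          rw [intervalIntegral.integral_const_mul, Real.rpow_sub_one hc0.ne']
          ring
      _ ≤ _ := intervalIntegral.integral_mono_on_of_le_Ioo ht (i2.const_mul _) i1 h3

theorem sum_weight_mul_norm_duhamel_sq_le {a : ℤ → ℝ → ℂ} {β : ℝ} (hβ : β ∈ Ico (1 : ℝ) 2) {t : ℝ}
    (ht : t ∈ Icc 0 T) (ha : ∀ k, ContinuousOn (a k) (Icc 0 T)) {B : ℝ} (hB0 : 0 ≤ B)
    (hB : ∀ s ∈ Icc 0 T, ∀ F : Finset ℤ, ∑ k ∈ F, ‖a k s‖ ^ 2 ≤ B) (F : Finset ℤ) :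
    ∑ k ∈ F, (1 + (k : ℝ) ^ 2) ^ β * ‖duhamel (heatRate k) (a k) t‖ ^ 2
      ≤ (T ^ (2 - β) / (2 - β) + T * T) * B := by
  have hsub : Icc 0 t ⊆ Icc 0 T := Icc_subset_Icc_right ht.2
  have i0 : IntervalIntegrable (fun s => (t - s) ^ (-(β - 1)) + t) volume 0 t :=
    (intervalIntegrable_sub_rpow (by linarith [hβ.2])).add intervalIntegrable_const
  have i1 : ∀ k, IntervalIntegrable (fun s => ((t - s) ^ (-(β - 1)) + t) * ‖a k s‖ ^ 2) volume 0 t :=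
    fun k => i0.mul_continuousOn (by
      rw [uIcc_of_le ht.1]; exact ((ha k).mono hsub).norm.pow 2)
  have isum : IntervalIntegrable
      (fun s => ∑ k ∈ F, ((t - s) ^ (-(β - 1)) + t) * ‖a k s‖ ^ 2) volume 0 t := by
    have := IntervalIntegrable.sum F fun k _ => i1 k
    rwa [Finset.sum_fn] at this
  calc _ ≤ ∑ k ∈ F, ∫ s in (0 : ℝ)..t, ((t - s) ^ (-(β - 1)) + t) * ‖a k s‖ ^ 2 :=
        Finset.sum_le_sum fun k _ => weight_mul_norm_duhamel_sq_le k hβ ht.1 ((ha k).mono hsub)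
    _ = ∫ s in (0 : ℝ)..t, ∑ k ∈ F, ((t - s) ^ (-(β - 1)) + t) * ‖a k s‖ ^ 2 :=
        (intervalIntegral.integral_finsetSum fun k _ => i1 k).symm
    _ ≤ ∫ s in (0 : ℝ)..t, ((t - s) ^ (-(β - 1)) + t) * B := by
        refine intervalIntegral.integral_mono_on ht.1
          isum (i0.mul_const B) fun s hs => ?_
        rw [← Finset.mul_sum]
        refine mul_le_mul_of_nonneg_left (hB s (hsub hs) F) ?_
        have : 0 ≤ (t - s) ^ (-(β - 1)) := Real.rpow_nonneg (sub_nonneg.2 hs.2) _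
        linarith [ht.1]
    _ = (t ^ (2 - β) / (2 - β) + t * t) * B := by
        rw [intervalIntegral.integral_mul_const, intervalIntegral.integral_add
          (intervalIntegrable_sub_rpow (by linarith [hβ.2])) intervalIntegrable_const,
          integral_sub_rpow (by linarith [hβ.2]), intervalIntegral.integral_const, sub_zero,
          smul_eq_mul]
        ring_nf
    _ ≤ _ := by
        have h2 : 0 < 2 - β := by linarith [hβ.2]
        have h3 := ht.1
        have h4 := ht.2
        have h5 := h3.trans h4
        gcongr

theorem summable_inv_add_heatRate {l : ℝ} (hl : 1 ≤ l) : Summable fun k => (l + heatRate k)⁻¹ := by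
  refine (summable_one_add_sq_rpow (a := 1) (by norm_num)).of_nonneg_of_le
    (fun k => inv_nonneg.2 (by linarith [heatRate_nonneg k])) fun k => ?_
  rw [Real.rpow_neg_one]
  refine inv_anti₀ (by positivity) ?_
  rcases eq_or_ne k 0 with rfl | hk
  · simp [heatRate]
    exact hl
  · linarith [one_add_sq_le_heatRate hk]

theorem exists_tsum_inv_add_heatRate_le {e : ℝ} (he : 0 < e) :
    ∃ l : ℝ, 1 ≤ l ∧ ∑' k, (l + heatRate k)⁻¹ ≤ e := by
  have h1 : Tendsto (fun l : ℝ => ∑' k, (l + heatRate k)⁻¹) atTop (𝓝 (∑' _ : ℤ, (0 : ℝ))) := by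
    refine tendsto_tsum_of_dominated_convergence (summable_inv_add_heatRate le_rfl) (fun k => ?_) ?_
    · exact tendsto_inv_atTop_zero.comp (tendsto_atTop_add_const_right _ _ tendsto_id)
    · filter_upwards [eventually_ge_atTop 1] with l hl k
      have := heatRate_nonneg k
      rw [Real.norm_of_nonneg (inv_nonneg.2 (by linarith))]
      exact inv_anti₀ (by linarith) (by linarith)
  rw [tsum_zero] at h1
  obtain ⟨l, hl, hl'⟩ := ((h1.eventually (gt_mem_nhds he)).and (eventually_ge_atTop 1)).exists
  exact ⟨l, hl', hl.le⟩

end Duhamel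

/-! ### Continuous paths in Sobolev spaces -/

theorem continuousInH_of_bounded {T β β' : ℝ} (hβ : β < β') {u : ℝ → C(Torus, ℝ)} {B : ℝ}
    (hB0 : 0 ≤ B) (hB : ∀ t ∈ Icc 0 T, sobolevNormSq β' (u t) ≤ ENNReal.ofReal B)
    (hc : ∀ k, ContinuousOn (fun t => realCoeff (u t) k) (Icc 0 T)) : ContinuousInH T β u := by
  intro t ht
  refine ⟨((sobolevNormSq_mono hβ.le _).trans (hB t ht)).trans_lt ENNReal.ofReal_lt_top, ?_⟩
  rw [ENNReal.tendsto_nhds_zero]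
  intro e he
  obtain ⟨ε, hε, hεe⟩ : ∃ ε : ℝ, 0 < ε ∧ ENNReal.ofReal ε ≤ e := by
    obtain ⟨ε, h0, h1, h2⟩ := ENNReal.lt_iff_exists_real_btwn.1 he
    exact ⟨ε, ENNReal.ofReal_pos.1 h1, h2.le⟩
  set δ := ε / (2 * (4 * B + 1))
  have hδ : 0 < δ := by positivity
  have hfin : {k : ℤ | δ ≤ (1 + (k : ℝ) ^ 2) ^ (-(β' - β))}.Finite := by
    have h1 : Tendsto (fun k : ℤ => 1 + (k : ℝ) ^ 2) cofinite atTop := by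
      refine tendsto_atTop_mono (fun k => ?_)
        (tendsto_norm_cocompact_atTop.comp Int.tendsto_coe_cofinite)
      simp only [Function.comp_apply, Real.norm_eq_abs]
      nlinarith [sq_nonneg (1 - |(k : ℝ)|), sq_abs (k : ℝ)]
    have h2 := (tendsto_rpow_neg_atTop (sub_pos.2 hβ)).comp h1
    have h3 := h2.eventually (gt_mem_nhds hδ)
    rw [eventually_cofinite] at h3
    simpa only [Function.comp_apply, not_lt] using h3
  set F := hfin.toFinset
  have hF : Tendsto (fun s => ∑ k ∈ F, (1 + (k : ℝ) ^ 2) ^ β * ‖realCoeff (u s) k - realCoeff (u t) k‖ ^ 2)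
      (𝓝[Icc 0 T] t) (𝓝 (∑ k ∈ F, (1 + (k : ℝ) ^ 2) ^ β * ‖realCoeff (u t) k - realCoeff (u t) k‖ ^ 2)) :=
    tendsto_finsetSum _ fun k _ => (((hc k t ht).sub_const _).norm.pow 2).const_mul _
  simp only [sub_self, norm_zero, ne_eq, OfNat.ofNat_ne_zero, not_false_eq_true, zero_pow, mul_zero,
    Finset.sum_const_zero] at hF
  filter_upwards [hF.eventually (gt_mem_nhds (half_pos hε)), self_mem_nhdsWithin] with s hs hsT
  refine le_trans (sobolevNormSq_le_of_sum_le fun F' => ?_) hεe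
  have hx : ∀ r ∈ Icc 0 T, ∑ k ∈ F', (1 + (k : ℝ) ^ 2) ^ β' * ‖realCoeff (u r) k‖ ^ 2 ≤ B := by
    intro r hr
    obtain ⟨h1, h2⟩ := summable_of_sobolevNormSq_le (hB r hr) hB0
    exact (h1.sum_le_tsum F' fun k _ => by positivity).trans h2
  have hterm : ∀ k ∈ F', (1 + (k : ℝ) ^ 2) ^ β * ‖realCoeff (u s - u t : C(Torus, ℝ)) k‖ ^ 2 ≤
      (if k ∈ F then (1 + (k : ℝ) ^ 2) ^ β * ‖realCoeff (u s) k - realCoeff (u t) k‖ ^ 2 else 0) +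
      δ * (2 * ((1 + (k : ℝ) ^ 2) ^ β' * ‖realCoeff (u s) k‖ ^ 2) +
        2 * ((1 + (k : ℝ) ^ 2) ^ β' * ‖realCoeff (u t) k‖ ^ 2)) := by
    intro k _
    rw [realCoeff_sub]
    split_ifs with hk
    · have : 0 ≤ δ * (2 * ((1 + (k : ℝ) ^ 2) ^ β' * ‖realCoeff (u s) k‖ ^ 2) +
        2 * ((1 + (k : ℝ) ^ 2) ^ β' * ‖realCoeff (u t) k‖ ^ 2)) := by positivity
      linarith
    · have h0 : (0 : ℝ) < 1 + (k : ℝ) ^ 2 := by positivity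
      have h1 : (1 + (k : ℝ) ^ 2) ^ (-(β' - β)) ≤ δ :=
        (lt_of_not_ge fun h => hk (hfin.mem_toFinset.2 h)).le
      have h2 : (1 + (k : ℝ) ^ 2) ^ β ≤ δ * (1 + (k : ℝ) ^ 2) ^ β' := by
        have : (1 + (k : ℝ) ^ 2) ^ β
            = (1 + (k : ℝ) ^ 2) ^ (-(β' - β)) * (1 + (k : ℝ) ^ 2) ^ β' := by
          rw [← Real.rpow_add h0]; congr 1; ring
        rw [this]
        gcongr
      have h3 : ‖realCoeff (u s) k - realCoeff (u t) k‖ ^ 2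
          ≤ 2 * ‖realCoeff (u s) k‖ ^ 2 + 2 * ‖realCoeff (u t) k‖ ^ 2 := by
        have := norm_sub_le (realCoeff (u s) k) (realCoeff (u t) k)
        have := pow_le_pow_left₀ (norm_nonneg _) this 2
        nlinarith [sq_nonneg (‖realCoeff (u s) k‖ - ‖realCoeff (u t) k‖)]
      calc _ ≤ (δ * (1 + (k : ℝ) ^ 2) ^ β') *
            (2 * ‖realCoeff (u s) k‖ ^ 2 + 2 * ‖realCoeff (u t) k‖ ^ 2) :=
            mul_le_mul h2 h3 (by positivity) (by positivity)
        _ = _ := by ring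
  refine (Finset.sum_le_sum hterm).trans ?_
  rw [Finset.sum_add_distrib, ← Finset.mul_sum, Finset.sum_add_distrib, ← Finset.mul_sum,
    ← Finset.mul_sum, Finset.sum_ite_mem]
  have h1 : ∑ k ∈ F' ∩ F, (1 + (k : ℝ) ^ 2) ^ β * ‖realCoeff (u s) k - realCoeff (u t) k‖ ^ 2
      ≤ ε / 2 :=
    (Finset.sum_le_sum_of_subset_of_nonneg Finset.inter_subset_right
      fun k _ _ => by positivity).trans hs.le
  have h2 : δ * (4 * B) ≤ ε / 2 := by
    rw [div_mul_eq_mul_div, div_le_div_iff₀ (by positivity) (by norm_num)]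
    nlinarith
  have h3 := mul_le_mul_of_nonneg_left (add_le_add (hx s hsT) (hx t ht)) hδ.le
  linarith

theorem ContinuousInH.continuousOn {T β : ℝ} (hβ : 3 / 2 < β) {u : ℝ → C(Torus, ℝ)}
    (hu : ContinuousInH T β u) : ContinuousOn u (Icc 0 T) := by
  obtain ⟨C, hC, hemb⟩ := exists_sobolev_embedding hβ
  intro t ht
  rw [ContinuousWithinAt, tendsto_iff_norm_sub_tendsto_zero, Metric.tendsto_nhds]
  intro e he
  have h0 : 0 < e / (C + 1) := by positivity
  have h1 := (ENNReal.tendsto_nhds_zero.1 (hu t ht).2) (ENNReal.ofReal ((e / (C + 1)) ^ 2))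
    (ENNReal.ofReal_pos.2 (by positivity))
  filter_upwards [h1] with s hs
  have h2 := (hemb _ _ h0 hs).2.2.1
  rw [Real.dist_eq, sub_zero, abs_of_nonneg (norm_nonneg _)]
  refine lt_of_le_of_lt h2 ?_
  rw [mul_div_assoc', div_lt_iff₀ (by positivity)]
  nlinarith

theorem ContinuousInH.exists_lipschitz {T β : ℝ} (hβ : 3 / 2 < β) {u : ℝ → C(Torus, ℝ)}
    (hu : ContinuousInH T β u) : ∃ L, 0 ≤ L ∧
      ∀ s ∈ Icc 0 T, ∀ x (a : ℝ), |u s (x + (a : Torus)) - u s x| ≤ L * |a| := by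
  obtain ⟨C, hC, hemb⟩ := exists_sobolev_embedding hβ
  refine isCompact_Icc.induction_on (p := fun A => ∃ L, 0 ≤ L ∧
    ∀ s ∈ A, ∀ x (a : ℝ), |u s (x + (a : Torus)) - u s x| ≤ L * |a|) ⟨0, le_rfl, by simp⟩ ?_ ?_ ?_
  · rintro s t hst ⟨L, hL, h⟩
    exact ⟨L, hL, fun x hx => h x (hst hx)⟩
  · rintro s t ⟨L, hL, h⟩ ⟨L', hL', h'⟩
    refine ⟨L + L', by positivity, fun x hx y a => ?_⟩
    have h0 := abs_nonneg a
    rcases hx with hx | hx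
    · nlinarith [h x hx y a, mul_nonneg hL' h0]
    · nlinarith [h' x hx y a, mul_nonneg hL h0]
  · intro t ht
    have h1 := (ENNReal.tendsto_nhds_zero.1 (hu t ht).2) (ENNReal.ofReal (1 ^ 2))
      (ENNReal.ofReal_pos.2 (by positivity))
    set B := (sobolevNormSq β (u t)).toReal + 1
    have hB : 1 ≤ B := by simp only [B]; linarith [(sobolevNormSq β (u t)).toReal_nonneg]
    have h2 : sobolevNormSq β (u t) ≤ ENNReal.ofReal (B ^ 2) := by
      rw [← ENNReal.ofReal_toReal (hu t ht).1.ne]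
      refine ENNReal.ofReal_le_ofReal ?_
      simp only [B] at hB ⊢
      nlinarith
    refine ⟨_, h1, C * 1 + C * B, by positivity, fun s hs x a => ?_⟩
    have h3 := (hemb _ 1 one_pos hs).2.2.2 x a
    have h4 := (hemb _ B (by linarith) h2).2.2.2 x a
    have h5 : u s (x + (a : Torus)) - u s x = ((u s - u t) (x + (a : Torus)) - (u s - u t) x)
        + (u t (x + (a : Torus)) - u t x) := by
      simp only [ContinuousMap.sub_apply]; ring
    rw [h5, add_mul]
    exact (abs_add_le _ _).trans (add_le_add h3 h4)

/-! ### The source term along a transported density -/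

theorem exists_isTransported {T M L : ℝ} {w : ℝ → C(Torus, ℝ)} (hw : IsAdmissibleField T M L w)
    (f₀ : L1xv) : ∃ f, IsTransported T (fun t x => w t x) f₀ f := by
  obtain ⟨X, V, h⟩ := exists_isCharacteristicFlow hw
  obtain ⟨f, hf⟩ := exists_transport hw h f₀
  exact ⟨f, X, V, h, hf⟩

namespace IsTransported

variable {T M L : ℝ} {w : ℝ → C(Torus, ℝ)} {f₀ : L1xv} {f : ℝ → L1xv}

theorem exists_backFlow (hf : IsTransported T (fun t x => w t x) f₀ f) :
    ∃ (X : ℝ → ℝ → Torus × ℝ → Torus) (V : ℝ → ℝ → Torus × ℝ → ℝ),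
      IsCharacteristicFlow T (fun t x => w t x) X V ∧
      ∀ t ∈ Icc 0 T, (f t : Torus × ℝ → ℝ) =ᵐ[volume]
        fun z => Real.exp t * f₀ (backFlow X V t z) := hf

theorem continuousInG (hf : IsTransported T (fun t x => w t x) f₀ f)
    (hw : IsAdmissibleField T M L w) {k : ℝ} (hk : 0 ≤ k) (hf₀ : MemG k f₀) :
    ContinuousInG T k f := by
  obtain ⟨X, V, h, hf⟩ := hf.exists_backFlow
  exact continuousInG_of_transport hw h hf hk hf₀

theorem memG0 (hf : IsTransported T (fun t x => w t x) f₀ f)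
    (hw : IsAdmissibleField T M L w) {k : ℝ} (hk : 0 ≤ k) (hf₀ : MemG0 k f₀) {t : ℝ}
    (ht : t ∈ Icc 0 T) : MemG0 k (f t) := by
  obtain ⟨X, V, h, hf⟩ := hf.exists_backFlow
  exact memG0_of_transport hw h hf hk hf₀ ht

theorem lintegral_le (hf : IsTransported T (fun t x => w t x) f₀ f)
    (hw : IsAdmissibleField T M L w) {t : ℝ} (ht : t ∈ Icc 0 T) :
    ∫⁻ z, ‖f t z‖ₑ ≤ gNorm 1 f₀ := by
  obtain ⟨X, V, h, hf⟩ := hf.exists_backFlow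
  have h1 := lintegral_transport_le hw h ht (stronglyMeasurable_coe f₀) (ρ := 1) (ρ' := 1)
    measurable_one (fun _ => le_rfl)
  rw [← lintegral_congr_enorm (hf t ht)] at h1
  simp only [Pi.one_apply, one_mul] at h1
  refine h1.trans ?_
  rw [gNorm_one]
  refine lintegral_mono fun z => le_mul_of_one_le_left zero_le ?_
  rw [ENNReal.one_le_ofReal]
  linarith [abs_nonneg z.2]

theorem gNorm_le (hf : IsTransported T (fun t x => w t x) f₀ f)
    (hw : IsAdmissibleField T M L w) {t : ℝ} (ht : t ∈ Icc 0 T) :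
    gNorm 1 (f t) ≤ ENNReal.ofReal (momentConst T M 1) * gNorm 1 f₀ := by
  obtain ⟨X, V, h, hf⟩ := hf.exists_backFlow
  have h1 := gNorm_transport_le hw h ht (stronglyMeasurable_coe f₀) zero_le_one
  rwa [← lintegral_congr_enorm (hf t ht)] at h1

theorem momentum_le (hf : IsTransported T (fun t x => w t x) f₀ f)
    (hw : IsAdmissibleField T M L w) {t : ℝ} (ht : t ∈ Icc 0 T) {N : ℝ}
    (hN : ∀ r ∈ Icc 0 t, ‖w r‖ ≤ N) :
    ∫⁻ z, ENNReal.ofReal |z.2| * ‖f t z‖ₑ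
      ≤ ENNReal.ofReal (2 * Real.exp (2 * T) * (1 + N * T)) * gNorm 1 f₀ := by
  obtain ⟨X, V, h, hf⟩ := hf.exists_backFlow
  have hN0 : 0 ≤ N := (norm_nonneg _).trans (hN 0 ⟨le_rfl, ht.1⟩)
  have hT : 0 ≤ T := ht.1.trans ht.2
  have hw' : IsAdmissibleField t N L w := { hw.mono ht.2 with norm_le := hN }
  have h1 := lintegral_transport_le hw h ht (stronglyMeasurable_coe f₀)
    (ρ := fun z => ENNReal.ofReal |z.2|)
    (ρ' := fun z => ENNReal.ofReal (2 * Real.exp (2 * T) * (1 + N * T)) * ENNReal.ofReal (1 + |z.2|))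
    (by fun_prop) (fun z => by
      rw [← ENNReal.ofReal_mul (by positivity)]
      refine ENNReal.ofReal_le_ofReal ?_
      obtain ⟨c, -, v⟩ := h.isCharacteristic ht z
      have h2 := (c.mono ht.2).abs_vel_le hw' ⟨le_rfl, ht.1⟩ ⟨ht.1, le_rfl⟩
      rw [v] at h2
      have h3 : Real.exp (2 * t) ≤ Real.exp (2 * T) := Real.exp_le_exp.2 (by linarith [ht.2])
      have h4 : N * t ≤ N * T := mul_le_mul_of_nonneg_left ht.2 hN0
      have h5 : |V 0 t z| + N * t ≤ (1 + N * T) * (1 + |V 0 t z|) := by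
        nlinarith [abs_nonneg (V 0 t z), mul_nonneg (mul_nonneg hN0 hT) (abs_nonneg (V 0 t z))]
      refine h2.trans ?_
      have ht0 := ht.1
      calc 2 * (|V 0 t z| + N * t) * Real.exp (2 * t)
          ≤ 2 * ((1 + N * T) * (1 + |V 0 t z|)) * Real.exp (2 * T) := by gcongr
        _ = _ := by simp only [backFlow]; ring)
  rw [← lintegral_congr_enorm (hf t ht)] at h1
  refine h1.trans (le_of_eq ?_)
  rw [gNorm_one, ← lintegral_const_mul' _ _ ENNReal.ofReal_ne_top]
  simp only [mul_assoc]

theorem lintegral_sq_le (hf : IsTransported T (fun t x => w t x) f₀ f)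
    (hw : IsAdmissibleField T M L w) {t : ℝ} (ht : t ∈ Icc 0 T) :
    ∫⁻ z, ENNReal.ofReal (1 + |z.2| ^ (4 : ℝ)) * ‖f t z‖ₑ ^ 2
      ≤ ENNReal.ofReal (Real.exp T * momentConst T M 4) *
        ∫⁻ z, ENNReal.ofReal (1 + |z.2| ^ (4 : ℝ)) * ‖f₀ z‖ₑ ^ 2 := by
  obtain ⟨X, V, h, hf⟩ := hf.exists_backFlow
  have hT : 0 ≤ T := ht.1.trans ht.2
  have hM : 0 ≤ M := (norm_nonneg _).trans (hw.norm_le t ht)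
  have hκ : 0 ≤ momentConst T M 4 := zero_le_one.trans (one_le_momentConst hT hM 4)
  have hm : Measurable fun z : Torus × ℝ => ENNReal.ofReal (1 + |z.2| ^ (4 : ℝ)) := by fun_prop
  have h1 := lintegral_sq_transport_le hw h ht (stronglyMeasurable_coe f₀)
    (ρ := fun z => ENNReal.ofReal (1 + |z.2| ^ (4 : ℝ)))
    (ρ' := fun z => ENNReal.ofReal (momentConst T M 4) * ENNReal.ofReal (1 + |z.2| ^ (4 : ℝ)))
    (hm.const_mul _) (fun z => by
      rw [← ENNReal.ofReal_mul hκ]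
      exact ENNReal.ofReal_le_ofReal (h.weight_le hw ht (by norm_num) z))
  have h2 : ∫⁻ z, ENNReal.ofReal (1 + |z.2| ^ (4 : ℝ)) * ‖f t z‖ₑ ^ 2 =
      ∫⁻ z, ENNReal.ofReal (1 + |z.2| ^ (4 : ℝ)) * ‖Real.exp t * f₀ (backFlow X V t z)‖ₑ ^ 2 :=
    lintegral_congr_ae (by filter_upwards [hf t ht] with z hz; rw [hz])
  rw [h2]
  refine h1.trans ?_
  simp only [mul_assoc]
  rw [lintegral_const_mul' _ _ ENNReal.ofReal_ne_top, ENNReal.ofReal_mul (Real.exp_pos _).le,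
    mul_assoc]
  gcongr
  exact ht.2

end IsTransported

theorem lintegral_coe_sub (f g : L1xv) (ρ : Torus × ℝ → ℝ≥0∞) :
    ∫⁻ z, ρ z * ‖(f - g : L1xv) z‖ₑ = ∫⁻ z, ρ z * ‖f z - g z‖ₑ :=
  lintegral_congr_enorm (Lp.coeFn_sub f g) ρ

theorem norm_sourceCoeff_le_of_memG {f : L1xv} (hf : MemG 1 f) {P Q : ℝ} (hP : 0 ≤ P) (hQ : 0 ≤ Q)
    (h1 : ∫⁻ z, ENNReal.ofReal |z.2| * ‖f z‖ₑ ≤ ENNReal.ofReal P)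
    (h2 : ∫⁻ z, ‖f z‖ₑ ≤ ENNReal.ofReal Q) (u : C(Torus, ℝ)) (k : ℤ) :
    ‖sourceCoeff f u k‖ ≤ P + ‖u‖ * Q :=
  norm_sourceCoeff_le (stronglyMeasurable_coe f).aestronglyMeasurable hf.integrable_weight hP hQ
    h1 h2 u k

theorem norm_sourceCoeff_sub_le_of_memG {f f' : L1xv} (hf : MemG 1 f) (hf' : MemG 1 f') {P Q : ℝ}
    (hP : 0 ≤ P) (hQ : 0 ≤ Q)
    (h1 : ∫⁻ z, ENNReal.ofReal (1 + |z.2|) * ‖f z - f' z‖ₑ ≤ ENNReal.ofReal P)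
    (h2 : gNorm 1 f' ≤ ENNReal.ofReal Q) (u u' : C(Torus, ℝ)) (k : ℤ) :
    ‖sourceCoeff f u k - sourceCoeff f' u' k‖ ≤ (1 + ‖u‖) * P + ‖u - u'‖ * Q :=
  norm_sourceCoeff_sub_le (stronglyMeasurable_coe f).aestronglyMeasurable hf.integrable_weight
    (stronglyMeasurable_coe f').aestronglyMeasurable hf'.integrable_weight hP hQ h1
    (by rwa [gNorm_one] at h2) u u' k

theorem continuousOn_sourceCoeff {T : ℝ} {f : ℝ → L1xv} {u : ℝ → C(Torus, ℝ)}
    (hf : ContinuousInG T 1 f) (hu : ContinuousOn u (Icc 0 T)) (k : ℤ) :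
    ContinuousOn (fun s => sourceCoeff (f s) (u s) k) (Icc 0 T) := by
  intro t ht
  rw [ContinuousWithinAt, tendsto_iff_norm_sub_tendsto_zero]
  have h1 : Tendsto (fun s => (gNorm 1 (f s - f t)).toReal) (𝓝[Icc 0 T] t) (𝓝 0) := by
    have := (ENNReal.tendsto_toReal ENNReal.zero_ne_top).comp (hf t ht).2
    rwa [ENNReal.toReal_zero] at this
  have h2 : Tendsto (fun s => ‖u s - u t‖) (𝓝[Icc 0 T] t) (𝓝 0) :=
    tendsto_iff_norm_sub_tendsto_zero.1 (hu t ht)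
  have h3 : Tendsto (fun s => ‖u s‖) (𝓝[Icc 0 T] t) (𝓝 ‖u t‖) := (hu t ht).norm
  have h4 : Tendsto (fun s => (1 + ‖u s‖) * (gNorm 1 (f s - f t)).toReal +
      ‖u s - u t‖ * (gNorm 1 (f t)).toReal) (𝓝[Icc 0 T] t) (𝓝 0) := by
    simpa using ((h3.const_add 1).mul h1).add (h2.mul_const (gNorm 1 (f t)).toReal)
  refine squeeze_zero' (Eventually.of_forall fun s => norm_nonneg _) ?_ h4
  filter_upwards [self_mem_nhdsWithin,
    (ENNReal.tendsto_nhds_zero.1 (hf t ht).2) 1 one_pos] with s hs hs1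
  refine norm_sourceCoeff_sub_le_of_memG (hf s hs).1 (hf t ht).1 ENNReal.toReal_nonneg
    ENNReal.toReal_nonneg ?_ ?_ _ _ _
  · rw [ENNReal.ofReal_toReal (ne_top_of_le_ne_top ENNReal.one_ne_top hs1), gNorm_one,
      lintegral_coe_sub]
  · rw [ENNReal.ofReal_toReal (hf t ht).1.ne]

/-! ### Mild solutions of the heat equation in terms of Fourier coefficients -/

theorem MemG.integrable_snd_mul {f : L1xv} (hf : MemG 1 f) :
    Integrable (fun z : Torus × ℝ => z.2 * f z) :=
  integrable_mul_of_abs_le (stronglyMeasurable_coe f).aestronglyMeasurable hf.integrable_weight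
    continuous_snd (C := 1) fun z => by linarith [abs_nonneg z.2]

theorem coeffL_eq_sourceCoeff {f : L1xv} (hf : MemG 1 f) {u : C(Torus, ℝ)} {G : L2x}
    (hG : (G : Torus → ℂ) =ᵐ[AddCircle.haarAddCircle]
      fun x => ((momentum f x - density f x * u x : ℝ) : ℂ)) (k : ℤ) :
    coeffL k G = sourceCoeff f u k := by
  rw [coeffL_apply, fourierCoeff_congr_ae hG, ← fourierCoeff_source hf.integrable_weight]
  rfl

theorem IsHeatMild.realCoeff_eq {T : ℝ} {u₀ : C(Torus, ℝ)} {f : ℝ → L1xv} {u : ℝ → C(Torus, ℝ)}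
    (h : IsHeatMild T u₀ f u) (hf : ∀ t ∈ Icc 0 T, MemG 1 (f t)) {t : ℝ} (ht : t ∈ Icc 0 T) (k : ℤ) :
    realCoeff (u t) k = ((Real.exp (-(heatRate k * t)) : ℝ) : ℂ) * realCoeff u₀ k +
      duhamel (heatRate k) (fun s => sourceCoeff (f s) (u s) k) t := by
  obtain ⟨G, hG, hint⟩ := h
  obtain ⟨hi, he⟩ := hint t ht
  rw [(duhamel_iff ht.1 hi).1 he k]
  congr 1
  refine duhamel_congr (a := fun s => coeffL k (G s)) ht.1 fun s hs => ?_
  have hs' : s ∈ Icc 0 T := ⟨hs.1, hs.2.trans ht.2⟩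
  exact coeffL_eq_sourceCoeff (hf s hs') (hG s hs').2 k

theorem isHeatMild_of_realCoeff_eq {T : ℝ} {u₀ : C(Torus, ℝ)} {f : ℝ → L1xv} {u : ℝ → C(Torus, ℝ)}
    (hf : ContinuousInG T 1 f) (hu : ContinuousOn u (Icc 0 T)) {G : ℝ → L2x} {B : ℝ}
    (hG : ∀ s ∈ Icc 0 T, (G s : Torus → ℂ) =ᵐ[AddCircle.haarAddCircle]
      (fun x => ((source (f s) (u s) x : ℝ) : ℂ)) ∧ ‖G s‖ ^ 2 ≤ B)
    (h : ∀ t ∈ Icc 0 T, ∀ k, realCoeff (u t) k =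
      ((Real.exp (-(heatRate k * t)) : ℝ) : ℂ) * realCoeff u₀ k +
      duhamel (heatRate k) (fun s => sourceCoeff (f s) (u s) k) t) : IsHeatMild T u₀ f u := by
  have hcoef : ∀ s ∈ Icc 0 T, ∀ k, coeffL k (G s) = sourceCoeff (f s) (u s) k := fun s hs k =>
    coeffL_eq_sourceCoeff (hf s hs).1 (hG s hs).1 k
  refine ⟨G, fun s hs => ⟨(hf s hs).1.integrable_snd_mul, (hG s hs).1⟩, fun t ht => ?_⟩
  have hsub : Icc 0 t ⊆ Icc 0 T := Icc_subset_Icc_right ht.2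
  have hi : IntervalIntegrable (fun s => heat (t - s) (G s)) volume 0 t := by
    refine intervalIntegrable_heat (B := Real.sqrt B) ht.1
      (fun s hs => Real.le_sqrt_of_sq_le (hG s (hsub hs)).2) fun k => ?_
    exact ((continuousOn_sourceCoeff hf hu k).mono hsub).congr fun s hs => hcoef s (hsub hs) k
  refine ⟨hi, (duhamel_iff ht.1 hi).2 fun k => ?_⟩
  rw [h t ht k]
  congr 1
  exact duhamel_congr (a' := fun s => coeffL k (G s)) ht.1 fun s hs => (hcoef s (hsub hs) k).symm

theorem sum_sq_sourceCoeff_le {f : L1xv} (hf : MemG 1 f) {u : C(Torus, ℝ)} {G : L2x} {B : ℝ}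
    (hG : (G : Torus → ℂ) =ᵐ[AddCircle.haarAddCircle] (fun x => ((source f u x : ℝ) : ℂ)))
    (hB : ‖G‖ ^ 2 ≤ B) (F : Finset ℤ) : ∑ k ∈ F, ‖sourceCoeff f u k‖ ^ 2 ≤ B := by
  simp only [← coeffL_eq_sourceCoeff hf hG]
  exact (sum_le_hasSum F (fun k _ => sq_nonneg _) (hasSum_sq_coeffL G)).trans hB

theorem realCoeff_neg (g : Torus → ℝ) (k : ℤ) : realCoeff g (-k) = star (realCoeff g k) := by
  rw [realCoeff, realCoeff, fourierCoeff, fourierCoeff, Complex.star_def, ← integral_conj]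
  refine integral_congr_ae (Eventually.of_forall fun x => ?_)
  simp only [smul_eq_mul, map_mul, Complex.conj_ofReal, fourier_neg, Complex.conj_conj]

theorem summable_norm_of_sum_weight_le {σ : ℝ} (hσ : 1 / 2 < σ) {c : ℤ → ℂ} {B : ℝ}
    (h : ∀ F : Finset ℤ, ∑ k ∈ F, (1 + (k : ℝ) ^ 2) ^ σ * ‖c k‖ ^ 2 ≤ B) :
    Summable fun k => ‖c k‖ := by
  have h1 : Summable fun k : ℤ => (1 + (k : ℝ) ^ 2) ^ σ * ‖c k‖ ^ 2 :=
    summable_of_sum_le (fun k => by positivity) h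
  refine ((summable_one_add_sq_rpow hσ).add h1).of_nonneg_of_le (fun k => norm_nonneg _) fun k => ?_
  have h0 : (0 : ℝ) < 1 + (k : ℝ) ^ 2 := by positivity
  rw [Real.rpow_neg h0.le]
  set p := (1 + (k : ℝ) ^ 2) ^ σ
  have hp : 0 < p := Real.rpow_pos_of_pos h0 _
  have h2 : p⁻¹ + p * ‖c k‖ ^ 2 - 2 * ‖c k‖ = (1 - p * ‖c k‖) ^ 2 / p := by
    field_simp
    ring
  have h3 : 0 ≤ (1 - p * ‖c k‖) ^ 2 / p := by positivity
  linarith [norm_nonneg (c k)]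

theorem exists_heat_path {T η : ℝ} (hη : η ∈ Ioo (3 / 2 : ℝ) 2) {u₀ : C(Torus, ℝ)}
    (hu₀ : MemH η u₀) (hT : 0 ≤ T) : ∃ C : ℝ, 0 ≤ C ∧ ∀ (a : ℤ → ℝ → ℂ) (B : ℝ), 0 ≤ B →
      (∀ k, ContinuousOn (a k) (Icc 0 T)) →
      (∀ k s, a (-k) s = star (a k s)) →
      (∀ s ∈ Icc 0 T, ∀ F : Finset ℤ, ∑ k ∈ F, ‖a k s‖ ^ 2 ≤ B) →
      ∃ u : ℝ → C(Torus, ℝ),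
        (∀ t ∈ Icc 0 T, ∀ k, realCoeff (u t) k =
          ((Real.exp (-(heatRate k * t)) : ℝ) : ℂ) * realCoeff u₀ k + duhamel (heatRate k) (a k) t) ∧
        (∀ t ∈ Icc 0 T, sobolevNormSq η (u t) ≤ ENNReal.ofReal (C * (1 + B))) := by
  have h2η : 0 < 2 - η := by linarith [hη.2]
  set U := (sobolevNormSq η u₀).toReal
  have hU : 0 ≤ U := ENNReal.toReal_nonneg
  obtain ⟨hU1, hU2⟩ := summable_of_sobolevNormSq_le (σ := η) (B := U) (g := u₀)
    (by rw [ENNReal.ofReal_toReal hu₀.ne]) hU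
  set D := T ^ (2 - η) / (2 - η) + T * T
  have hD : 0 ≤ D := by positivity
  refine ⟨2 * U + 2 * D, by positivity, fun a B hB0 hac hconj hB => ?_⟩
  set c : ℝ → ℤ → ℂ := fun t k =>
    ((Real.exp (-(heatRate k * t)) : ℝ) : ℂ) * realCoeff u₀ k + duhamel (heatRate k) (a k) t
  have hbound : ∀ t ∈ Icc 0 T, ∀ F : Finset ℤ,
      ∑ k ∈ F, (1 + (k : ℝ) ^ 2) ^ η * ‖c t k‖ ^ 2 ≤ (2 * U + 2 * D) * (1 + B) := by
    intro t ht F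
    have h1 := sum_weight_mul_norm_duhamel_sq_le (β := η) ⟨by linarith [hη.1], hη.2⟩ ht hac hB0 hB F
    have h2 := (hU1.sum_le_tsum F fun k _ => by positivity).trans hU2
    have h3 : ∀ k ∈ F, (1 + (k : ℝ) ^ 2) ^ η * ‖c t k‖ ^ 2 ≤
        2 * ((1 + (k : ℝ) ^ 2) ^ η * ‖realCoeff u₀ k‖ ^ 2) +
        2 * ((1 + (k : ℝ) ^ 2) ^ η * ‖duhamel (heatRate k) (a k) t‖ ^ 2) := by
      intro k _
      have h4 : ‖c t k‖ ≤ ‖realCoeff u₀ k‖ + ‖duhamel (heatRate k) (a k) t‖ := by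
        refine (norm_add_le _ _).trans (add_le_add_left ?_ _)
        rw [norm_mul, Complex.norm_real, Real.norm_eq_abs, Real.abs_exp]
        exact mul_le_of_le_one_left (norm_nonneg _) (exp_heatRate_le_one k ht.1)
      have h5 : ‖c t k‖ ^ 2 ≤ 2 * ‖realCoeff u₀ k‖ ^ 2 + 2 * ‖duhamel (heatRate k) (a k) t‖ ^ 2 := by
        have := pow_le_pow_left₀ (norm_nonneg _) h4 2
        nlinarith [sq_nonneg (‖realCoeff u₀ k‖ - ‖duhamel (heatRate k) (a k) t‖)]
      have h6 : (0 : ℝ) ≤ (1 + (k : ℝ) ^ 2) ^ η := by positivity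
      nlinarith [mul_le_mul_of_nonneg_left h5 h6]
    refine (Finset.sum_le_sum h3).trans ?_
    rw [Finset.sum_add_distrib, ← Finset.mul_sum, ← Finset.mul_sum]
    nlinarith [mul_nonneg hU hB0, mul_nonneg hD hB0]
  have hex : ∀ t, ∃ g : C(Torus, ℝ), t ∈ Icc 0 T → ∀ k, realCoeff g k = c t k := by
    intro t
    by_cases ht : t ∈ Icc 0 T
    · obtain ⟨g, hg⟩ := exists_of_summable_coeff
        (summable_norm_of_sum_weight_le (by linarith [hη.1]) (hbound t ht)) (fun k => by
          simp only [c, heatRate_neg, realCoeff_neg, star_add, star_mul', Complex.star_def,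
            Complex.conj_ofReal]
          rw [← Complex.star_def, ← duhamel_star]
          simp only [funext (hconj k)])
      exact ⟨g, fun _ => hg⟩
    · exact ⟨0, fun h => absurd h ht⟩
  choose u hu using hex
  refine ⟨u, hu, fun t ht => sobolevNormSq_le_of_sum_le fun F => ?_⟩
  simp only [hu t ht]
  exact hbound t ht F

/-! ### The coupled system -/

theorem IsAdmissibleField.weaken {T M L M' L' : ℝ} {w : ℝ → C(Torus, ℝ)}
    (hw : IsAdmissibleField T M L w) (hM : M ≤ M') (hL : L ≤ L') : IsAdmissibleField T M' L' w where
  aesm := hw.aesm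
  norm_le s hs := (hw.norm_le s hs).trans hM
  nonneg := hw.nonneg.trans hL
  lip s hs x a := (hw.lip s hs x a).trans (mul_le_mul_of_nonneg_right hL (abs_nonneg a))

theorem IsAdmissibleField.add {T M L R L' : ℝ} {b u : ℝ → C(Torus, ℝ)}
    (hb : IsAdmissibleField T M L b) (hu : ContinuousOn u (Icc 0 T))
    (hR : ∀ s ∈ Icc 0 T, ‖u s‖ ≤ R) (hL' : 0 ≤ L')
    (hlip : ∀ s ∈ Icc 0 T, ∀ x (a : ℝ), |u s (x + (a : Torus)) - u s x| ≤ L' * |a|) :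
    IsAdmissibleField T (M + R) (L + L') (fun s => b s + u s) where
  aesm := hb.aesm.add (hu.aestronglyMeasurable measurableSet_Icc)
  norm_le s hs := (norm_add_le _ _).trans (add_le_add (hb.norm_le s hs) (hR s hs))
  nonneg := add_nonneg hb.nonneg hL'
  lip s hs x a := by
    have h1 : (b s + u s) (x + (a : Torus)) - (b s + u s) x
        = (b s (x + (a : Torus)) - b s x) + (u s (x + (a : Torus)) - u s x) := by
      simp only [ContinuousMap.add_apply]; ring
    rw [h1, add_mul]
    exact (abs_add_le _ _).trans (add_le_add (hb.lip s hs x a) (hlip s hs x a))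

theorem exists_sourceCoeff_lipschitz {f₀ : L1xv} (hf₀ : MemG 1 f₀)
    (hf₀' : HasWeightedIntegrableGradient f₀) (T M L R : ℝ) (hT : 0 ≤ T) (hM : 0 ≤ M) (hR : 0 ≤ R)
    (b : ℝ → C(Torus, ℝ)) :
    ∃ K : ℝ, 0 ≤ K ∧ ∀ (u u' : ℝ → C(Torus, ℝ)) (f f' : ℝ → L1xv),
      IsAdmissibleField T M L (fun s => b s + u s) →
      IsAdmissibleField T M L (fun s => b s + u' s) →
      IsTransported T (fun t x => (b t + u t) x) f₀ f →
      IsTransported T (fun t x => (b t + u' t) x) f₀ f' →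
      (∀ s ∈ Icc 0 T, ‖u s‖ ≤ R) →
      ∀ t ∈ Icc 0 T, ∀ e : ℝ, (∀ r ∈ Icc 0 t, ‖u r - u' r‖ ≤ e) → ∀ k,
        ‖sourceCoeff (f t) (u t) k - sourceCoeff (f' t) (u' t) k‖ ≤ K * e := by
  obtain ⟨K, hK, hlip⟩ := exists_transport_lipschitz f₀ hf₀' T M L
  set Q := momentConst T M 1 * (gNorm 1 f₀).toReal
  have hκ : 0 ≤ momentConst T M 1 := zero_le_one.trans (one_le_momentConst hT hM 1)
  have hQ : 0 ≤ Q := mul_nonneg hκ ENNReal.toReal_nonneg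
  refine ⟨(1 + R) * K + Q, by positivity, fun u u' f f' hw hw' hf hf' hu t ht e he k => ?_⟩
  have he0 : 0 ≤ e := (norm_nonneg _).trans (he 0 ⟨le_rfl, ht.1⟩)
  have h1 : ∫⁻ z, ENNReal.ofReal (1 + |z.2|) * ‖f t z - f' t z‖ₑ ≤ ENNReal.ofReal (K * e) := by
    obtain ⟨X, V, h, hf⟩ := hf.exists_backFlow (w := fun s => b s + u s)
    obtain ⟨X', V', h', hf'⟩ := hf'.exists_backFlow (w := fun s => b s + u' s)
    refine hlip _ _ X X' V V' f f' hw hw' h h' hf hf' t ht e fun r hr => ?_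
    rw [add_sub_add_left_eq_sub]
    exact he r hr
  have h2 : gNorm 1 (f' t) ≤ ENNReal.ofReal Q := by
    rw [ENNReal.ofReal_mul hκ, ENNReal.ofReal_toReal hf₀.ne]
    exact hf'.gNorm_le hw' ht
  have h3 := norm_sourceCoeff_sub_le_of_memG (hf.continuousInG hw zero_le_one hf₀ t ht).1
    (hf'.continuousInG hw' zero_le_one hf₀ t ht).1 (mul_nonneg hK he0) hQ h1 h2 (u t) (u' t) k
  refine h3.trans ?_
  have h4 := hu t ht
  have h5 := he t ⟨ht.1, le_rfl⟩
  have : 0 ≤ K * e := mul_nonneg hK he0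
  calc (1 + ‖u t‖) * (K * e) + ‖u t - u' t‖ * Q ≤ (1 + R) * (K * e) + e * Q := by gcongr
    _ = _ := by ring

/-- The heat equation gains a small factor in a norm with a large exponential weight in time. -/
theorem norm_sub_le_of_duhamel {T K l N : ℝ} (hl : 1 ≤ l) (hK : 0 ≤ K) (hN : 0 ≤ N)
    (hκ : ∑' k, (l + heatRate k)⁻¹ ≤ 1 / (2 * (K + 1))) {a a' : ℤ → ℝ → ℂ} {c : ℝ → ℤ → ℂ}
    {u u' v v' : ℝ → C(Torus, ℝ)}
    (ha : ∀ k, ContinuousOn (a k) (Icc 0 T)) (ha' : ∀ k, ContinuousOn (a' k) (Icc 0 T))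
    (hv : ∀ t ∈ Icc 0 T, ∀ k, realCoeff (v t) k = c t k + duhamel (heatRate k) (a k) t)
    (hv' : ∀ t ∈ Icc 0 T, ∀ k, realCoeff (v' t) k = c t k + duhamel (heatRate k) (a' k) t)
    (hdiff : ∀ t ∈ Icc 0 T, ∀ e : ℝ, (∀ r ∈ Icc 0 t, ‖u r - u' r‖ ≤ e) →
      ∀ k, ‖a k t - a' k t‖ ≤ K * e)
    (hu : ∀ s ∈ Icc 0 T, ‖u s - u' s‖ ≤ N * Real.exp (l * s)) :
    ∀ s ∈ Icc 0 T, ‖v s - v' s‖ ≤ N / 2 * Real.exp (l * s) := by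
  intro t ht
  have hs := ((summable_inv_add_heatRate hl).mul_left (K * N)).mul_right (Real.exp (l * t))
  have h1 : ∀ k, ‖realCoeff (v t - v' t : C(Torus, ℝ)) k‖
      ≤ K * N * (l + heatRate k)⁻¹ * Real.exp (l * t) := by
    intro k
    rw [realCoeff_sub, hv t ht, hv' t ht, add_sub_add_left_eq_sub, duhamel_sub (ha k) (ha' k) _ ht]
    refine norm_duhamel_le (by linarith [heatRate_nonneg k]) (by positivity) ht.1 fun s hs => ?_
    have hs' : s ∈ Icc 0 T := ⟨hs.1, hs.2.trans ht.2⟩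
    rw [mul_assoc]
    refine hdiff s hs' _ (fun r hr => (hu r ⟨hr.1, hr.2.trans hs'.2⟩).trans ?_) k
    have := hr.2
    gcongr
  refine (norm_le_tsum_of_coeff_le hs h1).trans ?_
  rw [tsum_mul_right, tsum_mul_left]
  refine mul_le_mul_of_nonneg_right ?_ (Real.exp_pos _).le
  have h2 : K * N * ∑' k, (l + heatRate k)⁻¹ ≤ K * N * (1 / (2 * (K + 1))) := by gcongr
  refine h2.trans ?_
  rw [mul_one_div, div_le_div_iff₀ (by positivity) (by norm_num)]
  nlinarith

theorem norm_le_of_duhamel {T l A U : ℝ} (hl : 1 ≤ l) (hA : 0 ≤ A) {a : ℤ → ℝ → ℂ}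
    {u₀ : C(Torus, ℝ)} (hs₀ : Summable fun k => ‖realCoeff u₀ k‖)
    (hU : ∑' k, ‖realCoeff u₀ k‖ ≤ U) {v : ℝ → C(Torus, ℝ)}
    (hv : ∀ t ∈ Icc 0 T, ∀ k, realCoeff (v t) k =
      ((Real.exp (-(heatRate k * t)) : ℝ) : ℂ) * realCoeff u₀ k + duhamel (heatRate k) (a k) t)
    (ha : ∀ s ∈ Icc 0 T, ∀ k, ‖a k s‖ ≤ A * Real.exp (l * s)) :
    ∀ t ∈ Icc 0 T, ‖v t‖ ≤ (U + A * ∑' k, (l + heatRate k)⁻¹) * Real.exp (l * t) := by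
  intro t ht
  have hs := ((summable_inv_add_heatRate hl).mul_left A).mul_right (Real.exp (l * t))
  have h1 : ∀ k, ‖realCoeff (v t) k‖
      ≤ ‖realCoeff u₀ k‖ + A * (l + heatRate k)⁻¹ * Real.exp (l * t) := by
    intro k
    rw [hv t ht]
    refine (norm_add_le _ _).trans (add_le_add ?_ ?_)
    · rw [norm_mul, Complex.norm_real, Real.norm_eq_abs, Real.abs_exp]
      exact mul_le_of_le_one_left (norm_nonneg _) (exp_heatRate_le_one k ht.1)
    · exact norm_duhamel_le (by linarith [heatRate_nonneg k]) hA ht.1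
        fun s hs => ha s ⟨hs.1, hs.2.trans ht.2⟩ k
  refine (norm_le_tsum_of_coeff_le (hs₀.add hs) h1).trans ?_
  rw [hs₀.tsum_add hs, tsum_mul_right, tsum_mul_left, add_mul]
  have hU0 : 0 ≤ U := (tsum_nonneg fun k => norm_nonneg _).trans hU
  have h2 : 1 ≤ Real.exp (l * t) := Real.one_le_exp (mul_nonneg (by linarith) ht.1)
  nlinarith

theorem norm_sourceCoeff_le_of_transported {T M L M₀ R l : ℝ} {b u : ℝ → C(Torus, ℝ)} {f₀ : L1xv}
    (hf₀ : MemG 1 f₀) {f : ℝ → L1xv} (hb : ∀ s ∈ Icc 0 T, ‖b s‖ ≤ M₀)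
    (hw : IsAdmissibleField T M L (fun s => b s + u s))
    (hf : IsTransported T (fun t x => (b t + u t) x) f₀ f) (hl : 0 ≤ l) (hR : 0 ≤ R)
    (hu : ∀ s ∈ Icc 0 T, ‖u s‖ ≤ R * Real.exp (l * s)) {s : ℝ} (hs : s ∈ Icc 0 T) (k : ℤ) :
    ‖sourceCoeff (f s) (u s) k‖ ≤ (gNorm 1 f₀).toReal * (2 * Real.exp (2 * T) * (1 + M₀ * T) +
      (2 * Real.exp (2 * T) * T + 1) * R) * Real.exp (l * s) := by
  set g := (gNorm 1 f₀).toReal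
  have hg : 0 ≤ g := ENNReal.toReal_nonneg
  have hg' : gNorm 1 f₀ = ENNReal.ofReal g := (ENNReal.ofReal_toReal hf₀.ne).symm
  have hT : 0 ≤ T := hs.1.trans hs.2
  have hM₀ : 0 ≤ M₀ := (norm_nonneg _).trans (hb s hs)
  have hE : 1 ≤ Real.exp (l * s) := Real.one_le_exp (mul_nonneg hl hs.1)
  set Es := Real.exp (l * s)
  have h1 := hf.momentum_le hw hs (N := M₀ + R * Es) fun r hr => by
    have hr' : r ∈ Icc 0 T := ⟨hr.1, hr.2.trans hs.2⟩
    refine (norm_add_le _ _).trans (add_le_add (hb r hr') ((hu r hr').trans ?_))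
    have := hr.2
    simp only [Es]
    gcongr
  rw [hg', ← ENNReal.ofReal_mul (by positivity)] at h1
  have h2 := hf.lintegral_le hw hs
  rw [hg'] at h2
  refine (norm_sourceCoeff_le_of_memG (hf.continuousInG hw zero_le_one hf₀ s hs).1 (by positivity)
    hg h1 h2 (u s) k).trans ?_
  have h3 := hu s hs
  have h4 : ‖u s‖ * g ≤ R * Es * g := by gcongr
  have h5 : 2 * Real.exp (2 * T) * (1 + M₀ * T) * g ≤ 2 * Real.exp (2 * T) * (1 + M₀ * T) * g * Es :=
    le_mul_of_one_le_right (by positivity) hE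
  nlinarith

theorem lintegral_sq_ne_top_of_integrable {f : L1xv}
    (hf : Integrable (fun z : Torus × ℝ => (1 + |z.2| ^ 4) * |f z| ^ 2)) :
    ∫⁻ z, ENNReal.ofReal (1 + |z.2| ^ (4 : ℝ)) * ‖f z‖ₑ ^ 2 ≠ ⊤ := by
  refine ne_top_of_le_ne_top hf.2.ne (lintegral_mono fun z => ?_)
  have h : |z.2| ^ (4 : ℝ) = |z.2| ^ 4 := by exact_mod_cast Real.rpow_natCast |z.2| 4
  rw [h, ← ofReal_norm, ← ofReal_norm, ← ENNReal.ofReal_pow (norm_nonneg _),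
    ← ENNReal.ofReal_mul (by positivity)]
  exact ENNReal.ofReal_le_ofReal (le_abs_self _)

/-- Existence for the coupled system with a given admissible field `b`. -/
theorem exists_mild_solution {T M₀ L₀ η : ℝ} (hT : 0 < T) {b : ℝ → C(Torus, ℝ)}
    (hb : IsAdmissibleField T M₀ L₀ b) {f₀ : L1xv}
    (hf₀ : Integrable (fun z : Torus × ℝ => (1 + |z.2| ^ 4) * |f₀ z| ^ 2))
    (hf₀' : HasWeightedIntegrableGradient f₀) (hη : η ∈ Ioo (3 / 2 : ℝ) 2) {u₀ : C(Torus, ℝ)}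
    (hu₀ : MemH η u₀) :
    ∃ (f : ℝ → L1xv) (u : ℝ → C(Torus, ℝ)) (M L : ℝ),
      IsAdmissibleField T M L (fun s => b s + u s) ∧
      IsTransported T (fun t x => (b t + u t) x) f₀ f ∧ IsHeatMild T u₀ f u ∧
      ∀ β < η, ContinuousInH T β u := by
  have hG₀ := memG_one_of_weighted_sq hf₀
  have hM₀ : 0 ≤ M₀ := (norm_nonneg _).trans (hb.norm_le 0 ⟨le_rfl, hT.le⟩)
  obtain ⟨Ce, hCe, hemb⟩ := exists_sobolev_embedding hη.1
  -- the initial datum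
  have hs₀ : Summable fun k => ‖realCoeff u₀ k‖ := by
    set V := (sobolevNormSq η u₀).toReal + 1
    have hV : 1 ≤ V := by simp only [V]; linarith [(sobolevNormSq η u₀).toReal_nonneg]
    have h2 : sobolevNormSq η u₀ ≤ ENNReal.ofReal (V ^ 2) := by
      rw [← ENNReal.ofReal_toReal hu₀.ne]
      refine ENNReal.ofReal_le_ofReal ?_
      simp only [V] at hV ⊢
      nlinarith
    exact (hemb u₀ V (by linarith) h2).1.of_nonneg_of_le (fun _ => norm_nonneg _)
      fun k => le_mul_of_one_le_left (norm_nonneg _) (by linarith [abs_nonneg (k : ℝ)])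
  set U := ∑' k, ‖realCoeff u₀ k‖
  have hU : 0 ≤ U := tsum_nonneg fun k => norm_nonneg _
  -- the bound in the uniform norm
  set g := (gNorm 1 f₀).toReal
  have hg : 0 ≤ g := ENNReal.toReal_nonneg
  set c₁ := g * (2 * Real.exp (2 * T) * (1 + M₀ * T))
  set c₂ := g * (2 * Real.exp (2 * T) * T + 1)
  have hc₁ : 0 ≤ c₁ := by positivity
  have hc₂ : 0 ≤ c₂ := by positivity
  obtain ⟨l, hl, hlκ⟩ := exists_tsum_inv_add_heatRate_le (e := 1 / (2 * (c₁ + c₂ + 1)))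
    (by positivity)
  have hl0 : 0 ≤ l := by linarith
  set R := 2 * U + 1
  have hR : 0 ≤ R := by positivity
  have hκR : U + (c₁ + c₂ * R) * ∑' k, (l + heatRate k)⁻¹ ≤ R := by
    have h1 : (c₁ + c₂ * R) * ∑' k, (l + heatRate k)⁻¹ ≤ (c₁ + c₂ * R) * (1 / (2 * (c₁ + c₂ + 1))) := by
      gcongr
    have h2 : (c₁ + c₂ * R) * (1 / (2 * (c₁ + c₂ + 1))) ≤ R / 2 := by
      rw [mul_one_div, div_le_div_iff₀ (by positivity) (by norm_num)]
      have : 1 ≤ R := by simp only [R]; linarith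
      nlinarith
    simp only [R] at h1 h2 ⊢
    linarith
  set R' := R * Real.exp (l * T)
  have hR' : 0 ≤ R' := by positivity
  have hexp : ∀ s ∈ Icc 0 T, R * Real.exp (l * s) ≤ R' := fun s hs => by
    have := hs.2
    simp only [R']
    gcongr
  set M := M₀ + R'
  have hM : 0 ≤ M := by positivity
  -- the bound in the Sobolev norm
  obtain ⟨Cs, hCs, hsrc⟩ := exists_source_bound
  set S₀ := (∫⁻ z, ENNReal.ofReal (1 + |z.2| ^ (4 : ℝ)) * ‖f₀ z‖ₑ ^ 2).toReal
  set S := Real.exp T * momentConst T M 4 * S₀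
  have hκ4 : 0 ≤ momentConst T M 4 := zero_le_one.trans (one_le_momentConst hT.le hM 4)
  have hS : 0 ≤ S := mul_nonneg (mul_nonneg (Real.exp_pos _).le hκ4) ENNReal.toReal_nonneg
  set B := Cs * (1 + R') ^ 2 * S
  have hB : 0 ≤ B := by positivity
  obtain ⟨Ch, hCh, hheat⟩ := exists_heat_path hη hu₀ hT.le
  set H := Ch * (1 + B)
  have hH : 0 ≤ H := by positivity
  set Lu := Ce * (Real.sqrt H + 1)
  have hLu : 0 ≤ Lu := by positivity
  set L := L₀ + Lu
  have hlipH : ∀ v : C(Torus, ℝ), sobolevNormSq η v ≤ ENNReal.ofReal H →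
      ∀ x (a : ℝ), |v (x + (a : Torus)) - v x| ≤ Lu * |a| := fun v hv =>
    (hemb v (Real.sqrt H + 1) (by positivity) (hv.trans (ENNReal.ofReal_le_ofReal (by
      nlinarith [Real.sq_sqrt hH, Real.sqrt_nonneg H])))).2.2.2
  -- the fixed point map
  set Z : Set (ℝ → C(Torus, ℝ)) := {u | ContinuousOn u (Icc 0 T) ∧
    (∀ s ∈ Icc 0 T, ‖u s‖ ≤ R * Real.exp (l * s)) ∧
    ∀ s ∈ Icc 0 T, ∀ x (a : ℝ), |u s (x + (a : Torus)) - u s x| ≤ Lu * |a|}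
  have hw : ∀ u ∈ Z, IsAdmissibleField T M L (fun s => b s + u s) := fun u hu =>
    hb.add hu.1 (fun s hs => (hu.2.1 s hs).trans (hexp s hs)) hLu hu.2.2
  have hex : ∀ u, ∃ p : (ℝ → L1xv) × (ℝ → C(Torus, ℝ)), u ∈ Z →
      IsTransported T (fun t x => (b t + u t) x) f₀ p.1 ∧
      (∀ t ∈ Icc 0 T, ∀ k, realCoeff (p.2 t) k =
        ((Real.exp (-(heatRate k * t)) : ℝ) : ℂ) * realCoeff u₀ k +
        duhamel (heatRate k) (fun s => sourceCoeff (p.1 s) (u s) k) t) ∧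
      (∀ t ∈ Icc 0 T, sobolevNormSq η (p.2 t) ≤ ENNReal.ofReal H) ∧
      ∃ G : ℝ → L2x, ∀ s ∈ Icc 0 T, (G s : Torus → ℂ) =ᵐ[AddCircle.haarAddCircle]
        (fun x => ((source (p.1 s) (u s) x : ℝ) : ℂ)) ∧ ‖G s‖ ^ 2 ≤ B := by
    intro u
    by_cases hu : u ∈ Z
    swap
    · exact ⟨(0, 0), fun h => absurd h hu⟩
    obtain ⟨f, hf⟩ := exists_isTransported (hw u hu) f₀
    have hfG := hf.continuousInG (hw u hu) zero_le_one hG₀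
    have hG : ∀ s, ∃ G : L2x, s ∈ Icc 0 T → (G : Torus → ℂ) =ᵐ[AddCircle.haarAddCircle]
        (fun x => ((source (f s) (u s) x : ℝ) : ℂ)) ∧ ‖G‖ ^ 2 ≤ B := by
      intro s
      by_cases hs : s ∈ Icc 0 T
      swap
      · exact ⟨0, fun h => absurd h hs⟩
      have h1 := hf.lintegral_sq_le (hw u hu) hs
      rw [← ENNReal.ofReal_toReal (lintegral_sq_ne_top_of_integrable hf₀),
        ← ENNReal.ofReal_mul (by positivity)] at h1
      obtain ⟨G, hG, hGB⟩ := hsrc (f s) (u s) S (hfG s hs).1 hS h1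
      refine ⟨G, fun _ => ⟨hG, hGB.trans ?_⟩⟩
      have := (hu.2.1 s hs).trans (hexp s hs)
      simp only [B]
      gcongr
    choose G hG using hG
    obtain ⟨v, hv, hvH⟩ := hheat (fun k s => sourceCoeff (f s) (u s) k) B hB
      (fun k => continuousOn_sourceCoeff hfG hu.1 k) (fun k s => sourceCoeff_neg _ _ _)
      (fun s hs F => sum_sq_sourceCoeff_le (hfG s hs).1 (hG s hs).1 (hG s hs).2 F)
    exact ⟨(f, v), fun _ => ⟨hf, hv, hvH, G, hG⟩⟩
  choose p hp using hex
  have hcont : ∀ u ∈ Z, ∀ k, ContinuousOn (fun s => sourceCoeff ((p u).1 s) (u s) k) (Icc 0 T) :=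
    fun u hu => continuousOn_sourceCoeff ((hp u hu).1.continuousInG (hw u hu) zero_le_one hG₀) hu.1
  have hInH : ∀ u ∈ Z, ∀ β < η, ContinuousInH T β (p u).2 := by
    intro u hu β hβ
    refine continuousInH_of_bounded hβ hH (hp u hu).2.2.1 fun k => ?_
    refine ContinuousOn.congr ?_ fun t ht => (hp u hu).2.1 t ht k
    refine ContinuousOn.add (ContinuousOn.mul ?_ continuousOn_const)
      (continuousOn_duhamel (hcont u hu k) _)
    exact (show Continuous fun t : ℝ => ((Real.exp (-(heatRate k * t)) : ℝ) : ℂ) by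
      fun_prop).continuousOn
  have hmaps : MapsTo (fun u => (p u).2) Z Z := by
    intro u hu
    have hmid : 3 / 2 < (3 / 2 + η) / 2 := by linarith [hη.1]
    refine ⟨(hInH u hu ((3 / 2 + η) / 2) (by linarith [hη.1])).continuousOn hmid, fun s hs => ?_,
      fun s hs => hlipH _ ((hp u hu).2.2.1 s hs)⟩
    refine (norm_le_of_duhamel hl (by positivity) hs₀ le_rfl (hp u hu).2.1
      (A := c₁ + c₂ * R) (fun s hs k => ?_) s hs).trans
      (mul_le_mul_of_nonneg_right hκR (Real.exp_pos _).le)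
    refine (norm_sourceCoeff_le_of_transported hG₀ hb.norm_le (hw u hu) (hp u hu).1 hl0 hR hu.2.1
      hs k).trans (le_of_eq ?_)
    simp only [c₁, c₂, g]
    ring
  obtain ⟨K, hK, hKlip⟩ := exists_sourceCoeff_lipschitz hG₀ hf₀' T M L R' hT.le hM hR' b
  obtain ⟨l', hl', hlκ'⟩ := exists_tsum_inv_add_heatRate_le (e := 1 / (2 * (K + 1))) (by positivity)
  have hzero : (0 : ℝ → C(Torus, ℝ)) ∈ Z := by
    refine ⟨continuousOn_const, fun s _ => ?_, fun s _ x a => ?_⟩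
    · simp only [Pi.zero_apply, norm_zero]; positivity
    · simp only [Pi.zero_apply, ContinuousMap.zero_apply, sub_zero, abs_zero]; positivity
  obtain ⟨u, hu, hfix⟩ := exists_fixedPoint_of_weighted_contraction (I := Icc 0 T)
    (wt := fun s => Real.exp (l' * s)) (B := Real.exp (l' * T))
    (fun s hs => Real.exp_le_exp.2 (mul_le_mul_of_nonneg_left hs.2 (by linarith))) Z
    (fun u => (p u).2) hmaps
    (fun u hu u' hu' N hN h => norm_sub_le_of_duhamel hl' hK hN hlκ' (hcont u hu) (hcont u' hu')
      (hp u hu).2.1 (hp u' hu').2.1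
      (fun t ht e he k => hKlip u u' _ _ (hw u hu) (hw u' hu') (hp u hu).1 (hp u' hu').1
        (fun s hs => (hu.2.1 s hs).trans (hexp s hs)) t ht e he k) h)
    (fun y z hy hyz => by
      have hpt : ∀ s ∈ Icc 0 T, Tendsto (fun n => y n s) atTop (𝓝 (z s)) := fun s hs =>
        hyz.tendsto_at hs
      refine ⟨hyz.continuousOn (Eventually.of_forall fun n => (hy n).1).frequently, fun s hs => ?_,
        fun s hs x a => ?_⟩
      · exact le_of_tendsto' (hpt s hs).norm fun n => (hy n).2.1 s hs
      · have h1 : ∀ x, Tendsto (fun n => y n s x) atTop (𝓝 (z s x)) := fun x =>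
          ((ContinuousMap.evalCLM ℝ x).continuous.tendsto (z s)).comp (hpt s hs)
        exact le_of_tendsto' ((h1 (x + (a : Torus))).sub (h1 x)).abs
          fun n => (hy n).2.2 s hs x a)
    hzero (N := R') hR' (fun s hs => by
      rw [Pi.zero_apply, sub_zero]
      refine (((hmaps hzero).2.1 s hs).trans (hexp s hs)).trans
        (le_mul_of_one_le_right hR' (Real.one_le_exp (mul_nonneg (by linarith) hs.1))))
  have hfG := (hp u hu).1.continuousInG (hw u hu) zero_le_one hG₀
  obtain ⟨hf, hv, hvH, G, hG⟩ := hp u hu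
  refine ⟨(p u).1, u, M, L, hw u hu, hf, isHeatMild_of_realCoeff_eq hfG hu.1 hG fun t ht k => ?_,
    fun β hβ t ht => ?_⟩
  · rw [← hv t ht k, hfix t ht]
  · obtain ⟨h1, h2⟩ := hInH u hu β hβ t ht
    simp only [hfix t ht] at h1 h2
    refine ⟨h1, h2.congr' ?_⟩
    filter_upwards [self_mem_nhdsWithin] with s hs
    rw [hfix s hs]

/-- Uniqueness for the coupled system with a given admissible field `b`. -/
theorem mild_solution_unique {T M₀ L₀ β β' : ℝ} (hT : 0 < T) {b : ℝ → C(Torus, ℝ)}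
    (hb : IsAdmissibleField T M₀ L₀ b) {f₀ : L1xv} (hG₀ : MemG 1 f₀)
    (hf₀' : HasWeightedIntegrableGradient f₀) {u₀ : C(Torus, ℝ)} {f f' : ℝ → L1xv}
    {u u' : ℝ → C(Torus, ℝ)} (hf : IsTransported T (fun t x => (b t + u t) x) f₀ f)
    (hu : IsHeatMild T u₀ f u) (hf' : IsTransported T (fun t x => (b t + u' t) x) f₀ f')
    (hu' : IsHeatMild T u₀ f' u') (hβ : 3 / 2 < β) (hβ' : 3 / 2 < β') (hc : ContinuousInH T β u)
    (hc' : ContinuousInH T β' u') : EqOn f' f (Icc 0 T) ∧ EqOn u' u (Icc 0 T) := by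
  have hM₀ : 0 ≤ M₀ := (norm_nonneg _).trans (hb.norm_le 0 ⟨le_rfl, hT.le⟩)
  obtain ⟨R₁, hR₁⟩ := isCompact_Icc.exists_bound_of_continuousOn (hc.continuousOn hβ)
  obtain ⟨R₂, hR₂⟩ := isCompact_Icc.exists_bound_of_continuousOn (hc'.continuousOn hβ')
  obtain ⟨L₁, hL₁, hlip₁⟩ := hc.exists_lipschitz hβ
  obtain ⟨L₂, hL₂, hlip₂⟩ := hc'.exists_lipschitz hβ'
  have h0 : (0 : ℝ) ∈ Icc 0 T := ⟨le_rfl, hT.le⟩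
  have hR₁0 : 0 ≤ R₁ := (norm_nonneg _).trans (hR₁ 0 h0)
  have hR₂0 : 0 ≤ R₂ := (norm_nonneg _).trans (hR₂ 0 h0)
  set M := M₀ + (R₁ + R₂)
  set L := L₀ + (L₁ + L₂)
  have hw : IsAdmissibleField T M L (fun s => b s + u s) :=
    (hb.add (hc.continuousOn hβ) hR₁ hL₁ hlip₁).weaken (by simp only [M]; linarith)
      (by simp only [L]; linarith)
  have hw' : IsAdmissibleField T M L (fun s => b s + u' s) :=
    (hb.add (hc'.continuousOn hβ') hR₂ hL₂ hlip₂).weaken (by simp only [M]; linarith)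
      (by simp only [L]; linarith)
  have hfG := hf.continuousInG hw zero_le_one hG₀
  have hfG' := hf'.continuousInG hw' zero_le_one hG₀
  obtain ⟨K, hK, hKlip⟩ := exists_sourceCoeff_lipschitz hG₀ hf₀' T M L R₁ hT.le (by positivity)
    hR₁0 b
  obtain ⟨l, hl, hlκ⟩ := exists_tsum_inv_add_heatRate_le (e := 1 / (2 * (K + 1))) (by positivity)
  have hzero := nonpos_of_weighted_contraction (I := Icc 0 T) (wt := fun s => Real.exp (l * s))
    (g := fun s => ‖u s - u' s‖) (N := R₁ + R₂) (by positivity) (fun s hs => by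
      refine ((norm_sub_le _ _).trans (add_le_add (hR₁ s hs) (hR₂ s hs))).trans
        (le_mul_of_one_le_right (by positivity)
          (Real.one_le_exp (mul_nonneg (by linarith) hs.1))))
    (fun N hN h => norm_sub_le_of_duhamel hl hK hN hlκ
      (continuousOn_sourceCoeff hfG (hc.continuousOn hβ))
      (continuousOn_sourceCoeff hfG' (hc'.continuousOn hβ'))
      (fun t ht k => hu.realCoeff_eq (fun t ht => (hfG t ht).1) ht k)
      (fun t ht k => hu'.realCoeff_eq (fun t ht => (hfG' t ht).1) ht k)
      (fun t ht e he k => hKlip u u' f f' hw hw' hf hf' hR₁ t ht e he k) h)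
  have heq : ∀ s ∈ Icc 0 T, u s = u' s := fun s hs =>
    sub_eq_zero.1 (norm_le_zero_iff.1 (hzero s hs))
  refine ⟨fun t ht => ?_, fun t ht => (heq t ht).symm⟩
  obtain ⟨K', hK', hlip⟩ := exists_transport_lipschitz f₀ hf₀' T M L
  obtain ⟨X, V, h, hf⟩ := hf.exists_backFlow (w := fun s => b s + u s)
  obtain ⟨X', V', h', hf'⟩ := hf'.exists_backFlow (w := fun s => b s + u' s)
  have h1 := hlip _ _ X X' V V' f f' hw hw' h h' hf hf' t ht 0 fun r hr => by
    rw [heq r ⟨hr.1, hr.2.trans ht.2⟩, sub_self, norm_zero]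
  rw [mul_zero, ENNReal.ofReal_zero] at h1
  have hm : Measurable fun z => ENNReal.ofReal (1 + |z.2|) * ‖f t z - f' t z‖ₑ :=
    Measurable.mul (by fun_prop)
      ((stronglyMeasurable_coe (f t)).sub (stronglyMeasurable_coe (f' t))).enorm
  have h2 := (lintegral_eq_zero_iff hm).1 (le_antisymm h1 zero_le)
  refine Lp.ext ?_
  filter_upwards [h2] with z hz
  rw [Pi.zero_apply, mul_eq_zero, enorm_eq_zero, ENNReal.ofReal_eq_zero] at hz
  rcases hz with hz | hz
  · linarith [abs_nonneg z.2]
  · exact (sub_eq_zero.1 hz).symm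

theorem IsCadlagOn.isAdmissibleField {E : Type*} [NormedAddCommGroup E] [NormedSpace ℝ E]
    {ι : E →ₗ[ℝ] C(Torus, ℝ)} (hι : ∃ C : ℝ, ∀ n : E, W2InftyNormLE (ι n) (C * ‖n‖)) {T : ℝ}
    {m : ℝ → E} (hm : IsCadlagOn T m) : ∃ M L, IsAdmissibleField T M L (fun t => ι (m t)) := by
  obtain ⟨K, hK, hbd⟩ := exists_bound_of_W2Infty ι hι
  obtain ⟨C, hC⟩ := hm.exists_bound
  have hC' : ∀ s ∈ Icc 0 T, ‖m s‖ ≤ |C| := fun s hs => (hC s hs).trans (le_abs_self C)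
  refine ⟨K * |C|, K * |C|, ⟨?_, fun s hs => ?_, by positivity, fun s hs x a => ?_⟩⟩
  · exact (ι.mkContinuous K fun n => (hbd n).1).continuous.comp_aestronglyMeasurable
      hm.aestronglyMeasurable
  · exact (hbd (m s)).1.trans (mul_le_mul_of_nonneg_left (hC' s hs) hK)
  · refine ((hbd (m s)).2 x a).trans ?_
    have := hC' s hs
    gcongr

end KineticFluid

theorem proposition3p1
    {E : Type*} [NormedAddCommGroup E] [NormedSpace ℝ E]
    -- the continuous embedding of `E` into `W^{2,∞}(𝕋)`
    (ι : E →ₗ[ℝ] C(KineticFluid.Torus, ℝ)) (_hι_inj : Function.Injective ι)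
    (hι : ∃ C : ℝ, ∀ n : E, KineticFluid.W2InftyNormLE (ι n) (C * ‖n‖))
    (T : ℝ) (hT : 0 < T)
    (m : ℝ → E) (hm : KineticFluid.IsCadlagOn T m)
    (f₀ : KineticFluid.L1xv)
    (hf₀ : Integrable (fun z : KineticFluid.Torus × ℝ => (1 + |z.2| ^ 4) * |f₀ z| ^ 2))
    (hf₀' : KineticFluid.HasWeightedIntegrableGradient f₀)
    (η : ℝ) (hη : η ∈ Ioo (3 / 2 : ℝ) 2)
    (u₀ : C(KineticFluid.Torus, ℝ)) (hu₀ : KineticFluid.MemH η u₀) :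
    ∃ (f : ℝ → KineticFluid.L1xv) (u : ℝ → C(KineticFluid.Torus, ℝ)),
      KineticFluid.IsMildSolution T (fun t => ι (m t)) f₀ u₀ f u ∧
      (∀ β ∈ Ioo (3 / 2 : ℝ) η, KineticFluid.ContinuousInH T β u) ∧
      -- uniqueness on `[0,T]`, in each of the classes `C([0,T]; H^β)`
      (∀ β ∈ Ioo (3 / 2 : ℝ) η,
        ∀ (f' : ℝ → KineticFluid.L1xv) (u' : ℝ → C(KineticFluid.Torus, ℝ)),
          KineticFluid.IsMildSolution T (fun t => ι (m t)) f₀ u₀ f' u' →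
          KineticFluid.ContinuousInH T β u' →
          EqOn f' f (Icc 0 T) ∧ EqOn u' u (Icc 0 T)) ∧
      (∀ k : ℝ, 0 ≤ k → KineticFluid.MemG k f₀ → KineticFluid.ContinuousInG T k f) ∧
      (∀ k : ℝ, 0 ≤ k → KineticFluid.MemG0 k f₀ →
        KineticFluid.ContinuousInG T k f ∧ ∀ t ∈ Icc 0 T, KineticFluid.MemG0 k (f t)) := by
  obtain ⟨M₀, L₀, hb⟩ := hm.isAdmissibleField hι
  obtain ⟨f, u, M, L, hw, hf, hu, hc⟩ :=
    KineticFluid.exists_mild_solution hT hb hf₀ hf₀' hη hu₀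
  refine ⟨f, u, ⟨hf, hu⟩, fun β hβ => hc β hβ.2, fun β hβ f' u' h' hc' => ?_,
    fun k hk hG => hf.continuousInG hw hk hG, fun k hk hG => ⟨hf.continuousInG hw hk hG.1,
      fun t ht => hf.memG0 hw hk hG ht⟩⟩
  exact KineticFluid.mild_solution_unique hT hb (KineticFluid.memG_one_of_weighted_sq hf₀) hf₀'
    hf hu h'.1 h'.2 hβ.1 hβ.1 (hc β hβ.2) hc'
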